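/- **Setting.** Let $G$ be a connected, simply connected, simple complex algebraic group with Lie algebra $\mathfrak g$ of rank $r$, opposite Borel subgroups $B_\pm$ with $B_+\cap B_-=H$ a maximal torus, $N_\pm=[B_\pm,B_\pm]$, Chevalley generators $e_i,f_i,\check\alpha_i$ ($1\le i\le r$), simple roots $\alpha_i$, and Cartan matrix $a_{ij}=\langle\alpha_j,\check\alpha_i\rangle$. Let $V_i$ be the irreducible representation whose highest weight is the fundamental weight $\omega_i$, with highest weight vector $\nu_i$, and let $W_i=\mathrm{span}(\nu_i,f_i\nu_i)\subset V_i$, a $B_+$-stable plane. For an algebraic group or a vector space $X$, write $X(z)$ for its $\mathbb C(z)$-points, resp. $X\otimes\mathbb C(z)$. Fix monic polynomials $\Lambda_1,\dots,\Lambda_r\in\mathbb C[z]$ and a semisimple twist $Z^H=\sum_i\zeta_i\check\alpha_i$ with $\zeta_i\in\mathbb C$. **Miura opers.** A Miura $G$-oper on $\mathbb P^1$ with regular singularities determined by the $\Lambda_i$ is a $G$-bundle with a meromorphic connection $\nabla$, a reduction $\mathcal F_{B_-}$ to $B_-$ which has a rational trivialization in which $\nabla=\partial_z+\sum_i\Lambda_ie_i+b(z)$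 with $b(z)\in\mathfrak b_-(z)$, and a reduction $\mathcal F_{B_+}$ to $B_+$ preserved by $\nabla$. These objects are considered over the generic point of $\mathbb P^1$, that is, up to isomorphism given by rational changes of trivialization in $G(z)$. Such an oper is in *standard form* in a rational trivialization in which the two reductions are the standard ones, to $B_-$ and $B_+$, and $\nabla=\partial_z+\sum_ig_i\check\alpha_i+\sum_i\Lambda_ie_i$ with $g_i\in\mathbb C(z)$. **Miura–Plücker data.** A Miura oper as above is $Z^H$-twisted Miura–Plücker if $\mathcal F_{B_+}$ has a rational trivialization in which, for every $i$, the connection induced by $\nabla$ on the rank two bundle associated to $W_i$ is $\partial_z+Z^H|_{W_i}$. A framing is the coset of such a trivialization modulo $H[N_+(z),N_+(z)]$, where $H$ is the group of constant elements of the torus; relative to a trivialization in standard form it is a coset $v(z)H[N_+(z),N_+(z)]$ with $v(z)\in B_+(z)$. A $Z^H$-twisted Miura–Plücker datum is a $Z^H$-twisted Miura–Plücker oper together with a framing. **Nondegeneracy.** Nonzero rational functions $y_1,\dots,y_r$ satisfy condition (N) if the $y_i$ have no multiple zeros or poles in $\mathbb C$, no zero of $\Lambda_i$ is a zero or pole of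 $y_i$, and $y_i,y_j$ have no common zero or pole in $\mathbb C$ (that is, no point is a zero or pole of both) whenever $i\ne j$ and $a_{ij}\neq0$. The datum is nondegenerate if in standard form $g_i=\zeta_i-y_i^{-1}\partial_zy_i$ with $y_1,\dots,y_r$ satisfying (N), and for every $i$ the Miura $SL(2)$-oper $\partial_z+g_i\check\alpha_i+\rho_ie_i$, where $\rho_i=\Lambda_i\prod_{k\ne i}y_k^{-a_{ki}}$, is nondegenerate: $g_i=\zeta_i-y^{-1}\partial_zy$ for a nonzero polynomial $y$ without multiple zeros and without common zeros with $\rho_i$. A polynomial solution $\{q^i_+,q^i_-\}_{i=1}^r$ of the $qq$-system $$q^i_+\,\partial_zq^i_--q^i_-\,\partial_zq^i_++\langle\alpha_i,Z^H\rangle\,q^i_+q^i_-=\Lambda_i\prod_{j\ne i}(q^j_+)^{-a_{ji}},\qquad i=1,\dots,r,$$ is nondegenerate if each $q^i_+$ is monic and the $q^i_+$ satisfy (N). **Theorem.** There is a bijection between the set of isomorphism classes of nondegenerate $Z^H$-twisted Miura–Plücker data and the set of nondegenerate polynomial solutions of the $qq$-system. Under this bijection, if a datum corresponds to $\{q^i_+,q^i_-\}$,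 then it can be brought to standard form, and in every standard form the connection is $$\nabla=\partial_z+\sum_i\bigl(\zeta_i-(q^i_+)^{-1}\partial_zq^i_+\bigr)\check\alpha_i+\sum_i\Lambda_ie_i,$$ the framing is the coset of $\prod_i(q^i_+)^{\check\alpha_i}\prod_i\exp\bigl(-\tfrac{q^i_-}{q^i_+}e_i\bigr)$ (the factors of the second product being taken in any order), and if $\prod_iy_i^{\check\alpha_i}\,n$ with monic polynomials $y_i$ and $n\in N_+(z)$ lies in the framing coset, then $y_i=q^i_+$ for all $i$. -/

import Mathlib

open scoped TensorProduct Polynomial Pointwise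

noncomputable section

set_option linter.unusedSectionVars false

namespace TwistedOper

/-! ### Rational functions -/

/-- The quotient-rule expression for a representation `p / q` of a rational function. -/
def quotRule (p q : ℂ[X]) : RatFunc ℂ :=
  algebraMap ℂ[X] (RatFunc ℂ) (Polynomial.derivative p * q - p * Polynomial.derivative q) /
    algebraMap ℂ[X] (RatFunc ℂ) (q ^ 2)

theorem quotRule_eq_of_div_eq {p q r s : ℂ[X]} (hq : q ≠ 0) (hs : s ≠ 0)
    (h : algebraMap ℂ[X] (RatFunc ℂ) p / algebraMap ℂ[X] (RatFunc ℂ) q =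
      algebraMap ℂ[X] (RatFunc ℂ) r / algebraMap ℂ[X] (RatFunc ℂ) s) :
    quotRule p q = quotRule r s := by
  have hq' : algebraMap ℂ[X] (RatFunc ℂ) q ≠ 0 := RatFunc.algebraMap_ne_zero hq
  have hs' : algebraMap ℂ[X] (RatFunc ℂ) s ≠ 0 := RatFunc.algebraMap_ne_zero hs
  rw [div_eq_div_iff hq' hs', ← map_mul, ← map_mul] at h
  have h1 : p * s = r * q := RatFunc.algebraMap_injective ℂ h
  have h2 := congrArg Polynomial.derivative h1
  rw [Polynomial.derivative_mul, Polynomial.derivative_mul] at h2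
  unfold quotRule
  rw [div_eq_div_iff (RatFunc.algebraMap_ne_zero (pow_ne_zero 2 hq))
    (RatFunc.algebraMap_ne_zero (pow_ne_zero 2 hs)), ← map_mul, ← map_mul]
  refine congrArg _ ?_
  generalize Polynomial.derivative p = p' at h2 ⊢
  generalize Polynomial.derivative q = q' at h2 ⊢
  generalize Polynomial.derivative r = r' at h2 ⊢
  generalize Polynomial.derivative s = s' at h2 ⊢
  linear_combination (q * s) * h2 - (q * s' + s * q') * h1

/-- The derivation `∂_z` of the field `ℂ(z)`, as a `ℂ`-linear map. -/
def ddz : RatFunc ℂ →ₗ[ℂ] RatFunc ℂ where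
  toFun f := quotRule f.num f.denom
  map_add' f g := by
    have hf := f.denom_ne_zero
    have hg := g.denom_ne_zero
    have hf' : algebraMap ℂ[X] (RatFunc ℂ) f.denom ≠ 0 := RatFunc.algebraMap_ne_zero hf
    have hg' : algebraMap ℂ[X] (RatFunc ℂ) g.denom ≠ 0 := RatFunc.algebraMap_ne_zero hg
    have key : quotRule (f + g).num (f + g).denom =
        quotRule (f.num * g.denom + f.denom * g.num) (f.denom * g.denom) := by
      apply quotRule_eq_of_div_eq (f + g).denom_ne_zero (mul_ne_zero hf hg)
      rw [RatFunc.num_div_denom, map_add, map_mul, map_mul, map_mul, ← div_add_div _ _ hf' hg',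
        RatFunc.num_div_denom, RatFunc.num_div_denom]
    rw [key]
    unfold quotRule
    simp only [Polynomial.derivative_mul, map_mul, map_add, map_sub,
      map_pow]
    field_simp
    ring
  map_smul' c f := by
    have hf := f.denom_ne_zero
    have key : quotRule (c • f).num (c • f).denom =
        quotRule (c • f.num) f.denom := by
      apply quotRule_eq_of_div_eq (c • f).denom_ne_zero hf
      rw [RatFunc.num_div_denom, Polynomial.smul_eq_C_mul, map_mul, mul_div_assoc,
        RatFunc.num_div_denom, RatFunc.algebraMap_C, RatFunc.smul_eq_C_mul]
    rw [key]
    unfold quotRule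
    rw [Polynomial.derivative_smul, smul_mul_assoc, smul_mul_assoc, ← smul_sub,
      Polynomial.smul_eq_C_mul, map_mul, mul_div_assoc, RatFunc.algebraMap_C,
      RatFunc.smul_eq_C_mul, RingHom.id_apply]

/-- `c` is a zero of the rational function `y`. -/
def IsZeroAt (y : RatFunc ℂ) (c : ℂ) : Prop := y.num.IsRoot c

/-- `c` is a pole of the rational function `y`. -/
def IsPoleAt (y : RatFunc ℂ) (c : ℂ) : Prop := y.denom.IsRoot c

/-- The polynomial `p`, seen as a rational function. -/
abbrev ratOf (p : ℂ[X]) : RatFunc ℂ := algebraMap ℂ[X] (RatFunc ℂ) p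

/-! ### Nondegeneracy conditions on tuples of rational functions

`a` is the Cartan matrix, with `a i j = ⟨α_j, α̌_i⟩`. -/

/-- The conditions imposed on the nonzero rational functions `y_i`: no multiple zeros or poles;
the zeros of `Λ_i` are neither zeros nor poles of `y_i`; and if `i ≠ j` and `a_ij ≠ 0`, then
`y_i` and `y_j` have no zero or pole in common. -/
structure HNondegenerate {ι : Type*} (a : Matrix ι ι ℤ) (Λ y : ι → RatFunc ℂ) : Prop where
  ne_zero : ∀ i, y i ≠ 0
  simple_zero : ∀ i c, (y i).num.rootMultiplicity c ≤ 1
  simple_pole : ∀ i c, (y i).denom.rootMultiplicity c ≤ 1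
  disjoint_sing : ∀ i c, IsZeroAt (Λ i) c → ¬ IsZeroAt (y i) c ∧ ¬ IsPoleAt (y i) c
  disjoint_adj : ∀ i j, i ≠ j → a i j ≠ 0 → ∀ c,
    ¬ ((IsZeroAt (y i) c ∨ IsPoleAt (y i) c) ∧ (IsZeroAt (y j) c ∨ IsPoleAt (y j) c))

/-- Nondegeneracy of the `ζα̌`-twisted Miura `SL(2)`-oper `∂_z + g α̌ + ρ e`: the Cartan connection
is `∂_z + (ζ - y⁻¹ ∂_z y) α̌`, the oper is `H`-nondegenerate for the Cartan matrix `(2)`, and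
the rational function `y` is a polynomial. -/
def SL2Nondegenerate (ζ : ℂ) (ρ g : RatFunc ℂ) : Prop :=
  ∃ y : RatFunc ℂ, g = RatFunc.C ζ - y⁻¹ * ddz y ∧
    HNondegenerate (ι := Unit) (fun _ _ => 2) (fun _ => ρ) (fun _ => y) ∧
    ∃ p : ℂ[X], y = ratOf p

section Lie

variable {ι : Type*} [Fintype ι] [DecidableEq ι]
  {𝔤 : Type*} [LieRing 𝔤] [LieAlgebra ℂ 𝔤] {𝔥 : LieSubalgebra ℂ 𝔤}
  (b : LieAlgebra.Basis ι 𝔥)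

/-- The Cartan matrix in the convention `a_ij = ⟨α_j, α̌_i⟩`, that is
`[α̌_i, e_j] = a_ij e_j`. -/
def cartan : Matrix ι ι ℤ := fun i j => b.A j i

/-- The value `⟨α_i, Z⟩` for `Z = ∑ j, ζ_j α̌_j`. -/
def rootValue (ζ : ι → ℂ) (i : ι) : ℂ := ∑ j, (cartan b j i : ℂ) * ζ j

/-- The Lie algebra `𝔫_+` generated by the `e_i`. -/
def nPlus : LieSubalgebra ℂ 𝔤 := LieSubalgebra.lieSpan ℂ 𝔤 (Set.range b.e)

/-- The Lie algebra `𝔫_-` generated by the `f_i`. -/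
def nMinus : LieSubalgebra ℂ 𝔤 := LieSubalgebra.lieSpan ℂ 𝔤 (Set.range b.f)

/-- The Borel subalgebra `𝔟_+` generated by the `e_i` and the `α̌_i`. -/
def bPlus : LieSubalgebra ℂ 𝔤 := LieSubalgebra.lieSpan ℂ 𝔤 (Set.range b.e ∪ Set.range b.h)

/-- The Borel subalgebra `𝔟_-` generated by the `f_i` and the `α̌_i`. -/
def bMinus : LieSubalgebra ℂ 𝔤 := LieSubalgebra.lieSpan ℂ 𝔤 (Set.range b.f ∪ Set.range b.h)

/-- The space `𝔩(z) = ℂ(z) ⊗ 𝔩` inside `𝔤(z)`, for a subalgebra `𝔩` of `𝔤`. -/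
abbrev ofRat (𝔩 : LieSubalgebra ℂ 𝔤) : Submodule (RatFunc ℂ) (RatFunc ℂ ⊗[ℂ] 𝔤) :=
  𝔩.toSubmodule.baseChange (RatFunc ℂ)

/-- The constant element `Z = ∑ i, ζ_i α̌_i` of `𝔥 ⊆ 𝔤(z)`. -/
def twist (ζ : ι → ℂ) : RatFunc ℂ ⊗[ℂ] 𝔤 := 1 ⊗ₜ[ℂ] (∑ i, ζ i • b.h i)

/-- The element `∑ g_i α̌_i + ∑ Λ_i e_i` of `𝔤(z)`. -/
def miuraMatrix (g Λ : ι → RatFunc ℂ) : RatFunc ℂ ⊗[ℂ] 𝔤 :=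
  ∑ i, g i ⊗ₜ[ℂ] b.h i + ∑ i, Λ i ⊗ₜ[ℂ] b.e i

/-- The rational function `ρ_i = Λ_i ∏_{k ≠ i} y_k ^ (-a_ki)`. -/
def rho (Λ y : ι → RatFunc ℂ) (i : ι) : RatFunc ℂ :=
  Λ i * ∏ k ∈ Finset.univ.erase i, y k ^ (-cartan b k i)

/-! ### The `qq`-system -/

/-- The nondegenerate polynomial solutions of the `qq`-system. The exponents `-a_ji`, `j ≠ i`,
are nonnegative integers. -/
@[ext] structure NondegSolution (Λ : ι → ℂ[X]) (ζ : ι → ℂ) where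
  /-- the polynomials `q^i_+` -/
  qp : ι → ℂ[X]
  /-- the polynomials `q^i_-` -/
  qm : ι → ℂ[X]
  qq : ∀ i, (qp i * Polynomial.derivative (qm i) - qm i * Polynomial.derivative (qp i)) +
      Polynomial.C (rootValue b ζ i) * (qp i * qm i) =
    Λ i * ∏ j ∈ Finset.univ.erase i, qp j ^ (-cartan b j i).toNat
  monic : ∀ i, (qp i).Monic
  nondeg : HNondegenerate (cartan b) (fun i => ratOf (Λ i)) (fun i => ratOf (qp i))

/-! ### The group `G(z)` of rational points and its subgroups

The simply connected group with Lie algebra `𝔤` is realized, as usual for Chevalley groups, inside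
the product of the `GL(V_i)`, where `V_i` are the fundamental representations; it acts faithfully
on their sum. -/

variable (V : ι → Type*) [∀ i, AddCommGroup (V i)] [∀ i, Module ℂ (V i)]
  [∀ i, LieRingModule 𝔤 (V i)] [∀ i, LieModule ℂ 𝔤 (V i)]

/-- Highest weight vectors `ν_i ∈ V_i` of weight `ω_i`, where `⟨ω_i, α̌_j⟩ = δ_ij`. If `V_i` is
irreducible, then it is the fundamental representation with highest weight `ω_i`. -/
structure FundamentalVectors where
  /-- the highest weight vectors -/
  ν : ∀ i, V i
  ne_zero : ∀ i, ν i ≠ 0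
  e_lie : ∀ i j, ⁅b.e j, ν i⁆ = 0
  h_lie : ∀ i j, ⁅b.h j, ν i⁆ = (if j = i then (1 : ℂ) else 0) • ν i

/-- The product of the groups `GL(V_i)(ℂ(z))`. -/
abbrev Ambient : Type _ := ∀ i, (Module.End (RatFunc ℂ) (RatFunc ℂ ⊗[ℂ] V i))ˣ

open scoped Classical in
/-- The exponential of an element of `𝔤(z)` that acts nilpotently on the `V_i`. (On other
elements, where it is not used, it has the value `1` in the factors concerned.) -/
def expo (x : RatFunc ℂ ⊗[ℂ] 𝔤) : Ambient V := fun i =>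
  if h : IsNilpotent (LieModule.toEnd (RatFunc ℂ) (RatFunc ℂ ⊗[ℂ] 𝔤) (RatFunc ℂ ⊗[ℂ] V i) x) then
    (IsNilpotent.isUnit_exp h).unit
  else 1

/-- `N_+(z)`, generated by the exponentials of the elements of `𝔫_+(z)`. -/
def NPlus : Subgroup (Ambient V) :=
  Subgroup.closure (expo V '' (ofRat (nPlus b) : Set (RatFunc ℂ ⊗[ℂ] 𝔤)))

/-- `N_-(z)`, generated by the exponentials of the elements of `𝔫_-(z)`. -/
def NMinus : Subgroup (Ambient V) :=
  Subgroup.closure (expo V '' (ofRat (nMinus b) : Set (RatFunc ℂ ⊗[ℂ] 𝔤)))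

/-- `t` is the element `∏ y_j ^ α̌_j` of the maximal torus: it acts on the vectors of weight `μ`
as multiplication by `∏ y_j ^ ⟨μ, α̌_j⟩`. -/
def IsTorusElement (y : ι → RatFunc ℂ) (t : Ambient V) : Prop :=
  ∀ (i : ι) (m : ι → ℤ) (v : V i), (∀ j, ⁅b.h j, v⁆ = (m j : ℂ) • v) →
    (t i : Module.End (RatFunc ℂ) (RatFunc ℂ ⊗[ℂ] V i)) (1 ⊗ₜ[ℂ] v) =
      (∏ j, y j ^ m j) • (1 ⊗ₜ[ℂ] v)

variable {b V} in
theorem IsTorusElement.one : IsTorusElement b V (fun _ => 1) 1 := by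
  intro i m v _
  simp

variable {b V} in
theorem IsTorusElement.mul {y y' : ι → RatFunc ℂ} {t t' : Ambient V}
    (h : IsTorusElement b V y t) (h' : IsTorusElement b V y' t') :
    IsTorusElement b V (fun j => y j * y' j) (t * t') := by
  intro i m v hv
  simp only [Pi.mul_apply, Units.val_mul, Module.End.mul_apply]
  rw [h' i m v hv, map_smul, h i m v hv, smul_smul, ← Finset.prod_mul_distrib]
  congr 1
  exact Finset.prod_congr rfl fun j _ => by rw [mul_comm, mul_zpow]

variable {b V} in
theorem IsTorusElement.inv {y : ι → RatFunc ℂ} {t : Ambient V} (hy : ∀ j, y j ≠ 0)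
    (h : IsTorusElement b V y t) : IsTorusElement b V (fun j => (y j)⁻¹) t⁻¹ := by
  intro i m v hv
  have h0 : ∏ j, y j ^ m j ≠ 0 := Finset.prod_ne_zero_iff.2 fun j _ => zpow_ne_zero _ (hy j)
  have h1 := congrArg (fun x => (∏ j, (y j)⁻¹ ^ m j) •
    ((t⁻¹ i : (Module.End (RatFunc ℂ) (RatFunc ℂ ⊗[ℂ] V i))ˣ) :
      Module.End (RatFunc ℂ) (RatFunc ℂ ⊗[ℂ] V i)) x) (h i m v hv)
  simp only [map_smul, smul_smul] at h1
  rw [← Module.End.mul_apply, ← Units.val_mul, ← Pi.mul_apply, inv_mul_cancel, Pi.one_apply,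
    Units.val_one, Module.End.one_apply] at h1
  simp only [inv_zpow, Finset.prod_inv_distrib] at h1 ⊢
  rw [h1, inv_mul_cancel₀ h0, one_smul]

/-- `H(z)`, the maximal torus. -/
def torus : Subgroup (Ambient V) where
  carrier := {t | ∃ y : ι → RatFunc ℂ, (∀ j, y j ≠ 0) ∧ IsTorusElement b V y t}
  one_mem' := ⟨fun _ => 1, fun _ => one_ne_zero, .one⟩
  mul_mem' := by
    rintro t t' ⟨y, hy, h⟩ ⟨y', hy', h'⟩
    exact ⟨_, fun j => mul_ne_zero (hy j) (hy' j), h.mul h'⟩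
  inv_mem' := by
    rintro t ⟨y, hy, h⟩
    exact ⟨_, fun j => inv_ne_zero (hy j), h.inv hy⟩

/-- `H`, the group of constant elements of the maximal torus. -/
def constTorus : Subgroup (Ambient V) where
  carrier := {t | ∃ c : ι → ℂ, (∀ j, c j ≠ 0) ∧ IsTorusElement b V (fun j => RatFunc.C (c j)) t}
  one_mem' := ⟨fun _ => 1, fun _ => one_ne_zero, by simpa using IsTorusElement.one⟩
  mul_mem' := by
    rintro t t' ⟨y, hy, h⟩ ⟨y', hy', h'⟩
    exact ⟨fun j => y j * y' j, fun j => mul_ne_zero (hy j) (hy' j), by simpa using h.mul h'⟩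
  inv_mem' := by
    rintro t ⟨y, hy, h⟩
    refine ⟨fun j => (y j)⁻¹, fun j => inv_ne_zero (hy j), ?_⟩
    have h' := h.inv fun j => by simpa using hy j
    simpa using h'

/-- `B_+(z) = H(z) N_+(z)`. -/
def BPlus : Subgroup (Ambient V) := torus b V ⊔ NPlus b V

/-- `B_-(z) = H(z) N_-(z)`. -/
def BMinus : Subgroup (Ambient V) := torus b V ⊔ NMinus b V

/-- `G(z)`. The `ℂ(z)`-points of a split simply connected group are generated by those of two
opposite Borel subgroups. -/
def GRat : Subgroup (Ambient V) := BPlus b V ⊔ BMinus b V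

/-- The group `H[N_+(z), N_+(z)]`. -/
def framingGroup : Subgroup (Ambient V) := constTorus b V ⊔ ⁅NPlus b V, NPlus b V⁆

/-! ### Connections and opers

On `ℙ¹` a `G`-bundle with reductions to `B_-` and `B_+` is trivial over a dense open subset, and
meromorphic connections are considered up to rational changes of trivialization. So the bundle is
trivialized at the generic point; a meromorphic connection is `∂_z + A` with `A ∈ 𝔤(z)`, a reduction
to a Borel subgroup `B` is a left coset of `B(z)` in `G(z)` (its rational trivializations), and
isomorphisms are given by `G(z)`. -/

variable {V}

/-- The connection `∂_z + A` on the vector bundle associated to `V_i`. -/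
def conn (A : RatFunc ℂ ⊗[ℂ] 𝔤) (i : ι) (x : RatFunc ℂ ⊗[ℂ] V i) : RatFunc ℂ ⊗[ℂ] V i :=
  ddz.rTensor (V i) x + ⁅A, x⁆

/-- `∂_z + A' = g (∂_z + A) g⁻¹`. -/
def IsGauge (g : Ambient V) (A A' : RatFunc ℂ ⊗[ℂ] 𝔤) : Prop :=
  ∀ (i : ι) (x : RatFunc ℂ ⊗[ℂ] V i),
    (g i : Module.End (RatFunc ℂ) (RatFunc ℂ ⊗[ℂ] V i)) (conn A i x) =
      conn A' i ((g i : Module.End (RatFunc ℂ) (RatFunc ℂ ⊗[ℂ] V i)) x)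

theorem IsGauge.refl (A : RatFunc ℂ ⊗[ℂ] 𝔤) : IsGauge (1 : Ambient V) A A := by
  intro i x
  simp

theorem IsGauge.symm {g : Ambient V} {A A' : RatFunc ℂ ⊗[ℂ] 𝔤} (h : IsGauge g A A') :
    IsGauge g⁻¹ A' A := by
  intro i x
  have h1 : (g i : Module.End (RatFunc ℂ) (RatFunc ℂ ⊗[ℂ] V i))
      ((g⁻¹ i : (Module.End (RatFunc ℂ) (RatFunc ℂ ⊗[ℂ] V i))ˣ).val x) = x := by
    rw [Pi.inv_apply, ← Module.End.mul_apply, Units.mul_inv, Module.End.one_apply]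
  have h2 := h i ((g⁻¹ i : (Module.End (RatFunc ℂ) (RatFunc ℂ ⊗[ℂ] V i))ˣ).val x)
  rw [h1] at h2
  rw [← h2, Pi.inv_apply, ← Module.End.mul_apply, Units.inv_mul, Module.End.one_apply]

theorem IsGauge.trans {g g' : Ambient V} {A A' A'' : RatFunc ℂ ⊗[ℂ] 𝔤} (h : IsGauge g A A')
    (h' : IsGauge g' A' A'') : IsGauge (g' * g) A A'' := by
  intro i x
  simp only [Pi.mul_apply, Units.val_mul, Module.End.mul_apply]
  rw [h i x, h' i]

/-- In some trivialization of the `B_-`-reduction `F` the connection is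
`∂_z + ∑ φ_i e_i + β` with `β ∈ 𝔟_-(z)`. -/
def HasOperForm (φ : ι → RatFunc ℂ) (A : RatFunc ℂ ⊗[ℂ] 𝔤) (F : Set (Ambient V)) : Prop :=
  ∃ p ∈ F, ∃ β ∈ ofRat (bMinus b), IsGauge p (∑ i, φ i ⊗ₜ[ℂ] b.e i + β) A

variable (V)

/-- A Miura `G`-oper: a meromorphic connection `∂_z + A` together with a reduction to `B_-`, for
which it is an oper, and a reduction to `B_+`, which it preserves. -/
structure MiuraOper where
  /-- the connection matrix -/
  A : RatFunc ℂ ⊗[ℂ] 𝔤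
  /-- the reduction to `B_-` -/
  Fminus : Set (Ambient V)
  /-- the reduction to `B_+` -/
  Fplus : Set (Ambient V)
  fminus_coset : ∃ p ∈ GRat b V, Fminus = p • (BMinus b V : Set (Ambient V))
  fplus_coset : ∃ p ∈ GRat b V, Fplus = p • (BPlus b V : Set (Ambient V))
  oper : ∃ φ : ι → RatFunc ℂ, (∀ i, φ i ≠ 0) ∧ HasOperForm b φ A Fminus
  preserved : ∃ p ∈ Fplus, ∃ β ∈ ofRat (bPlus b), IsGauge p β A

variable {b V}

/-- The Miura oper has regular singularities determined by the polynomials `Λ_i`. -/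
def MiuraOper.HasRegularSingularities (O : MiuraOper b V) (Λ : ι → ℂ[X]) : Prop :=
  HasOperForm b (fun i => ratOf (Λ i)) O.A O.Fminus

/-- `a` is a change of trivialization after which the two reductions are the standard ones and
the connection is `∂_z + ∑ g_i α̌_i + ∑ Λ_i e_i`. -/
structure MiuraOper.IsStandardForm (O : MiuraOper b V) (Λ : ι → ℂ[X]) (a : Ambient V)
    (g : ι → RatFunc ℂ) : Prop where
  mem : a ∈ GRat b V
  gauge : IsGauge a O.A (miuraMatrix b g fun i => ratOf (Λ i))
  fminus : a • O.Fminus = (BMinus b V : Set (Ambient V))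
  fplus : a • O.Fplus = (BPlus b V : Set (Ambient V))

/-- Nondegeneracy: the associated Cartan connection `∂_z + ∑ g_i α̌_i` has the form
`∂_z + ∑ (ζ_i - y_i⁻¹ ∂_z y_i) α̌_i` where the `y_i` satisfy the conditions of
`H`-nondegeneracy, and the associated `ζ_i α̌_i`-twisted Miura `SL(2)`-opers
`∂_z + g_i α̌_i + ρ_i e_i` are nondegenerate. -/
def MiuraOper.Nondegenerate (O : MiuraOper b V) (Λ : ι → ℂ[X]) (ζ : ι → ℂ) : Prop :=
  ∃ (a : Ambient V) (g y : ι → RatFunc ℂ), O.IsStandardForm Λ a g ∧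
    (∀ i, g i = RatFunc.C (ζ i) - (y i)⁻¹ * ddz (y i)) ∧
    HNondegenerate (cartan b) (fun i => ratOf (Λ i)) y ∧
    ∀ i, SL2Nondegenerate (ζ i) (rho b (fun i => ratOf (Λ i)) y i) (g i)

/-- The plane `W_i ⊆ V_i` spanned by `ν_i` and `f_i ν_i`, with coefficients in `ℂ(z)`. -/
def FundamentalVectors.plane (ν : FundamentalVectors b V) (i : ι) :
    Submodule (RatFunc ℂ) (RatFunc ℂ ⊗[ℂ] V i) :=
  (Submodule.span ℂ {ν.ν i, ⁅b.f i, ν.ν i⁆}).baseChange (RatFunc ℂ)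

/-- `t` is a trivialization of the `B_+`-reduction in which the connection induced by `∂_z + A` on
the rank two bundle associated to `W_i` is `∂_z + Z|_{W_i}`, for all `i`, where
`Z = ∑ ζ_j α̌_j`. -/
def MiuraOper.IsPluckerTrivialization (O : MiuraOper b V) (ν : FundamentalVectors b V)
    (ζ : ι → ℂ) (t : Ambient V) : Prop :=
  t ∈ O.Fplus ∧ ∀ i, ∀ w ∈ ν.plane i,
    conn O.A i ((t i : Module.End (RatFunc ℂ) (RatFunc ℂ ⊗[ℂ] V i)) w) =
      (t i : Module.End (RatFunc ℂ) (RatFunc ℂ ⊗[ℂ] V i)) (conn (twist b ζ) i w)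

/-- A `Z`-twisted Miura-Plücker datum, `Z = ∑ ζ_i α̌_i`: a Miura oper with regular singularities
determined by the `Λ_i`, and a framing, that is the coset modulo `H[N_+(z), N_+(z)]` of a
trivialization of the `B_+`-reduction in which the connections on the rank two bundles
are constant, equal to `Z`. -/
structure MPDatum (ν : FundamentalVectors b V) (Λ : ι → ℂ[X]) (ζ : ι → ℂ)
    extends MiuraOper b V where
  regular : toMiuraOper.HasRegularSingularities Λ
  /-- the framing -/
  framing : Set (Ambient V)
  framing_coset : ∃ t, toMiuraOper.IsPluckerTrivialization ν ζ t ∧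
    framing = t • (framingGroup b V : Set (Ambient V))

/-- Isomorphism of Miura-Plücker data: a change of trivialization by an element of `G(z)`. -/
instance mpSetoid (ν : FundamentalVectors b V) (Λ : ι → ℂ[X]) (ζ : ι → ℂ) :
    Setoid (MPDatum ν Λ ζ) where
  r D D' := ∃ a ∈ GRat b V, IsGauge a D.A D'.A ∧ D'.Fminus = a • D.Fminus ∧
    D'.Fplus = a • D.Fplus ∧ D'.framing = a • D.framing
  iseqv :=
    { refl := fun D => ⟨1, one_mem _, .refl _, by simp, by simp, by simp⟩
      symm := by
        rintro D D' ⟨a, ha, h, h1, h2, h3⟩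
        exact ⟨a⁻¹, inv_mem ha, h.symm, by simp [h1], by simp [h2], by simp [h3]⟩
      trans := by
        rintro D D' D'' ⟨a, ha, h, h1, h2, h3⟩ ⟨a', ha', h', h1', h2', h3'⟩
        exact ⟨a' * a, mul_mem ha' ha, h.trans h', by rw [h1', h1, mul_smul],
          by rw [h2', h2, mul_smul], by rw [h3', h3, mul_smul]⟩ }

/-- The nondegenerate Miura-Plücker data. -/
abbrev NondegDatum (ν : FundamentalVectors b V) (Λ : ι → ℂ[X]) (ζ : ι → ℂ) : Type _ :=
  {D : MPDatum ν Λ ζ // D.Nondegenerate Λ ζ}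

/-- The nondegenerate Miura-Plücker data up to isomorphism. -/
abbrev NondegDatumClass (ν : FundamentalVectors b V) (Λ : ι → ℂ[X]) (ζ : ι → ℂ) : Type _ :=
  Quotient ((mpSetoid ν Λ ζ).comap (Subtype.val : NondegDatum ν Λ ζ → MPDatum ν Λ ζ))

/-- The isomorphism class of a nondegenerate Miura-Plücker datum. -/
def NondegDatum.cls {ν : FundamentalVectors b V} {Λ : ι → ℂ[X]} {ζ : ι → ℂ}
    (D : NondegDatum ν Λ ζ) : NondegDatumClass ν Λ ζ := Quotient.mk _ D

end Lie

end TwistedOper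

end

/-!
The point is that all the data in the theorem can be read off from the action on the planes `W_i`.
An element `t` of `B_+(z)` sends `ν_i` to `y_i ν_i`, and `f_i ν_i` to a multiple of itself,
determined by the `y_j`, plus `y_i c_i ν_i` (`ActsBy`). In these coordinates the Plücker condition
on a trivialization of an oper in standard form becomes (`plucker_iff`)
`g_i = ζ_i - y_i⁻¹ ∂_z y_i`, together with a first-order linear differential equation for `c_i`.
With `y_i = q^i_+` and `c_i = -q^i_- / q^i_+` that equation is the `i`-th equation of the `qq`-system
(`pluckerEq_snd_iff`, `qq_iff`). So one has to see that the coordinates of the framing determine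
the datum, and that nondegeneracy makes them polynomial.

The coordinates determine the framing: two elements of `B_+(z)` with the same coordinates are
congruent modulo `[N_+(z), N_+(z)]` (`inv_mul_mem_commutator_of_actsBy`), since `N_+(z)` is
generated by exponentials, which are additive modulo the derived group, and since the exponentials
of the derived algebra lie in the derived group. The last two facts are consequences of one
statement about a nilpotent Lie algebra of nilpotent elements of a ring
(`IsUnipotentLie.curvesEndInCommutator`): a polynomial curve of units that starts at `1` and whose
logarithmic derivative has coefficients in the derived algebra ends in the derived group. It is
proved by descending induction on the lower central series; the leading terms of the logarithmic
derivative are cancelled by curves `exp(t ^ m [x, w])`, and `exp [x, w]` differs from the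
commutator of `exp x` and `exp w` by the end of a curve that lies deeper in the series. Thus no
Baker-Campbell-Hausdorff formula is needed.

The standard form is nearly unique: a change of trivialization between two standard forms lies in
`B_+(z) ∩ B_-(z)` and fixes the coefficients `Λ_i`, so it is a torus element on which all simple
roots are `1`; as the Cartan matrix is invertible, its coordinates are roots of unity, hence
constants (`MiuraOper.IsStandardForm.actsBy_mul_inv`). The constants are absorbed by the group `H`
in the definition of the framing, so the framing has the same coordinates in all standard forms up
to constants, and the coordinates `y_i` are unique once they are monic polynomials.

Polynomiality: `g_i` determines `y_i` up to a constant, and by `SL(2)`-nondegeneracy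
`ζ_i - g_i` is the logarithmic derivative of a polynomial. The equation for `c_i` then shows that `c_i`
has at most simple poles, located at the simple zeros of `q^i_+`
(`exists_polynomial_of_ddz_add_eq`), so `q^i_- = -c_i q^i_+` is a polynomial.
-/


noncomputable section

set_option linter.unusedSectionVars false

namespace TwistedOper

/-! ### Rational functions: the derivation and logarithmic derivatives -/

theorem ddz_eq_quotRule {f : RatFunc ℂ} {p q : ℂ[X]} (hq : q ≠ 0) (h : f = ratOf p / ratOf q) :
    ddz f = quotRule p q := by
  refine quotRule_eq_of_div_eq f.denom_ne_zero hq ?_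
  rw [RatFunc.num_div_denom, h]

theorem ratOf_mul (p q : ℂ[X]) : ratOf (p * q) = ratOf p * ratOf q := map_mul _ p q

theorem exists_eq_ratOf_div (f : RatFunc ℂ) : ∃ p q : ℂ[X], q ≠ 0 ∧ f = ratOf p / ratOf q :=
  ⟨f.num, f.denom, f.denom_ne_zero, f.num_div_denom.symm⟩

theorem ddz_mul (f g : RatFunc ℂ) : ddz (f * g) = ddz f * g + f * ddz g := by
  obtain ⟨a, b, hb, rfl⟩ := exists_eq_ratOf_div f
  obtain ⟨c, d, hd, rfl⟩ := exists_eq_ratOf_div g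
  have hb' : ratOf b ≠ 0 := RatFunc.algebraMap_ne_zero hb
  have hd' : ratOf d ≠ 0 := RatFunc.algebraMap_ne_zero hd
  rw [ddz_eq_quotRule (p := a * c) (q := b * d) (mul_ne_zero hb hd)
      (by rw [ratOf_mul, ratOf_mul, mul_div_mul_comm]),
    ddz_eq_quotRule hb rfl, ddz_eq_quotRule hd rfl]
  unfold quotRule
  simp only [Polynomial.derivative_mul, map_mul, map_add, map_sub, map_pow]
  field_simp
  ring

/-- `∂_z` as a derivation of the field `ℂ(z)`. -/
def ddzDerivation : Derivation ℂ (RatFunc ℂ) (RatFunc ℂ) :=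
  Derivation.mk' ddz fun f g => by rw [ddz_mul, smul_eq_mul, smul_eq_mul]; ring

@[simp] theorem ddzDerivation_apply (f : RatFunc ℂ) : ddzDerivation f = ddz f := rfl

theorem ratFunc_C_eq_algebraMap (c : ℂ) : RatFunc.C c = algebraMap ℂ (RatFunc ℂ) c := by
  rw [RatFunc.algebraMap_eq_C]

@[simp] theorem ddz_C (c : ℂ) : ddz (RatFunc.C c) = 0 := by
  rw [ratFunc_C_eq_algebraMap]
  exact ddzDerivation.map_algebraMap c

@[simp] theorem ddz_one : ddz 1 = 0 := ddzDerivation.map_one_eq_zero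

/-- The kernel of `∂_z` consists of the constants. -/
theorem eq_C_of_ddz_eq_zero {f : RatFunc ℂ} (h : ddz f = 0) : ∃ c : ℂ, f = RatFunc.C c := by
  have hd := f.denom_ne_zero
  have h1 : f.num.derivative * f.denom - f.num * f.denom.derivative = 0 := by
    have h2 : quotRule f.num f.denom = 0 := h
    rw [quotRule, div_eq_zero_iff] at h2
    rcases h2 with h2 | h2
    · exact (map_eq_zero_iff _ (RatFunc.algebraMap_injective ℂ)).1 h2
    · exact absurd h2 (RatFunc.algebraMap_ne_zero (pow_ne_zero 2 hd))
  have hco : IsCoprime f.denom f.num := f.isCoprime_num_denom.symm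
  have h3 : f.denom ∣ f.denom.derivative :=
    hco.dvd_of_dvd_mul_left ⟨f.num.derivative, by linear_combination -h1⟩
  have h4 : f.denom.derivative = 0 := by
    by_contra hne
    exact absurd (Polynomial.degree_le_of_dvd h3 hne)
      (not_le.2 (Polynomial.degree_derivative_lt hd))
  have h5 : f.num.derivative = 0 := by
    rw [h4, mul_zero, sub_zero] at h1
    exact (mul_eq_zero.1 h1).resolve_right hd
  have h6 := Polynomial.eq_C_of_derivative_eq_zero h4
  have h7 := Polynomial.eq_C_of_derivative_eq_zero h5
  refine ⟨f.num.coeff 0 / f.denom.coeff 0, ?_⟩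
  rw [map_div₀, ← RatFunc.algebraMap_C, ← RatFunc.algebraMap_C, ← h6, ← h7, RatFunc.num_div_denom]

theorem exists_C_mul_of_logDeriv_eq {f g : RatFunc ℂ} (hf : f ≠ 0) (hg : g ≠ 0)
    (h : f⁻¹ * ddz f = g⁻¹ * ddz g) : ∃ c : ℂ, c ≠ 0 ∧ f = RatFunc.C c * g := by
  have h1 : ddz (f / g) = 0 := by
    have h2 := ddzDerivation.leibniz_div f g
    simp only [ddzDerivation_apply, smul_eq_mul] at h2
    rw [h2]
    field_simp at h ⊢
    linear_combination h
  obtain ⟨c, hc⟩ := eq_C_of_ddz_eq_zero h1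
  refine ⟨c, ?_, ?_⟩
  · rintro rfl
    rw [map_zero, div_eq_zero_iff] at hc
    exact hc.elim hf hg
  · rw [← hc, div_mul_cancel₀ _ hg]

/-- Roots of unity in `ℂ(z)` are constant. -/
theorem eq_C_of_pow_eq_one {f : RatFunc ℂ} {n : ℕ} (hn : n ≠ 0) (h : f ^ n = 1) :
    ∃ c : ℂ, c ≠ 0 ∧ f = RatFunc.C c := by
  have hf : f ≠ 0 := by
    rintro rfl
    rw [zero_pow hn] at h
    exact zero_ne_one h
  have h1 := ddzDerivation.leibniz_pow f n
  rw [h, ddzDerivation.map_one_eq_zero, ddzDerivation_apply, smul_eq_mul, nsmul_eq_mul, eq_comm,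
    mul_eq_zero, mul_eq_zero] at h1
  obtain ⟨c, rfl⟩ := eq_C_of_ddz_eq_zero
    ((h1.resolve_left (by exact_mod_cast hn)).resolve_left (pow_ne_zero _ hf))
  refine ⟨c, ?_, rfl⟩
  rintro rfl
  simp at hf

theorem num_ratOf (p : ℂ[X]) : (ratOf p).num = p := RatFunc.num_algebraMap p

theorem denom_ratOf (p : ℂ[X]) : (ratOf p).denom = 1 := RatFunc.denom_algebraMap p

theorem isZeroAt_ratOf {p : ℂ[X]} {c : ℂ} : IsZeroAt (ratOf p) c ↔ p.IsRoot c := by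
  rw [IsZeroAt, num_ratOf]

theorem not_isPoleAt_ratOf (p : ℂ[X]) (c : ℂ) : ¬ IsPoleAt (ratOf p) c := by
  rw [IsPoleAt, denom_ratOf]
  simp

/-- If all roots of `q` are simple and `φ' + r φ = R / q²` with `R` a polynomial, then `φ` has
at most simple poles, located at the zeros of `q`: a pole of order `k` of `φ` is a pole of order
`k + 1` of the left hand side, and the right hand side has at most double poles. -/
theorem exists_polynomial_of_ddz_add_eq {φ : RatFunc ℂ} {r : ℂ} {q R : ℂ[X]}
    (hq : q ≠ 0) (hsimple : ∀ c, q.rootMultiplicity c ≤ 1)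
    (h : ddz φ + RatFunc.C r * φ = ratOf R / ratOf q ^ 2) : ∃ p : ℂ[X], φ * ratOf q = ratOf p := by
  set a := φ.num with ha
  set b := φ.denom with hb
  have hb0 : b ≠ 0 := φ.denom_ne_zero
  have hq' : ratOf q ≠ 0 := RatFunc.algebraMap_ne_zero hq
  have hb' : ratOf b ≠ 0 := RatFunc.algebraMap_ne_zero hb0
  have hφ : φ = ratOf a / ratOf b := φ.num_div_denom.symm
  have key : q ^ 2 * (a.derivative * b - a * b.derivative + Polynomial.C r * (a * b)) =
      R * b ^ 2 := by
    apply RatFunc.algebraMap_injective ℂ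
    rw [ddz_eq_quotRule hb0 hφ, quotRule] at h
    conv_lhs at h => rw [hφ]
    rw [map_pow, ← RatFunc.algebraMap_C] at h
    field_simp at h
    simp only [map_mul, map_add, map_sub, map_pow] at h ⊢
    linear_combination h
  have hdvd : b ∣ q := by
    rw [(IsAlgClosed.splits b).dvd_iff_roots_le_roots hb0 hq, Multiset.le_iff_count]
    intro c
    rw [Polynomial.count_roots, Polynomial.count_roots]
    set k := b.rootMultiplicity c
    rcases Nat.eq_zero_or_pos k with hk | hk
    · omega
    obtain ⟨k', hk'⟩ : ∃ k', k = k' + 1 := ⟨k - 1, by omega⟩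
    obtain ⟨b1, hb1, hb1c⟩ := b.exists_eq_pow_rootMultiplicity_mul_and_not_dvd hb0 c
    obtain ⟨q1, hq1, hq1c⟩ := q.exists_eq_pow_rootMultiplicity_mul_and_not_dvd hq c
    change b = (Polynomial.X - Polynomial.C c) ^ k * b1 at hb1
    set e := q.rootMultiplicity c
    rw [Polynomial.dvd_iff_isRoot, Polynomial.IsRoot] at hb1c hq1c
    have hac : a.eval c ≠ 0 := by
      intro h0
      obtain ⟨u, v, huv⟩ := φ.isCoprime_num_denom
      have h1 := congrArg (Polynomial.eval c) huv
      rw [← ha, ← hb, hb1, hk'] at h1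
      simp [h0] at h1
    by_contra hlt
    -- cancelling the powers of `X - c` leaves an identity that fails at `c`
    have he : 2 * e ≤ k' + 1 := by have := hsimple c; omega
    set w := Polynomial.X - Polynomial.C c with hw
    have hw0 : w ≠ 0 := Polynomial.X_sub_C_ne_zero c
    have hder : b.derivative = w ^ k' * (Polynomial.C (k : ℂ) * b1 + w * b1.derivative) := by
      rw [hb1, hk', Polynomial.derivative_mul, Polynomial.derivative_X_sub_C_pow, pow_succ]
      simp only [Nat.add_sub_cancel, map_natCast]
      ring
    rw [hder, hq1, hb1, show w ^ k = w ^ (k' + 1) by rw [hk']] at key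
    have h2 : w ^ (2 * e + k') * (q1 ^ 2 * (a.derivative * (w * b1) -
        a * (Polynomial.C (k : ℂ) * b1 + w * b1.derivative) +
          Polynomial.C r * (a * (w * b1)))) =
        w ^ (2 * e + k') * (w ^ (k' + 2 - 2 * e) * R * b1 ^ 2) := by
      have h3 : w ^ (2 * e + k') * w ^ (k' + 2 - 2 * e) = w ^ (2 * (k' + 1)) := by
        rw [← pow_add]; congr 1; omega
      linear_combination key - R * b1 ^ 2 * h3
    have h4 := congrArg (Polynomial.eval c) (mul_left_cancel₀ (pow_ne_zero _ hw0) h2)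
    have hw1 : w.eval c = 0 := by simp [hw]
    have h5 : k' + 2 - 2 * e ≠ 0 := by omega
    have h6 : (k : ℂ) ≠ 0 := by exact_mod_cast hk.ne'
    simp only [Polynomial.eval_mul, Polynomial.eval_pow, Polynomial.eval_add, Polynomial.eval_sub,
      hw1, Polynomial.eval_C, zero_pow h5, zero_mul, mul_zero, add_zero, zero_sub, mul_neg,
      neg_eq_zero, mul_eq_zero, pow_eq_zero_iff two_ne_zero] at h4
    tauto
  obtain ⟨d, hd⟩ := hdvd
  refine ⟨a * d, ?_⟩
  conv_lhs => rw [hφ]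
  rw [hd, ratOf_mul, ratOf_mul]
  field_simp

/-! ### Exponentials in a ring -/

section NilpotentExp

variable {R : Type*} [Ring R] [Module ℚ R]

open scoped Classical in
/-- The exponential of a nilpotent element as a unit of the ring; it is `1` on elements that are
not nilpotent. -/
def nexp (a : R) : Rˣ := if h : IsNilpotent a then (IsNilpotent.isUnit_exp h).unit else 1

theorem val_nexp {a : R} (h : IsNilpotent a) : (nexp a : R) = IsNilpotent.exp a := by
  rw [nexp, dif_pos h, IsUnit.unit_spec]

theorem nexp_neg {a : R} (h : IsNilpotent a) : nexp (-a) = (nexp a)⁻¹ := by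
  rw [eq_inv_iff_mul_eq_one, Units.ext_iff, Units.val_mul, val_nexp h, val_nexp h.neg,
    IsNilpotent.exp_neg_mul_exp_self h, Units.val_one]

theorem val_inv_nexp {a : R} (h : IsNilpotent a) :
    ((nexp a)⁻¹ : Rˣ).val = IsNilpotent.exp (-a) := by
  rw [← nexp_neg h, val_nexp h.neg]

theorem map_nexp {S : Type*} [Ring S] [Module ℚ S] (f : R →+* S) {a : R} (h : IsNilpotent a) :
    Units.map f.toMonoidHom (nexp a) = nexp (f a) := by
  rw [Units.ext_iff, val_nexp (h.map f), Units.coe_map, val_nexp h]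
  exact IsNilpotent.map_exp h f

theorem conj_nexp {a : R} (h : IsNilpotent a) (u : Rˣ) :
    u * nexp a * u⁻¹ = nexp (u * a * (u⁻¹ : Rˣ)) := by
  have hs : ∀ b : R, ConjAct.toConjAct u • b = u * b * (u⁻¹ : Rˣ) := fun b => by
    rw [ConjAct.units_smul_def, ConjAct.ofConjAct_toConjAct]
  have h' : IsNilpotent (u * a * (u⁻¹ : Rˣ) : R) := by
    rw [← hs]
    exact h.map (MulSemiringAction.toRingHom (ConjAct Rˣ) R (ConjAct.toConjAct u))
  rw [Units.ext_iff, val_nexp h', Units.val_mul, Units.val_mul, val_nexp h, ← hs, ← hs,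
    IsNilpotent.exp_smul _ h]

theorem commute_nexp {a z : R} (h : IsNilpotent a) (hz : Commute a z) :
    Commute (nexp a : R) z := by
  rw [val_nexp h, IsNilpotent.exp]
  exact Commute.sum_left _ _ _ fun i _ => ((hz.pow_left i).smul_left _)

/-- The formula `exp(a) z exp(-a) = ∑ ad(a)^i z / i!`. -/
theorem exp_mul_mul_exp_neg {a : R} (h : IsNilpotent a) (z : R) :
    ∃ N : ℕ, ∀ n, N ≤ n → IsNilpotent.exp a * z * IsNilpotent.exp (-a) =
      ∑ i ∈ Finset.range n, (i.factorial : ℚ)⁻¹ •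
        ((LinearMap.mulLeft ℤ a - LinearMap.mulRight ℤ a) ^ i) z := by
  have hl : ∀ {b : R} (m : ℕ), b ^ m = 0 → LinearMap.mulLeft ℤ b ^ m = 0 := fun m hm => by
    rw [LinearMap.pow_mulLeft, hm, LinearMap.mulLeft_zero_eq_zero]
  have hr : ∀ {b : R} (m : ℕ), b ^ m = 0 → LinearMap.mulRight ℤ b ^ m = 0 := fun m hm => by
    rw [LinearMap.pow_mulRight, hm, LinearMap.mulRight_zero_eq_zero]
  have hexpl : ∀ {b : R}, IsNilpotent b → ∀ w,
      IsNilpotent.exp (LinearMap.mulLeft ℤ b) w = IsNilpotent.exp b * w := by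
    rintro b ⟨m, hm⟩ w
    rw [IsNilpotent.exp_eq_sum (hl m hm), IsNilpotent.exp_eq_sum hm, Finset.sum_mul]
    simp [LinearMap.pow_mulLeft, smul_mul_assoc]
  have hexpr : ∀ {b : R}, IsNilpotent b → ∀ w,
      IsNilpotent.exp (LinearMap.mulRight ℤ b) w = w * IsNilpotent.exp b := by
    rintro b ⟨m, hm⟩ w
    rw [IsNilpotent.exp_eq_sum (hr m hm), IsNilpotent.exp_eq_sum hm, Finset.mul_sum]
    simp [LinearMap.pow_mulRight, mul_smul_comm]
  have hL : IsNilpotent (LinearMap.mulLeft ℤ a) := h.elim fun m hm => ⟨m, hl m hm⟩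
  have hR : IsNilpotent (LinearMap.mulRight ℤ (-a)) := h.neg.elim fun m hm => ⟨m, hr m hm⟩
  have hc : Commute (LinearMap.mulLeft ℤ a) (LinearMap.mulRight ℤ (-a)) :=
    LinearMap.commute_mulLeft_right _ _
  have hneg : LinearMap.mulRight ℤ (-a) = -LinearMap.mulRight ℤ a := by ext; simp
  obtain ⟨N, hN⟩ := hc.isNilpotent_add hL hR
  refine ⟨N, fun n hn => ?_⟩
  have h1 := LinearMap.congr_fun (IsNilpotent.exp_add_of_commute hc hL hR) z
  rw [Module.End.mul_apply, hexpr h.neg, hexpl h, ← mul_assoc] at h1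
  rw [← h1, IsNilpotent.exp_eq_sum (pow_eq_zero_of_le hn hN), LinearMap.sum_apply, hneg,
    ← sub_eq_add_neg]
  rfl

/-- If `ad(a)` raises the degree of a filtration by one, then `exp(ad(a)) z` agrees with
`z + [a, z]` up to terms two steps further down the filtration. -/
theorem nexp_conj_sub_sub_mem {K : Type*} [Field K] [CharZero K] [Module K R] {a : R}
    (h : IsNilpotent a) (M : ℕ → Submodule K R) (hM : ∀ j, M (j + 1) ≤ M j)
    (had : ∀ j, ∀ z ∈ M j, a * z - z * a ∈ M (j + 1)) {j : ℕ} {z : R} (hz : z ∈ M j) :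
    nexp a * z * ((nexp a)⁻¹ : Rˣ) - z - (a * z - z * a) ∈ M (j + 2) := by
  obtain ⟨N, hN⟩ := exp_mul_mul_exp_neg h z
  have hanti : Antitone M := antitone_nat_of_succ_le hM
  have hpow : ∀ i, ((LinearMap.mulLeft ℤ a - LinearMap.mulRight ℤ a) ^ i) z ∈ M (j + i) := by
    intro i
    induction i with
    | zero => simpa using hz
    | succ i ih =>
      rw [pow_succ', Module.End.mul_apply]
      exact had _ _ ih
  rw [val_nexp h, val_inv_nexp h, hN (N + 2) (by omega), Finset.sum_range_succ',
    Finset.sum_range_succ']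
  have h2 : ∀ i, (((i + 1 + 1).factorial : ℚ)⁻¹ •
      ((LinearMap.mulLeft ℤ a - LinearMap.mulRight ℤ a) ^ (i + 1 + 1)) z) ∈ M (j + 2) :=
    fun i => Submodule.smul_of_tower_mem _ _ (hanti (by omega) (hpow (i + 1 + 1)))
  have h3 := Submodule.sum_mem (M (j + 2)) (t := Finset.range N) fun i _ => h2 i
  convert h3 using 1
  simp

theorem nexp_conj_sub_mem {K : Type*} [Field K] [CharZero K] [Module K R] {a : R}
    (h : IsNilpotent a) (M : ℕ → Submodule K R) (hM : ∀ j, M (j + 1) ≤ M j)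
    (had : ∀ j, ∀ z ∈ M j, a * z - z * a ∈ M (j + 1)) {j : ℕ} {z : R} (hz : z ∈ M j) :
    nexp a * z * ((nexp a)⁻¹ : Rˣ) - z ∈ M (j + 1) := by
  have h1 := add_mem (hM _ (nexp_conj_sub_sub_mem h M hM had hz)) (had j z hz)
  simpa using h1

end NilpotentExp

/-! ### Polynomial curves in the group of units of a ring -/

section Curves

variable {E : Type*} [Ring E]

/-- Evaluation of polynomials over a noncommutative ring at the central element `0`. -/
def evalZero : E[X] →+* E := Polynomial.eval₂RingHom' (RingHom.id E) 0 fun _ => Commute.zero_right _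

/-- Evaluation of polynomials over a noncommutative ring at the central element `1`. -/
def evalOne : E[X] →+* E := Polynomial.eval₂RingHom' (RingHom.id E) 1 fun _ => Commute.one_right _

@[simp] theorem evalZero_monomial_succ (n : ℕ) (a : E) :
    evalZero (Polynomial.monomial (n + 1) a) = 0 := by
  simp [evalZero, Polynomial.eval₂RingHom']

@[simp] theorem evalOne_monomial (n : ℕ) (a : E) : evalOne (Polynomial.monomial n a) = a := by
  simp [evalOne, Polynomial.eval₂RingHom']

@[simp] theorem evalZero_C (a : E) : evalZero (Polynomial.C a) = a := by
  simp [evalZero, Polynomial.eval₂RingHom']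

@[simp] theorem evalOne_C (a : E) : evalOne (Polynomial.C a) = a := by
  simp [evalOne, Polynomial.eval₂RingHom']

/-- The logarithmic derivative `u' u⁻¹` of a polynomial curve `u` of units. -/
def logDer (u : E[X]ˣ) : E[X] := Polynomial.derivative (u : E[X]) * (u⁻¹ : E[X]ˣ)

theorem logDer_mul (u v : E[X]ˣ) : logDer (u * v) = logDer u + u * logDer v * (u⁻¹ : E[X]ˣ) := by
  simp only [logDer, Units.val_mul, Polynomial.derivative_mul, mul_inv_rev, add_mul]
  congr 1
  · rw [mul_assoc, ← mul_assoc (v : E[X]), Units.mul_inv, one_mul]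
  · simp only [mul_assoc]

@[simp] theorem logDer_one : logDer (1 : E[X]ˣ) = 0 := by simp [logDer]

theorem logDer_map_C (u : Eˣ) :
    logDer (Units.map (Polynomial.C : E →+* E[X]).toMonoidHom u) = 0 := by
  simp [logDer]

theorem derivative_pow_of_commute {a : E[X]} (h : Commute a (Polynomial.derivative a)) (n : ℕ) :
    Polynomial.derivative (a ^ (n + 1)) = (n + 1 : ℕ) • (Polynomial.derivative a * a ^ n) := by
  induction n with
  | zero => simp
  | succ n ih =>
    rw [pow_succ, Polynomial.derivative_mul, ih, succ_nsmul _ (n + 1), smul_mul_assoc, mul_assoc,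
      ← pow_succ, (h.pow_left (n + 1)).eq]

variable [Module ℚ E]

theorem logDer_nexp {a : E[X]} (hn : IsNilpotent a) (h : Commute a (Polynomial.derivative a)) :
    logDer (nexp a) = Polynomial.derivative a := by
  rw [logDer, Units.mul_inv_eq_iff_eq_mul, val_nexp hn]
  obtain ⟨N, hN⟩ := hn
  conv_lhs => rw [IsNilpotent.exp_eq_sum (k := N + 1) (pow_eq_zero_of_le (by omega) hN),
    Polynomial.derivative_sum, Finset.sum_range_succ']
  rw [IsNilpotent.exp_eq_sum hN, Finset.mul_sum]
  have hs : ∀ (q : ℚ) (p : E[X]), Polynomial.derivative (q • p) = q • Polynomial.derivative p :=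
    fun q p => map_rat_smul Polynomial.derivative.toAddMonoidHom q p
  simp only [pow_zero, hs, Polynomial.derivative_one, smul_zero, add_zero]
  refine Finset.sum_congr rfl fun i _ => ?_
  rw [derivative_pow_of_commute h, mul_smul_comm, ← Nat.cast_smul_eq_nsmul ℚ, smul_smul]
  congr 1
  rw [Nat.factorial_succ, Nat.cast_mul]
  field_simp

theorem isNilpotent_monomial {v : E} (h : IsNilpotent v) (n : ℕ) :
    IsNilpotent (Polynomial.monomial n v) := by
  obtain ⟨N, hN⟩ := h
  exact ⟨N, by rw [Polynomial.monomial_pow, hN, map_zero]⟩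

theorem logDer_nexp_monomial {v : E} (h : IsNilpotent v) (n : ℕ) :
    logDer (nexp (Polynomial.monomial (n + 1) v)) =
      Polynomial.monomial n (((n + 1 : ℕ) : ℚ) • v) := by
  have h1 : Polynomial.derivative (Polynomial.monomial (n + 1) v) =
      Polynomial.monomial n (((n + 1 : ℕ) : ℚ) • v) := by
    rw [Polynomial.derivative_monomial, Nat.cast_smul_eq_nsmul, nsmul_eq_mul,
      (Nat.cast_commute (n + 1) v).eq, Nat.add_sub_cancel]
  rw [logDer_nexp (isNilpotent_monomial h _), h1]
  rw [h1, Commute, SemiconjBy, Polynomial.monomial_mul_monomial,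
    Polynomial.monomial_mul_monomial, add_comm, mul_smul_comm, smul_mul_assoc]

end Curves

/-! ### The abelianization of a unipotent group -/

section Unipotent

variable {K : Type*} [Field K] {E : Type*} [Ring E] [Algebra K E]

/-- The polynomials with coefficients in `M`. -/
def polyIn (M : Submodule K E) : Submodule K E[X] where
  carrier := {p | ∀ n, p.coeff n ∈ M}
  zero_mem' n := by simp
  add_mem' hp hq n := by
    rw [Polynomial.coeff_add]
    exact add_mem (hp n) (hq n)
  smul_mem' c p hp n := by
    rw [Polynomial.coeff_smul]
    exact M.smul_mem c (hp n)

theorem polyIn_mono {M M' : Submodule K E} (h : M ≤ M') : polyIn M ≤ polyIn M' :=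
  fun _ hp n => h (hp n)

theorem monomial_mem_polyIn {M : Submodule K E} {a : E} (h : a ∈ M) (n : ℕ) :
    Polynomial.monomial n a ∈ polyIn M := by
  intro k
  rw [Polynomial.coeff_monomial]
  split_ifs
  exacts [h, M.zero_mem]

theorem C_mem_polyIn {M : Submodule K E} {a : E} (h : a ∈ M) : Polynomial.C a ∈ polyIn M :=
  monomial_mem_polyIn h 0

theorem mul_sub_mul_mem_polyIn {M M' M'' : Submodule K E}
    (h : ∀ x ∈ M, ∀ y ∈ M', x * y - y * x ∈ M'') {p q : E[X]} (hp : p ∈ polyIn M)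
    (hq : q ∈ polyIn M') : p * q - q * p ∈ polyIn M'' := by
  intro n
  rw [Polynomial.coeff_sub, Polynomial.coeff_mul, Polynomial.coeff_mul,
    ← Finset.Nat.sum_antidiagonal_swap (f := fun ij : ℕ × ℕ => q.coeff ij.1 * p.coeff ij.2),
    ← Finset.sum_sub_distrib]
  exact Submodule.sum_mem _ fun ij _ => h _ (hp _) _ (hq _)

/-- The lower central series of a subspace closed under commutators. -/
def lowerCentral (S : Submodule K E) : ℕ → Submodule K E
  | 0 => S
  | k + 1 => Submodule.span K {z | ∃ x ∈ S, ∃ w ∈ lowerCentral S k, z = x * w - w * x}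

theorem lie_mem_lowerCentral {S : Submodule K E} {x w : E} {k : ℕ} (hx : x ∈ S)
    (hw : w ∈ lowerCentral S k) : x * w - w * x ∈ lowerCentral S (k + 1) :=
  Submodule.subset_span ⟨x, hx, w, hw, rfl⟩

variable [Module ℚ E]

/-- The group generated by the exponentials of the elements of `S`. -/
def expGroup (S : Submodule K E) : Subgroup Eˣ := Subgroup.closure (nexp '' (S : Set E))

theorem nexp_mem_expGroup {S : Submodule K E} {x : E} (hx : x ∈ S) : nexp x ∈ expGroup S :=
  Subgroup.subset_closure ⟨x, hx, rfl⟩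

/-- The derived group of the group generated by the exponentials. -/
abbrev expDerived (S : Submodule K E) : Subgroup Eˣ := ⁅expGroup S, expGroup S⁆

/-- A subspace of a ring that consists of nilpotent elements and is a nilpotent Lie algebra under
the commutator. -/
structure IsUnipotentLie (S : Submodule K E) : Prop where
  lie_mem : ∀ x ∈ S, ∀ y ∈ S, x * y - y * x ∈ S
  nilpotent : ∀ x ∈ S, IsNilpotent x
  lowerCentral_eq_bot : ∃ n, lowerCentral S n = ⊥

namespace IsUnipotentLie

variable [CharZero K] {S : Submodule K E}

theorem lowerCentral_succ_le (hS : IsUnipotentLie S) (k : ℕ) :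
    lowerCentral S (k + 1) ≤ lowerCentral S k := by
  induction k with
  | zero =>
    refine Submodule.span_le.2 ?_
    rintro _ ⟨x, hx, w, hw, rfl⟩
    exact hS.lie_mem x hx w hw
  | succ k ih =>
    refine Submodule.span_le.2 ?_
    rintro _ ⟨x, hx, w, hw, rfl⟩
    exact lie_mem_lowerCentral hx (ih hw)

theorem lowerCentral_antitone (hS : IsUnipotentLie S) : Antitone (lowerCentral S) :=
  antitone_nat_of_succ_le hS.lowerCentral_succ_le

theorem lowerCentral_le (hS : IsUnipotentLie S) (k : ℕ) : lowerCentral S k ≤ S :=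
  hS.lowerCentral_antitone (Nat.zero_le k)

/-- Conjugation by `exp(a)`, `a ∈ S t ^ m`, is the identity on the graded pieces of the lower
central series. -/
theorem nexp_monomial_conj_sub_mem (hS : IsUnipotentLie S) {a : E} (ha : a ∈ S) (m : ℕ) {k : ℕ}
    {Z : E[X]} (hZ : Z ∈ polyIn (lowerCentral S k)) :
    nexp (Polynomial.monomial m a) * Z * ((nexp (Polynomial.monomial m a))⁻¹ : E[X]ˣ) - Z ∈
      polyIn (lowerCentral S (k + 1)) :=
  nexp_conj_sub_mem (isNilpotent_monomial (hS.nilpotent a ha) m)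
    (fun j => polyIn (lowerCentral S j)) (fun j => polyIn_mono (hS.lowerCentral_succ_le j))
    (fun _ _ hz => mul_sub_mul_mem_polyIn (fun _ hx _ hy => lie_mem_lowerCentral hx hy)
      (monomial_mem_polyIn ha m) hz) hZ

/-- Every polynomial curve that starts at `1` and whose logarithmic derivative has coefficients in
the `k`-th term of the lower central series ends in the commutator group. -/
def CurvesEndInCommutator (S : Submodule K E) (k : ℕ) : Prop :=
  ∀ u : E[X]ˣ, Units.map evalZero.toMonoidHom u = 1 → logDer u ∈ polyIn (lowerCentral S k) →
    Units.map evalOne.toMonoidHom u ∈ expDerived S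

theorem evalZero_nexp_monomial {a : E} (ha : IsNilpotent a) (m : ℕ) :
    Units.map evalZero.toMonoidHom (nexp (Polynomial.monomial (m + 1) a)) = 1 := by
  rw [map_nexp _ (isNilpotent_monomial ha _), evalZero_monomial_succ, Units.ext_iff,
    val_nexp IsNilpotent.zero, IsNilpotent.exp_zero, Units.val_one]

theorem evalOne_nexp_monomial {a : E} (ha : IsNilpotent a) (m : ℕ) :
    Units.map evalOne.toMonoidHom (nexp (Polynomial.monomial m a)) = nexp a := by
  rw [map_nexp _ (isNilpotent_monomial ha _), evalOne_monomial]

theorem logDer_nexp_monomial_one {a : E} (ha : IsNilpotent a) :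
    logDer (nexp (Polynomial.monomial 1 a)) = Polynomial.C a := by
  rw [show (1 : ℕ) = 0 + 1 from rfl, logDer_nexp_monomial ha 0, Polynomial.monomial_zero_left]
  simp

theorem curvesEndInCommutator_of_eq_bot {k : ℕ} (hk : lowerCentral S k = ⊥) :
    CurvesEndInCommutator S k := by
  intro u h0 h
  have h1 : logDer u = 0 := by
    ext n
    have := h n
    rwa [hk, Submodule.mem_bot] at this
  rw [logDer, Units.mul_left_eq_zero] at h1
  have : IsAddTorsionFree E := by
    refine ⟨fun n hn a b hab => ?_⟩
    have h2 : (n : ℚ) • a = (n : ℚ) • b := by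
      rw [Nat.cast_smul_eq_nsmul, Nat.cast_smul_eq_nsmul]
      exact hab
    exact (IsUnit.mk0 (n : ℚ) (by exact_mod_cast hn)).smul_left_cancel.1 h2
  have h2 := Polynomial.eq_C_of_derivative_eq_zero h1
  have h3 : Units.map evalOne.toMonoidHom u = 1 := by
    rw [← h0, Units.ext_iff]
    change evalOne (u : E[X]) = evalZero (u : E[X])
    rw [h2]
    simp
  rw [h3]
  exact one_mem _

/-- The curve `exp(-t[x, w]) exp(tx) exp(w) exp(-tx) exp(-w)` shows that `exp([x, w])` is a
commutator up to an element coming from deeper terms of the lower central series. -/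
theorem nexp_lie_mem (hS : IsUnipotentLie S) {j : ℕ} (hQ : CurvesEndInCommutator S (j + 2))
    {x w : E} (hx : x ∈ S) (hw : w ∈ lowerCentral S j) : nexp (x * w - w * x) ∈ expDerived S := by
  set v := x * w - w * x with hv
  have hvj : v ∈ lowerCentral S (j + 1) := lie_mem_lowerCentral hx hw
  have hvS : v ∈ S := hS.lowerCentral_le _ hvj
  have hwS : w ∈ S := hS.lowerCentral_le _ hw
  have hxn := hS.nilpotent x hx
  have hvn := hS.nilpotent v hvS
  have hwn := hS.nilpotent w hwS
  set U := nexp (Polynomial.monomial 1 (-v)) with hU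
  set P := nexp (Polynomial.monomial 1 x) with hP
  set W := nexp (Polynomial.C w) with hW
  have hW' : W = Units.map (Polynomial.C : E →+* E[X]).toMonoidHom (nexp w) :=
    (map_nexp _ hwn).symm
  have hWn : IsNilpotent (Polynomial.C w) := hwn.map (Polynomial.C : E →+* E[X])
  have hPx : Commute (P : E[X]) (Polynomial.C x) := by
    refine commute_nexp (isNilpotent_monomial hxn _) ?_
    rw [Commute, SemiconjBy, Polynomial.monomial_mul_C, Polynomial.C_mul_monomial]
  have hPinv : logDer P⁻¹ = -Polynomial.C x := by
    rw [hP, ← nexp_neg (isNilpotent_monomial hxn _), ← map_neg, logDer_nexp_monomial_one hxn.neg,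
      map_neg]
  -- conjugating `x` by `exp w` produces `x + [w, x]` up to deeper terms
  let M : ℕ → Submodule K E := fun i => Nat.casesOn i S fun i => lowerCentral S (j + 1 + i)
  have hM : ∀ i, M (i + 1) ≤ M i := by
    rintro (_ | i)
    · exact hS.lowerCentral_le _
    · exact hS.lowerCentral_succ_le _
  have hWx : W * Polynomial.C x * (W⁻¹ : E[X]ˣ) - Polynomial.C x -
      (Polynomial.C w * Polynomial.C x - Polynomial.C x * Polynomial.C w) ∈
        polyIn (lowerCentral S (j + 2)) := by
    refine nexp_conj_sub_sub_mem hWn (fun i => polyIn (M i)) (fun i => polyIn_mono (hM i)) ?_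
      (j := 0) (C_mem_polyIn hx)
    intro i z hz
    refine mul_sub_mul_mem_polyIn ?_ (C_mem_polyIn (Submodule.mem_span_singleton_self (R := K) w))
      hz
    intro a ha y hy
    obtain ⟨c, rfl⟩ := Submodule.mem_span_singleton.1 ha
    rcases i with _ | i
    · change _ ∈ lowerCentral S (j + 1)
      have h1 := (lowerCentral S (j + 1)).smul_mem (-c) (lie_mem_lowerCentral hy hw)
      simpa [smul_sub, smul_mul_assoc, mul_smul_comm, sub_eq_add_neg, add_comm] using h1
    · exact lie_mem_lowerCentral (S.smul_mem c hwS) hy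
  set y := W * Polynomial.C x * (W⁻¹ : E[X]ˣ) - Polynomial.C x with hy
  have hy' : y + Polynomial.C v ∈ polyIn (lowerCentral S (j + 2)) := by
    convert hWx using 1
    rw [hv, map_sub, map_mul, map_mul]
    abel
  have hyj : y ∈ polyIn (lowerCentral S (j + 1)) := by
    have h1 := sub_mem (polyIn_mono (hS.lowerCentral_succ_le _) hy') (C_mem_polyIn hvj)
    simpa using h1
  have hlog : logDer (U * (P * W * P⁻¹ * W⁻¹)) =
      -(y + Polynomial.C v) - (P * y * (P⁻¹ : E[X]ˣ) - y) +
        (U * (-(P * y * (P⁻¹ : E[X]ˣ))) * (U⁻¹ : E[X]ˣ) - -(P * y * (P⁻¹ : E[X]ˣ))) := by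
    have hWinv : logDer W⁻¹ = 0 := by rw [hW', ← map_inv, logDer_map_C]
    have h1 : logDer (P * W * P⁻¹ * W⁻¹) = -(P * y * (P⁻¹ : E[X]ˣ)) := by
      rw [mul_assoc, mul_assoc, logDer_mul, logDer_mul W, logDer_mul P⁻¹, hWinv, hPinv, hW',
        logDer_map_C, ← hW', logDer_nexp_monomial_one hxn, hy]
      have h2 : (P : E[X]) * Polynomial.C x * (P⁻¹ : E[X]ˣ) = Polynomial.C x := by
        rw [hPx.eq, mul_assoc, Units.mul_inv, mul_one]
      simp only [mul_zero, zero_mul, add_zero, zero_add, mul_neg, neg_mul, mul_sub, sub_mul, h2]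
      abel
    rw [logDer_mul, h1, hU, logDer_nexp_monomial_one hvn.neg, map_neg]
    abel
  have hPy := hS.nexp_monomial_conj_sub_mem hx 1 hyj
  have hmem := hQ (U * (P * W * P⁻¹ * W⁻¹))
    (by
      rw [map_mul, map_mul, map_mul, map_mul, map_inv, map_inv, hU, hP,
        evalZero_nexp_monomial hvn.neg 0, evalZero_nexp_monomial hxn 0]
      simp)
    (by
      rw [hlog]
      refine add_mem (sub_mem (neg_mem hy') hPy) ?_
      refine hS.nexp_monomial_conj_sub_mem (neg_mem hvS) 1 (neg_mem ?_)
      have h1 := add_mem (polyIn_mono (hS.lowerCentral_succ_le _) hPy) hyj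
      simpa using h1)
  rw [map_mul, map_mul, map_mul, map_mul, map_inv, map_inv, hU, hP,
    evalOne_nexp_monomial hvn.neg 1, evalOne_nexp_monomial hxn 1, hW,
    ← Polynomial.monomial_zero_left, evalOne_nexp_monomial hwn 0, ← commutatorElement_def] at hmem
  have h1 := (Subgroup.mul_mem_cancel_right _ (Subgroup.commutator_mem_commutator
    (nexp_mem_expGroup hx) (nexp_mem_expGroup hwS))).1 hmem
  rw [nexp_neg hvn] at h1
  exact inv_mem_iff.1 h1

/-- A logarithmic derivative in a term of the lower central series can be cancelled, up to the
next term, by a curve that ends in the commutator group. -/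
theorem exists_cancelling_curve (hS : IsUnipotentLie S) {j : ℕ}
    (hQ : CurvesEndInCommutator S (j + 2)) {X : E[X]} (hX : X ∈ polyIn (lowerCentral S (j + 1))) :
    ∃ u : E[X]ˣ, Units.map evalZero.toMonoidHom u = 1 ∧
      Units.map evalOne.toMonoidHom u ∈ expDerived S ∧
      logDer u + X ∈ polyIn (lowerCentral S (j + 2)) ∧
      ∀ Z ∈ polyIn (lowerCentral S (j + 1)),
        u * Z * (u⁻¹ : E[X]ˣ) - Z ∈ polyIn (lowerCentral S (j + 2)) := by
  let p : E[X] → Prop := fun X => X ∈ polyIn (lowerCentral S (j + 1)) ∧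
    ∃ u : E[X]ˣ, Units.map evalZero.toMonoidHom u = 1 ∧
      Units.map evalOne.toMonoidHom u ∈ expDerived S ∧
      logDer u + X ∈ polyIn (lowerCentral S (j + 2)) ∧
      ∀ Z ∈ polyIn (lowerCentral S (j + 1)),
        u * Z * (u⁻¹ : E[X]ˣ) - Z ∈ polyIn (lowerCentral S (j + 2))
  have hzero : p 0 := ⟨zero_mem _, 1, by simp, by simp [one_mem], by simp, by simp⟩
  have hadd : ∀ X Y, p X → p Y → p (X + Y) := by
    rintro X Y ⟨hX, u, hu0, hu1, hu2, hu3⟩ ⟨hY, v, hv0, hv1, hv2, hv3⟩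
    have hanti := polyIn_mono (hS.lowerCentral_succ_le (j + 1))
    have hu4 : ∀ Z ∈ polyIn (lowerCentral S (j + 1)),
        ∀ Z' ∈ polyIn (lowerCentral S (j + 1)), Z - Z' ∈ polyIn (lowerCentral S (j + 2)) →
          u * Z * (u⁻¹ : E[X]ˣ) - Z' ∈ polyIn (lowerCentral S (j + 2)) := by
      intro Z hZ Z' hZ' h
      have h1 := add_mem (hu3 Z hZ) h
      simpa using h1
    have hv : logDer v ∈ polyIn (lowerCentral S (j + 1)) := by
      have h1 := sub_mem (hanti hv2) hY
      simpa using h1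
    refine ⟨add_mem hX hY, u * v, by rw [map_mul, hu0, hv0, one_mul], by
      rw [map_mul]; exact mul_mem hu1 hv1, ?_, ?_⟩
    · have h1 := hu4 (logDer v) hv (-Y) (neg_mem hY) (by rwa [sub_neg_eq_add])
      have h2 := add_mem hu2 h1
      rw [logDer_mul]
      convert h2 using 1
      abel
    · intro Z hZ
      have h1 := hv3 Z hZ
      have h2 : v * Z * (v⁻¹ : E[X]ˣ) ∈ polyIn (lowerCentral S (j + 1)) := by
        have h1 := add_mem (hanti h1) hZ
        simpa using h1
      have h3 := hu4 _ h2 Z hZ h1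
      simpa only [Units.val_mul, mul_inv_rev, mul_assoc] using h3
  have hmono : ∀ n, ∀ z ∈ lowerCentral S (j + 1), p (Polynomial.monomial n z) := by
    intro n z hz
    induction hz using Submodule.closure_induction with
    | zero => rwa [map_zero]
    | add a b _ _ ha hb =>
      rw [map_add]
      exact hadd _ _ ha hb
    | smul_mem c z hz =>
      obtain ⟨x, hx, w, hw, rfl⟩ := hz
      set v := c • (x * w - w * x) with hv
      have hvj : v ∈ lowerCentral S (j + 1) :=
        Submodule.smul_mem _ _ (lie_mem_lowerCentral hx hw)
      set q : ℚ := -((n + 1 : ℕ) : ℚ)⁻¹ with hq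
      have hqv : q • v ∈ S := Submodule.smul_of_tower_mem _ _ (hS.lowerCentral_le _ hvj)
      have hqn := hS.nilpotent _ hqv
      refine ⟨monomial_mem_polyIn hvj n, nexp (Polynomial.monomial (n + 1) (q • v)),
        evalZero_nexp_monomial hqn n, ?_, ?_, fun Z hZ => hS.nexp_monomial_conj_sub_mem hqv _ hZ⟩
      · rw [evalOne_nexp_monomial hqn]
        have h1 : q • v = (q • c • x) * w - w * (q • c • x) := by
          rw [hv, smul_sub, smul_sub, smul_mul_assoc, smul_mul_assoc, mul_smul_comm, mul_smul_comm]
        rw [h1]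
        exact hS.nexp_lie_mem hQ (Submodule.smul_of_tower_mem _ _ (S.smul_mem c hx)) hw
      · have h1 : ((n + 1 : ℕ) : ℚ) • q • v = -v := by
          rw [smul_smul, hq, mul_neg, mul_inv_cancel₀ (by positivity), neg_one_smul]
        rw [logDer_nexp_monomial hqn, h1, map_neg, neg_add_cancel]
        exact zero_mem _
  have hall : p X := by
    rw [X.as_sum_range]
    exact Finset.sum_induction _ p hadd hzero fun n _ => hmono n _ (hX n)
  exact hall.2

theorem curvesEndInCommutator (hS : IsUnipotentLie S) (j : ℕ) :
    CurvesEndInCommutator S (j + 1) := by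
  obtain ⟨n, hn⟩ := hS.lowerCentral_eq_bot
  suffices h : ∀ m j, n ≤ j + 1 + m → CurvesEndInCommutator S (j + 1) from h n j (by omega)
  intro m
  induction m with
  | zero =>
    intro j hj
    refine curvesEndInCommutator_of_eq_bot (eq_bot_iff.2 ?_)
    rw [← hn]
    exact hS.lowerCentral_antitone hj
  | succ m ih =>
    intro j hj u hu0 hu
    have hQ := ih (j + 1) (by omega)
    obtain ⟨v, hv0, hv1, hv2, hv3⟩ := hS.exists_cancelling_curve hQ hu
    have h1 := hQ (v * u) (by rw [map_mul, hu0, hv0, one_mul]) (by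
      rw [logDer_mul]
      have h2 := add_mem hv2 (hv3 _ hu)
      convert h2 using 1
      abel)
    rw [map_mul] at h1
    exact (Subgroup.mul_mem_cancel_left _ hv1).1 h1

/-- The exponential of an element of the derived algebra lies in the derived group. -/
theorem nexp_mem_commutator (hS : IsUnipotentLie S) {z : E} (hz : z ∈ lowerCentral S 1) :
    nexp z ∈ expDerived S := by
  have hn := hS.nilpotent z (hS.lowerCentral_le 1 hz)
  rw [← evalOne_nexp_monomial hn 1]
  refine hS.curvesEndInCommutator 0 _ (evalZero_nexp_monomial hn 0) ?_
  rw [logDer_nexp_monomial_one hn]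
  exact C_mem_polyIn hz

/-- Modulo the derived group, the exponential is additive. -/
theorem nexp_neg_add_mul_mem_commutator (hS : IsUnipotentLie S) {x y : E} (hx : x ∈ S)
    (hy : y ∈ S) : nexp (-(x + y)) * (nexp x * nexp y) ∈ expDerived S := by
  have hxn := hS.nilpotent x hx
  have hyn := hS.nilpotent y hy
  have hxy : -(x + y) ∈ S := neg_mem (add_mem hx hy)
  have hxyn := hS.nilpotent _ hxy
  rw [← evalOne_nexp_monomial hxn 1, ← evalOne_nexp_monomial hyn 1,
    ← evalOne_nexp_monomial hxyn 1, ← map_mul, ← map_mul]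
  refine hS.curvesEndInCommutator 0 _ (by
    rw [map_mul, map_mul, evalZero_nexp_monomial hxn 0, evalZero_nexp_monomial hyn 0,
      evalZero_nexp_monomial hxyn 0, one_mul, one_mul]) ?_
  have hC : ∀ {a : E}, a ∈ S → Polynomial.C a ∈ polyIn (lowerCentral S 0) := C_mem_polyIn
  have h1 := hS.nexp_monomial_conj_sub_mem hx 1 (hC hy)
  have h2 : Polynomial.C x + nexp (Polynomial.monomial 1 x) * Polynomial.C y *
      ((nexp (Polynomial.monomial 1 x))⁻¹ : E[X]ˣ) ∈ polyIn (lowerCentral S 0) := by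
    have h3 := add_mem (add_mem (polyIn_mono (hS.lowerCentral_succ_le 0) h1) (hC hy)) (hC hx)
    rw [sub_add_cancel, add_comm] at h3
    exact h3
  have h3 := add_mem (hS.nexp_monomial_conj_sub_mem hxy 1 h2) h1
  rw [logDer_mul, logDer_mul, logDer_nexp_monomial_one hxn, logDer_nexp_monomial_one hyn,
    logDer_nexp_monomial_one hxyn]
  convert h3 using 1
  rw [map_neg, map_add]
  abel

/-- Every element of the group generated by the exponentials is an exponential modulo the derived
group. -/
theorem exists_nexp_mul_mem_commutator (hS : IsUnipotentLie S) {n : Eˣ} (hn : n ∈ expGroup S) :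
    ∃ x ∈ S, (nexp x)⁻¹ * n ∈ expDerived S := by
  have hgen : ∀ x ∈ S, ∀ m : Eˣ, m ∈ expGroup S →
      (∃ y ∈ S, (nexp y)⁻¹ * m ∈ expDerived S) →
        ∃ y ∈ S, (nexp y)⁻¹ * (nexp x * m) ∈ expDerived S := by
    rintro x hx m hm ⟨y, hy, h⟩
    refine ⟨x + y, add_mem hx hy, ?_⟩
    have h1 := mul_mem (hS.nexp_neg_add_mul_mem_commutator hx hy) h
    rw [nexp_neg (hS.nilpotent _ (add_mem hx hy))] at h1
    convert h1 using 1
    group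
  refine (Subgroup.closure_induction_left (p := fun m _ => m ∈ expGroup S ∧
    ∃ y ∈ S, (nexp y)⁻¹ * m ∈ expDerived S) ?_ ?_ ?_ hn).2
  · refine ⟨one_mem _, 0, zero_mem _, ?_⟩
    rw [show nexp (0 : E) = 1 by
      rw [Units.ext_iff, val_nexp IsNilpotent.zero, IsNilpotent.exp_zero, Units.val_one]]
    simp [one_mem]
  · rintro _ ⟨x, hx, rfl⟩ m _ ⟨hm, h⟩
    exact ⟨mul_mem (nexp_mem_expGroup hx) hm, hgen x hx m hm h⟩
  · rintro _ ⟨x, hx, rfl⟩ m _ ⟨hm, h⟩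
    rw [← nexp_neg (hS.nilpotent x hx)]
    exact ⟨mul_mem (nexp_mem_expGroup (neg_mem hx)) hm, hgen (-x) (neg_mem hx) m hm h⟩

end IsUnipotentLie

end Unipotent

/-! ### Weight vectors -/

section Weights

variable {ι : Type*} [Fintype ι] [DecidableEq ι]
  {𝔤 : Type*} [LieRing 𝔤] [LieAlgebra ℂ 𝔤] {𝔥 : LieSubalgebra ℂ 𝔤}
  (b : LieAlgebra.Basis ι 𝔥)
  {W : Type*} [AddCommGroup W] [Module ℂ W] [LieRingModule 𝔤 W] [LieModule ℂ 𝔤 W]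

theorem lie_h_e_eq (k j : ι) : ⁅b.h k, b.e j⁆ = (cartan b k j : ℂ) • b.e j := by
  rw [b.lie_h_e, cartan, Int.cast_smul_eq_zsmul]

theorem lie_h_f_eq (k j : ι) : ⁅b.h k, b.f j⁆ = -(cartan b k j : ℂ) • b.f j := by
  rw [b.lie_h_f, cartan, ← Int.cast_neg, Int.cast_smul_eq_zsmul]

theorem cartan_self (i : ι) : cartan b i i = 2 := by
  have : IsAddTorsionFree 𝔤 := .of_isTorsionFree ℂ 𝔤
  exact b.A_diag_eq_two i

/-- The off-diagonal Cartan integers are not positive: `e_j` is a primitive vector for the `sl₂`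
triple `(-α̌_i, f_i, e_i)`. -/
theorem cartan_nonpos [FiniteDimensional ℂ 𝔤] {i j : ι} (hij : i ≠ j) : cartan b i j ≤ 0 := by
  have hp : (b.sl2 i).symm.HasPrimitiveVectorWith (b.e j) (-(cartan b i j : ℂ)) :=
    { ne_zero := (b.sl2 j).e_ne_zero
      lie_h := by rw [neg_lie, lie_h_e_eq, neg_smul]
      lie_e := by rw [← lie_skew, b.lie_e_f_ne j i hij.symm, neg_zero] }
  obtain ⟨n, hn⟩ := hp.exists_nat
  have h1 : -(cartan b i j) = n := by exact_mod_cast hn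
  omega

theorem det_cartan_ne_zero : (cartan b).det ≠ 0 := by
  have h : cartan b = b.A.transpose := rfl
  rw [h, Matrix.det_transpose]
  exact b.nondegen.det_ne_zero

/-- An integral coweight that takes the same positive value `d` on all simple roots. -/
theorem exists_coweight : ∃ (n : ι → ℤ) (d : ℤ), 0 < d ∧ ∀ j, ∑ k, n k * cartan b k j = d := by
  set D := (cartan b).det with hD
  refine ⟨fun k => D * ∑ l, (cartan b).adjugate l k, D ^ 2,
    by have := det_cartan_ne_zero b; positivity, fun j => ?_⟩
  have h1 : ∀ l, ∑ k, (cartan b).adjugate l k * cartan b k j = if l = j then D else 0 := by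
    intro l
    have h2 := congrFun (congrFun (Matrix.adjugate_mul (cartan b)) l) j
    rw [Matrix.mul_apply] at h2
    rw [h2, Matrix.smul_apply, Matrix.one_apply, ← hD]
    simp
  calc ∑ k, D * (∑ l, (cartan b).adjugate l k) * cartan b k j
      = D * ∑ l, ∑ k, (cartan b).adjugate l k * cartan b k j := by
        rw [Finset.sum_comm, Finset.mul_sum]
        refine Finset.sum_congr rfl fun k _ => ?_
        rw [← Finset.sum_mul, mul_assoc]
    _ = D ^ 2 := by simp [h1, sq]

/-- `v` has the integral weight `m`, that is, `α̌_j` acts on it as `m j`. -/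
def IsWeightVector (m : ι → ℤ) (v : W) : Prop := ∀ j, ⁅b.h j, v⁆ = (m j : ℂ) • v

variable {b}

theorem IsWeightVector.lie_e {m : ι → ℤ} {v : W} (hv : IsWeightVector b m v) (j : ι) :
    IsWeightVector b (fun k => m k + cartan b k j) ⁅b.e j, v⁆ := by
  intro k
  rw [leibniz_lie, hv k, lie_h_e_eq, lie_smul, smul_lie, ← add_smul, Int.cast_add, add_comm]

theorem IsWeightVector.lie_f {m : ι → ℤ} {v : W} (hv : IsWeightVector b m v) (j : ι) :
    IsWeightVector b (fun k => m k - cartan b k j) ⁅b.f j, v⁆ := by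
  intro k
  rw [leibniz_lie, hv k, lie_h_f_eq, lie_smul, smul_lie, ← add_smul, Int.cast_sub]
  ring_nf

/-- The elements of `𝔤` that map `P s` to `P (s + k)` for all `s`. -/
def shiftSubalgebra (𝔤 : Type*) [LieRing 𝔤] [LieAlgebra ℂ 𝔤] [LieRingModule 𝔤 W]
    [LieModule ℂ 𝔤 W] (P : ℤ → Submodule ℂ W) (hP : Antitone P) (k : ℕ) :
    LieSubalgebra ℂ 𝔤 where
  carrier := {x | ∀ s, ∀ v ∈ P s, ⁅x, v⁆ ∈ P (s + k)}
  add_mem' hx hy s v hv := by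
    rw [add_lie]
    exact add_mem (hx s v hv) (hy s v hv)
  zero_mem' s v _ := by
    rw [zero_lie]
    exact zero_mem _
  smul_mem' c x hx s v hv := by
    rw [smul_lie]
    exact Submodule.smul_mem _ _ (hx s v hv)
  lie_mem' hx hy s v hv := by
    rw [lie_lie]
    exact hP (by omega) (sub_mem (hx _ _ (hy s v hv)) (hy _ _ (hx s v hv)))

variable (b) in
/-- A subspace stable under the `e_j` and the `f_j` is stable under `𝔤`. -/
theorem lie_mem_of_forall {P : Submodule ℂ W} (he : ∀ j, ∀ v ∈ P, ⁅b.e j, v⁆ ∈ P)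
    (hf : ∀ j, ∀ v ∈ P, ⁅b.f j, v⁆ ∈ P) (x : 𝔤) {v : W} (hv : v ∈ P) : ⁅x, v⁆ ∈ P := by
  have h1 : (⊤ : LieSubalgebra ℂ 𝔤) ≤ shiftSubalgebra 𝔤 (fun _ => P) antitone_const 0 := by
    rw [← b.span_ef, LieSubalgebra.lieSpan_le]
    rintro _ (⟨j, rfl⟩ | ⟨j, rfl⟩) s v hv
    exacts [he j v hv, hf j v hv]
  exact h1 (LieSubalgebra.mem_top x) 0 v hv

/-- An irreducible representation containing a vector of integral weight is spanned by such
vectors. -/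
theorem span_isWeightVector_eq_top [LieModule.IsIrreducible ℂ 𝔤 W] {m₀ : ι → ℤ} {v₀ : W}
    (hv₀ : IsWeightVector b m₀ v₀) (h0 : v₀ ≠ 0) :
    Submodule.span ℂ {v : W | ∃ m, IsWeightVector b m v} = ⊤ := by
  set P := Submodule.span ℂ {v : W | ∃ m, IsWeightVector b m v} with hP
  have hstable : ∀ x : 𝔤, (∀ v : W, (∃ m, IsWeightVector b m v) → ∃ m, IsWeightVector b m ⁅x, v⁆) →
      ∀ v ∈ P, ⁅x, v⁆ ∈ P := by
    intro x hx v hv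
    induction hv using Submodule.span_induction with
    | mem v hv => exact Submodule.subset_span (hx v hv)
    | zero => rw [lie_zero]; exact zero_mem _
    | add v w _ _ hv hw => rw [lie_add]; exact add_mem hv hw
    | smul c v _ hv => rw [lie_smul]; exact Submodule.smul_mem _ _ hv
  let N : LieSubmodule ℂ 𝔤 W :=
    { P with
      lie_mem := fun {x v} hv => lie_mem_of_forall b
        (fun j => hstable _ fun v ⟨m, hm⟩ => ⟨_, hm.lie_e j⟩)
        (fun j => hstable _ fun v ⟨m, hm⟩ => ⟨_, hm.lie_f j⟩) x hv }
  have hN : N = ⊤ := by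
    refine (eq_bot_or_eq_top N).resolve_left fun h => h0 ?_
    have h1 : v₀ ∈ N := Submodule.subset_span ⟨m₀, hv₀⟩
    rwa [h, LieSubmodule.mem_bot] at h1
  rw [eq_top_iff]
  intro v _
  have h1 : v ∈ N := hN ▸ LieSubmodule.mem_top v
  exact h1

variable (b W) in
/-- A basis of vectors of integral weight. -/
structure WeightBasis where
  /-- the index type -/
  κ : Type
  /-- the index type is finite -/
  fin : Fintype κ
  /-- the basis -/
  basis : Module.Basis κ ℂ W
  /-- the weights of the basis vectors -/
  wt : κ → ι → ℤ
  isWeightVector : ∀ k, IsWeightVector b (wt k) (basis k)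

attribute [instance] WeightBasis.fin

theorem exists_weightBasis [FiniteDimensional ℂ W]
    (h : Submodule.span ℂ {v : W | ∃ m, IsWeightVector b m v} = ⊤) :
    Nonempty (WeightBasis b W) := by
  let B := Module.Basis.ofSpan h.ge
  have hB : ∀ k, ∃ m, IsWeightVector b m (B k) :=
    fun k => Module.Basis.ofSpan_subset h.ge ⟨k, rfl⟩
  choose m hm using hB
  have hfin := Module.Finite.finite_basis B
  obtain ⟨n, ⟨e⟩⟩ := @Finite.exists_equiv_fin _ hfin
  refine ⟨⟨Fin n, inferInstance, B.reindex e, fun k => m (e.symm k), fun k => ?_⟩⟩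
  rw [Module.Basis.reindex_apply]
  exact hm _

namespace WeightBasis

variable (B : WeightBasis b W)

/-- A vector of weight `m` is a combination of basis vectors of weight `m`. -/
theorem repr_eq_zero {m : ι → ℤ} {v : W} (hv : IsWeightVector b m v) {k : B.κ}
    (hk : B.wt k ≠ m) : B.basis.repr v k = 0 := by
  by_contra hne
  refine hk (funext fun j => ?_)
  have h1 : ∀ w : W, B.basis.repr ⁅b.h j, w⁆ k = (B.wt k j : ℂ) * B.basis.repr w k := by
    have h2 : (B.basis.coord k).comp (LieModule.toEnd ℂ 𝔤 W (b.h j)) =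
        (B.wt k j : ℂ) • B.basis.coord k := by
      refine B.basis.ext fun l => ?_
      simp only [LinearMap.comp_apply, LinearMap.smul_apply, Module.Basis.coord_apply]
      change B.basis.repr ⁅b.h j, B.basis l⁆ k = _
      rw [B.isWeightVector l j, map_smul, Module.Basis.repr_self, Finsupp.smul_apply]
      by_cases hlk : l = k
      · rw [hlk]
      · simp [Finsupp.single_eq_of_ne' hlk]
    exact fun w => LinearMap.congr_fun h2 w
  have h3 := h1 v
  rw [hv j, map_smul, Finsupp.smul_apply, smul_eq_mul] at h3
  exact_mod_cast (mul_right_cancel₀ hne h3).symm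

end WeightBasis

end Weights

/-! ### The filtration by height and the action of the unipotent group -/

section Levels

variable {ι : Type*} [Fintype ι] [DecidableEq ι]
  {𝔤 : Type*} [LieRing 𝔤] [LieAlgebra ℂ 𝔤] {𝔥 : LieSubalgebra ℂ 𝔤}
  (b : LieAlgebra.Basis ι 𝔥)

/-- The height of an integral weight with respect to a coweight `n`. -/
def height (n m : ι → ℤ) : ℤ := ∑ k, n k * m k

theorem height_add_cartan {n : ι → ℤ} {d : ℤ} (hn : ∀ j, ∑ k, n k * cartan b k j = d)
    (m : ι → ℤ) (j : ι) : height n (fun k => m k + cartan b k j) = height n m + d := by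
  simp only [height, mul_add, Finset.sum_add_distrib, hn]

theorem height_sub_cartan {n : ι → ℤ} {d : ℤ} (hn : ∀ j, ∑ k, n k * cartan b k j = d)
    (m : ι → ℤ) (j : ι) : height n (fun k => m k - cartan b k j) = height n m - d := by
  simp only [height, mul_sub, Finset.sum_sub_distrib, hn]

variable (W : Type*) [AddCommGroup W] [Module ℂ W] [LieRingModule 𝔤 W] [LieModule ℂ 𝔤 W]

/-- The span of the weight vectors whose heights lie in `T`. -/
def levelSpan (n : ι → ℤ) (T : Set ℤ) : Submodule ℂ W :=
  Submodule.span ℂ {v | ∃ m, IsWeightVector b m v ∧ height n m ∈ T}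

variable {W}

theorem mem_levelSpan {n m : ι → ℤ} {T : Set ℤ} {v : W} (hv : IsWeightVector b m v)
    (hm : height n m ∈ T) : v ∈ levelSpan b W n T := Submodule.subset_span ⟨m, hv, hm⟩

theorem levelSpan_mono (n : ι → ℤ) : Monotone (levelSpan b W n) := fun _ _ h =>
  Submodule.span_mono fun _ ⟨m, hv, hm⟩ => ⟨m, hv, h hm⟩

theorem lie_mem_levelSpan {n : ι → ℤ} {T T' : Set ℤ} {x : 𝔤}
    (h : ∀ (m : ι → ℤ) (v : W), IsWeightVector b m v → height n m ∈ T →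
      ∃ m', IsWeightVector b m' ⁅x, v⁆ ∧ height n m' ∈ T') {v : W} (hv : v ∈ levelSpan b W n T) :
    ⁅x, v⁆ ∈ levelSpan b W n T' := by
  induction hv using Submodule.span_induction with
  | mem v hv =>
    obtain ⟨m, hm, hT⟩ := hv
    exact Submodule.subset_span (h m v hm hT)
  | zero => rw [lie_zero]; exact zero_mem _
  | add v w _ _ hv hw => rw [lie_add]; exact add_mem hv hw
  | smul c v _ hv => rw [lie_smul]; exact Submodule.smul_mem _ _ hv

theorem nPlus_lie_mem {n : ι → ℤ} {d : ℤ} (hd : 0 < d) (hn : ∀ j, ∑ k, n k * cartan b k j = d)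
    {x : 𝔤} (hx : x ∈ nPlus b) (s : ℤ) {v : W} (hv : v ∈ levelSpan b W n (Set.Ici s)) :
    ⁅x, v⁆ ∈ levelSpan b W n (Set.Ici (s + 1)) := by
  have hanti : Antitone fun s : ℤ => levelSpan b W n (Set.Ici s) :=
    fun s t h => levelSpan_mono b n (Set.Ici_subset_Ici.2 h)
  have h1 : nPlus b ≤ shiftSubalgebra 𝔤 _ hanti 1 := by
    rw [nPlus, LieSubalgebra.lieSpan_le]
    rintro _ ⟨j, rfl⟩ s v hv
    refine lie_mem_levelSpan b (fun m v hm hT => ⟨_, hm.lie_e j, ?_⟩) hv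
    rw [height_add_cartan b hn]
    simp only [Set.mem_Ici, Nat.cast_one] at hT ⊢
    omega
  exact h1 hx s v hv

theorem nMinus_lie_mem {n : ι → ℤ} {d : ℤ} (hd : 0 < d) (hn : ∀ j, ∑ k, n k * cartan b k j = d)
    {x : 𝔤} (hx : x ∈ nMinus b) (s : ℤ) {v : W} (hv : v ∈ levelSpan b W n (Set.Iio s)) :
    ⁅x, v⁆ ∈ levelSpan b W n (Set.Iio s) := by
  have h1 : nMinus b ≤
      shiftSubalgebra 𝔤 (fun _ => levelSpan b W n (Set.Iio s)) antitone_const 0 := by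
    rw [nMinus, LieSubalgebra.lieSpan_le]
    rintro _ ⟨j, rfl⟩ _ v hv
    refine lie_mem_levelSpan b (fun m v hm hT => ⟨_, hm.lie_f j, ?_⟩) hv
    rw [height_sub_cartan b hn]
    simp only [Set.mem_Iio] at hT ⊢
    omega
  exact h1 hx 0 v hv

variable {b}

theorem WeightBasis.levelSpan_eq_top (B : WeightBasis b W) (n : ι → ℤ) {T : Set ℤ}
    (h : ∀ k, height n (B.wt k) ∈ T) : levelSpan b W n T = ⊤ := by
  rw [eq_top_iff, ← B.basis.span_eq, Submodule.span_le]
  rintro _ ⟨k, rfl⟩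
  exact mem_levelSpan b (B.isWeightVector k) (h k)

theorem WeightBasis.levelSpan_eq_bot (B : WeightBasis b W) (n : ι → ℤ) {T : Set ℤ}
    (h : ∀ k, height n (B.wt k) ∉ T) : levelSpan b W n T = ⊥ := by
  rw [levelSpan, Submodule.span_eq_bot]
  rintro v ⟨m, hm, hT⟩
  refine B.basis.ext_elem fun k => ?_
  rw [map_zero, Finsupp.zero_apply, B.repr_eq_zero hm]
  rintro rfl
  exact h k hT

/-- The heights of the weights of `W` are bounded. -/
theorem WeightBasis.exists_bound (B : WeightBasis b W) (n : ι → ℤ) :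
    ∃ N : ℕ, ∀ M : ℕ, N ≤ M → levelSpan b W n (Set.Ici (-M : ℤ)) = ⊤ ∧
      levelSpan b W n (Set.Ici (M : ℤ)) = ⊥ := by
  have hle : ∀ k, (height n (B.wt k)).natAbs ≤ ∑ k, (height n (B.wt k)).natAbs :=
    fun k => Finset.single_le_sum (f := fun k => (height n (B.wt k)).natAbs)
      (fun _ _ => Nat.zero_le _) (Finset.mem_univ k)
  refine ⟨∑ k, (height n (B.wt k)).natAbs + 1, fun M hM => ⟨?_, ?_⟩⟩
  · refine B.levelSpan_eq_top n fun k => ?_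
    have := hle k
    rw [Set.mem_Ici]
    omega
  · refine B.levelSpan_eq_bot n fun k => ?_
    have := hle k
    rw [Set.mem_Ici]
    omega

end Levels

section BaseChange

variable {𝔤 : Type*} [LieRing 𝔤] [LieAlgebra ℂ 𝔤]
  {W : Type*} [AddCommGroup W] [Module ℂ W] [LieRingModule 𝔤 W] [LieModule ℂ 𝔤 W]

theorem baseChange_induction {W : Type*} [AddCommGroup W] [Module ℂ W] {P : Submodule ℂ W}
    {p : RatFunc ℂ ⊗[ℂ] W → Prop}
    (tmul : ∀ v ∈ P, p (1 ⊗ₜ v)) (zero : p 0) (add : ∀ x y, p x → p y → p (x + y))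
    (smul : ∀ (c : RatFunc ℂ) x, p x → p (c • x)) {w : RatFunc ℂ ⊗[ℂ] W}
    (hw : w ∈ P.baseChange (RatFunc ℂ)) : p w := by
  rw [Submodule.baseChange_eq_span] at hw
  induction hw using Submodule.span_induction with
  | mem v hv =>
    obtain ⟨v, hv, rfl⟩ := hv
    exact tmul v hv
  | zero => exact zero
  | add x y _ _ hx hy => exact add x y hx hy
  | smul c x _ hx => exact smul c x hx

theorem one_tmul_mem_baseChange {W : Type*} [AddCommGroup W] [Module ℂ W] {P : Submodule ℂ W}
    {v : W} (hv : v ∈ P) : (1 : RatFunc ℂ) ⊗ₜ[ℂ] v ∈ P.baseChange (RatFunc ℂ) :=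
  Submodule.tmul_mem_baseChange_of_mem _ hv

theorem lie_mem_baseChange {𝔩 : Submodule ℂ 𝔤} {P P' : Submodule ℂ W}
    (h : ∀ x ∈ 𝔩, ∀ v ∈ P, ⁅x, v⁆ ∈ P') {x : RatFunc ℂ ⊗[ℂ] 𝔤}
    (hx : x ∈ 𝔩.baseChange (RatFunc ℂ)) {w : RatFunc ℂ ⊗[ℂ] W}
    (hw : w ∈ P.baseChange (RatFunc ℂ)) : ⁅x, w⁆ ∈ P'.baseChange (RatFunc ℂ) := by
  refine baseChange_induction (p := fun x => ⁅x, w⁆ ∈ P'.baseChange (RatFunc ℂ)) ?_ ?_ ?_ ?_ hx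
  · intro x hx
    refine baseChange_induction
      (p := fun w => ⁅(1 : RatFunc ℂ) ⊗ₜ[ℂ] x, w⁆ ∈ P'.baseChange (RatFunc ℂ)) ?_ ?_ ?_ ?_ hw
    · intro v hv
      rw [LieAlgebra.ExtendScalars.bracket_tmul, one_mul]
      exact one_tmul_mem_baseChange (h x hx v hv)
    · rw [lie_zero]; exact zero_mem _
    · intro v w hv hw
      rw [lie_add]; exact add_mem hv hw
    · intro c v hv
      rw [lie_smul]; exact Submodule.smul_mem _ _ hv
  · rw [zero_lie]; exact zero_mem _
  · intro x y hx hy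
    rw [add_lie]; exact add_mem hx hy
  · intro c x hx
    rw [smul_lie]; exact Submodule.smul_mem _ _ hx

end BaseChange

section Unipotent

variable {ι : Type*} [Fintype ι] [DecidableEq ι]
  {𝔤 : Type*} [LieRing 𝔤] [LieAlgebra ℂ 𝔤] {𝔥 : LieSubalgebra ℂ 𝔤}
  (b : LieAlgebra.Basis ι 𝔥)
  (V : ι → Type*) [∀ i, AddCommGroup (V i)] [∀ i, Module ℂ (V i)]
  [∀ i, LieRingModule 𝔤 (V i)] [∀ i, LieModule ℂ 𝔤 (V i)]

/-- The product of the endomorphism rings of the `ℂ(z) ⊗ V_i`; its group of units is the ambient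
group. -/
abbrev EndProd : Type _ := ∀ i, Module.End (RatFunc ℂ) (RatFunc ℂ ⊗[ℂ] V i)

/-- The `ℚ`-module structures for which `IsNilpotent.exp` is formed, recorded so that they need not
be searched for in `EndProd V`. -/
instance moduleRatEnd (i : ι) : Module ℚ (Module.End (RatFunc ℂ) (RatFunc ℂ ⊗[ℂ] V i)) :=
  inferInstance

instance moduleRatEndProd : Module ℚ (EndProd V) :=
  @Pi.module ι _ _ _ _ fun i => moduleRatEnd V i

/-- The action of `𝔤(z)` on all the `ℂ(z) ⊗ V_i` simultaneously. -/
def act : RatFunc ℂ ⊗[ℂ] 𝔤 →ₗ[RatFunc ℂ] EndProd V :=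
  LinearMap.pi fun i =>
    (LieModule.toEnd (RatFunc ℂ) (RatFunc ℂ ⊗[ℂ] 𝔤) (RatFunc ℂ ⊗[ℂ] V i) : _ →ₗ[RatFunc ℂ] _)

@[simp] theorem act_apply (x : RatFunc ℂ ⊗[ℂ] 𝔤) (i : ι) (w : RatFunc ℂ ⊗[ℂ] V i) :
    act V x i w = ⁅x, w⁆ := rfl

theorem act_lie (x y : RatFunc ℂ ⊗[ℂ] 𝔤) :
    act V ⁅x, y⁆ = act V x * act V y - act V y * act V x := by
  funext i
  refine LinearMap.ext fun w => ?_
  exact lie_lie x y w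

/-- The image of `𝔫_+(z)` in the product of the endomorphism rings. -/
def nImage : Submodule (RatFunc ℂ) (EndProd V) := (ofRat (nPlus b)).map (act V)

variable {V}

theorem exists_bound_of_weightBasis (B : ∀ i, WeightBasis b (V i)) (n : ι → ℤ) :
    ∃ M : ℕ, ∀ i, levelSpan b (V i) n (Set.Ici (-M : ℤ)) = ⊤ ∧
      levelSpan b (V i) n (Set.Ici (M : ℤ)) = ⊥ := by
  choose N hN using fun i => (B i).exists_bound n
  exact ⟨∑ i, N i, fun i => hN i _
    (Finset.single_le_sum (f := N) (fun _ _ => Nat.zero_le _) (Finset.mem_univ i))⟩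

/-- The `k`-th term of the lower central series of `𝔫_+(z)` raises heights by at least `k + 1`. -/
theorem mul_mem_lowerCentral_shift {n : ι → ℤ} {d : ℤ} (hd : 0 < d)
    (hn : ∀ j, ∑ k, n k * cartan b k j = d) (k : ℕ) :
    ∀ X ∈ lowerCentral (nImage b V) k, ∀ (i : ι) (s : ℤ),
      ∀ w ∈ (levelSpan b (V i) n (Set.Ici s)).baseChange (RatFunc ℂ),
        X i w ∈ (levelSpan b (V i) n (Set.Ici (s + (k + 1 : ℕ)))).baseChange (RatFunc ℂ) := by
  have h0 : ∀ X ∈ nImage b V, ∀ (i : ι) (s : ℤ),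
      ∀ w ∈ (levelSpan b (V i) n (Set.Ici s)).baseChange (RatFunc ℂ),
        X i w ∈ (levelSpan b (V i) n (Set.Ici (s + 1))).baseChange (RatFunc ℂ) := by
    rintro _ ⟨x, hx, rfl⟩ i s w hw
    exact lie_mem_baseChange (fun x hx v hv => nPlus_lie_mem b hd hn hx s hv) hx hw
  induction k with
  | zero =>
    rw [zero_add, Nat.cast_one]
    exact h0
  | succ k ih =>
    intro X hX i s w hw
    induction hX using Submodule.span_induction with
    | mem X hX =>
      obtain ⟨Y, hY, Z, hZ, rfl⟩ := hX
      rw [Pi.sub_apply, LinearMap.sub_apply]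
      refine sub_mem ?_ ?_
      · have h1 := h0 Y hY i _ _ (ih Z hZ i s w hw)
        rwa [add_assoc, ← Nat.cast_succ] at h1
      · have h1 := ih Z hZ i _ _ (h0 Y hY i s w hw)
        rwa [add_assoc, add_comm (1 : ℤ), ← Nat.cast_succ] at h1
    | zero => exact zero_mem _
    | add X Y _ _ hX hY => exact add_mem hX hY
    | smul c X _ hX => exact Submodule.smul_mem _ c hX

/-- `𝔫_+(z)` acts as a nilpotent Lie algebra of nilpotent endomorphisms, because it raises the
heights of weights. -/
theorem isUnipotentLie_nImage (B : ∀ i, WeightBasis b (V i)) : IsUnipotentLie (nImage b V) := by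
  obtain ⟨n, d, hd, hn⟩ := exists_coweight b
  obtain ⟨M, hM⟩ := exists_bound_of_weightBasis b B n
  have htop : ∀ i w, w ∈ (levelSpan b (V i) n (Set.Ici (-M : ℤ))).baseChange (RatFunc ℂ) := by
    intro i w
    rw [(hM i).1, Submodule.baseChange_top]
    trivial
  have hbot : ∀ i w, w ∈ (levelSpan b (V i) n (Set.Ici (M : ℤ))).baseChange (RatFunc ℂ) →
      w = 0 := by
    intro i w hw
    rwa [(hM i).2, Submodule.baseChange_bot] at hw
  refine ⟨?_, ?_, 2 * M, ?_⟩
  · rintro _ ⟨x, hx, rfl⟩ _ ⟨y, hy, rfl⟩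
    exact ⟨⁅x, y⁆, lie_mem_baseChange (W := 𝔤)
      (fun x hx y hy => (nPlus b).lie_mem hx hy) hx hy, act_lie V x y⟩
  · intro X hX
    have h1 : ∀ (k : ℕ) (i : ι) (w : RatFunc ℂ ⊗[ℂ] V i), (X ^ k) i w ∈
        (levelSpan b (V i) n (Set.Ici (-M + k : ℤ))).baseChange (RatFunc ℂ) := by
      intro k i w
      induction k with
      | zero => simpa using htop i w
      | succ k ih =>
        rw [pow_succ', Pi.mul_apply, Module.End.mul_apply]
        have h2 := mul_mem_lowerCentral_shift b hd hn 0 X hX i _ _ ih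
        rwa [zero_add, add_assoc, ← Nat.cast_add] at h2
    refine ⟨2 * M, ?_⟩
    funext i
    refine LinearMap.ext fun w => ?_
    refine hbot i _ ?_
    have h2 := h1 (2 * M) i w
    rwa [show (-M + (2 * M : ℕ) : ℤ) = M by push_cast; ring] at h2
  · rw [eq_bot_iff]
    intro X hX
    rw [Submodule.mem_bot]
    funext i
    refine LinearMap.ext fun w => ?_
    refine hbot i _ ?_
    have h2 := mul_mem_lowerCentral_shift b hd hn _ X hX i _ w (htop i w)
    have hle := levelSpan_mono (W := V i) b n (Set.Ici_subset_Ici.2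
      (show (M : ℤ) ≤ -M + (2 * M + 1 : ℕ) by push_cast; linarith))
    exact Submodule.baseChange_mono _ hle h2

variable {b}

theorem isNilpotent_act (B : ∀ i, WeightBasis b (V i)) {x : RatFunc ℂ ⊗[ℂ] 𝔤}
    (hx : x ∈ ofRat (nPlus b)) : IsNilpotent (act V x) :=
  (isUnipotentLie_nImage b B).nilpotent _ ⟨x, hx, rfl⟩

theorem expo_eq_nexp (x : RatFunc ℂ ⊗[ℂ] 𝔤) (i : ι) : expo V x i = nexp (act V x i) := rfl

theorem expo_eq_piUnits (B : ∀ i, WeightBasis b (V i)) {x : RatFunc ℂ ⊗[ℂ] 𝔤}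
    (hx : x ∈ ofRat (nPlus b)) : expo V x = MulEquiv.piUnits (nexp (act V x)) := by
  funext i
  rw [expo_eq_nexp]
  exact (map_nexp (Pi.evalRingHom _ i) (isNilpotent_act B hx)).symm

theorem NPlus_eq_map (B : ∀ i, WeightBasis b (V i)) :
    NPlus b V = (expGroup (nImage b V)).map MulEquiv.piUnits.toMonoidHom := by
  rw [expGroup, MonoidHom.map_closure, NPlus, Set.image_image, nImage]
  congr 1
  ext t
  constructor
  · rintro ⟨x, hx, rfl⟩
    exact ⟨_, ⟨x, hx, rfl⟩, (expo_eq_piUnits B hx).symm⟩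
  · rintro ⟨_, ⟨x, hx, rfl⟩, rfl⟩
    exact ⟨x, hx, expo_eq_piUnits B hx⟩

theorem commutator_NPlus_eq_map (B : ∀ i, WeightBasis b (V i)) :
    ⁅NPlus b V, NPlus b V⁆ =
      (expDerived (nImage b V)).map MulEquiv.piUnits.toMonoidHom := by
  rw [NPlus_eq_map B, Subgroup.map_commutator]

end Unipotent

/-! ### The maximal torus -/

section Torus

variable {ι : Type*} [Fintype ι] [DecidableEq ι]
  {𝔤 : Type*} [LieRing 𝔤] [LieAlgebra ℂ 𝔤] {𝔥 : LieSubalgebra ℂ 𝔤}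
  {b : LieAlgebra.Basis ι 𝔥}
  {V : ι → Type*} [∀ i, AddCommGroup (V i)] [∀ i, Module ℂ (V i)]
  [∀ i, LieRingModule 𝔤 (V i)] [∀ i, LieModule ℂ 𝔤 (V i)]

namespace WeightBasis

variable {W : Type*} [AddCommGroup W] [Module ℂ W] [LieRingModule 𝔤 W] [LieModule ℂ 𝔤 W]
  (B : WeightBasis b W)

/-- The diagonal endomorphism of `ℂ(z) ⊗ W` with eigenvalue `∏ y_j ^ m_j` on weight `m`. -/
def diag (y : ι → RatFunc ℂ) : Module.End (RatFunc ℂ) (RatFunc ℂ ⊗[ℂ] W) :=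
  (B.basis.baseChange (RatFunc ℂ)).constr (RatFunc ℂ) fun k =>
    (∏ j, y j ^ B.wt k j) • ((1 : RatFunc ℂ) ⊗ₜ[ℂ] B.basis k)

theorem diag_tmul_basis (y : ι → RatFunc ℂ) (k : B.κ) :
    B.diag y (1 ⊗ₜ[ℂ] B.basis k) = (∏ j, y j ^ B.wt k j) • ((1 : RatFunc ℂ) ⊗ₜ[ℂ] B.basis k) := by
  rw [diag, ← Module.Basis.baseChange_apply, Module.Basis.constr_basis,
    Module.Basis.baseChange_apply]

theorem linearMap_ext (B : WeightBasis b W) {M : Type*} [AddCommGroup M] [Module (RatFunc ℂ) M]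
    {f g : RatFunc ℂ ⊗[ℂ] W →ₗ[RatFunc ℂ] M}
    (h : ∀ (m : ι → ℤ) (v : W), IsWeightVector b m v → f (1 ⊗ₜ v) = g (1 ⊗ₜ v)) : f = g := by
  refine (B.basis.baseChange (RatFunc ℂ)).ext fun k => ?_
  rw [Module.Basis.baseChange_apply]
  exact h _ _ (B.isWeightVector k)

theorem diag_tmul {m : ι → ℤ} {v : W} (hv : IsWeightVector b m v) (y : ι → RatFunc ℂ) :
    B.diag y (1 ⊗ₜ[ℂ] v) = (∏ j, y j ^ m j) • ((1 : RatFunc ℂ) ⊗ₜ[ℂ] v) := by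
  rw [← B.basis.sum_repr v, TensorProduct.tmul_sum, map_sum, Finset.smul_sum]
  refine Finset.sum_congr rfl fun k _ => ?_
  by_cases hk : B.wt k = m
  · rw [TensorProduct.tmul_smul, LinearMap.map_smul_of_tower, diag_tmul_basis, hk, smul_comm]
  · rw [B.repr_eq_zero hv hk, zero_smul, TensorProduct.tmul_zero, map_zero, smul_zero]

theorem diag_mul_diag {y y' : ι → RatFunc ℂ} (h : ∀ j, y j * y' j = 1) :
    B.diag y * B.diag y' = 1 := by
  refine B.linearMap_ext fun m v hv => ?_
  rw [Module.End.mul_apply, B.diag_tmul hv, map_smul, B.diag_tmul hv, smul_smul,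
    ← Finset.prod_mul_distrib, Module.End.one_apply]
  simp only [← mul_zpow, mul_comm (y' _), h, one_zpow, Finset.prod_const_one, one_smul]

end WeightBasis

theorem exists_isTorusElement (B : ∀ i, WeightBasis b (V i)) {y : ι → RatFunc ℂ}
    (hy : ∀ j, y j ≠ 0) : ∃ t, IsTorusElement b V y t :=
  ⟨fun i => ⟨(B i).diag y, (B i).diag fun j => (y j)⁻¹,
    (B i).diag_mul_diag fun j => mul_inv_cancel₀ (hy j),
    (B i).diag_mul_diag fun j => inv_mul_cancel₀ (hy j)⟩, fun i _ _ hv => (B i).diag_tmul hv y⟩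

theorem IsTorusElement.unique (B : ∀ i, WeightBasis b (V i)) {y : ι → RatFunc ℂ} {t t' : Ambient V}
    (h : IsTorusElement b V y t) (h' : IsTorusElement b V y t') : t = t' := by
  funext i
  refine Units.ext ((B i).linearMap_ext fun m v hv => ?_)
  rw [h i m v hv, h' i m v hv]

/-- Conjugation by the torus preserves `𝔫_+(z)`. -/
theorem IsTorusElement.exists_conj (B : ∀ i, WeightBasis b (V i)) {y : ι → RatFunc ℂ}
    (hy : ∀ j, y j ≠ 0) {t : Ambient V} (h : IsTorusElement b V y t) {x : RatFunc ℂ ⊗[ℂ] 𝔤}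
    (hx : x ∈ ofRat (nPlus b)) : ∃ x' ∈ ofRat (nPlus b), ∀ i,
      (t i).val * act V x i = act V x' i * (t i).val := by
  refine baseChange_induction (p := fun x => ∃ x' ∈ ofRat (nPlus b), ∀ i,
      (t i).val * act V x i = act V x' i * (t i).val) ?_ ?_ ?_ ?_ hx
  · intro x hx
    replace hx : x ∈ LieSubalgebra.lieSpan ℂ 𝔤 (Set.range b.e) := hx
    induction hx using LieSubalgebra.lieSpan_induction with
    | mem x hx =>
      obtain ⟨j, rfl⟩ := hx
      refine ⟨(∏ k, y k ^ cartan b k j) • ((1 : RatFunc ℂ) ⊗ₜ[ℂ] b.e j), Submodule.smul_mem _ _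
        (one_tmul_mem_baseChange (LieSubalgebra.subset_lieSpan ⟨j, rfl⟩)), fun i => ?_⟩
      refine (B i).linearMap_ext fun m v hv => ?_
      rw [Module.End.mul_apply, Module.End.mul_apply, h i m v hv, map_smul, act_apply, act_apply,
        smul_lie, LieAlgebra.ExtendScalars.bracket_tmul, one_mul, h i _ _ (hv.lie_e j), smul_smul,
        ← Finset.prod_mul_distrib]
      congr 1
      exact Finset.prod_congr rfl fun k _ => zpow_add₀ (hy k) _ _
    | zero =>
      refine ⟨0, zero_mem _, fun i => ?_⟩
      simp
    | add u v _ _ hu hv =>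
      obtain ⟨u', hu', hu⟩ := hu
      obtain ⟨v', hv', hv⟩ := hv
      refine ⟨u' + v', add_mem hu' hv', fun i => ?_⟩
      rw [TensorProduct.tmul_add, map_add, map_add, Pi.add_apply, Pi.add_apply, mul_add, add_mul,
        hu, hv]
    | smul c u _ hu =>
      obtain ⟨u', hu', hu⟩ := hu
      refine ⟨RatFunc.C c • u', Submodule.smul_mem _ _ hu', fun i => ?_⟩
      have h1 : (1 : RatFunc ℂ) ⊗ₜ[ℂ] (c • u) = RatFunc.C c • (1 ⊗ₜ[ℂ] u) := by
        rw [TensorProduct.smul_tmul', TensorProduct.tmul_smul, TensorProduct.smul_tmul',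
          RatFunc.smul_eq_C_mul, smul_eq_mul]
      rw [h1, map_smul, map_smul, Pi.smul_apply, Pi.smul_apply, mul_smul_comm, smul_mul_assoc, hu]
    | lie u v _ _ hu hv =>
      obtain ⟨u', hu', hu⟩ := hu
      obtain ⟨v', hv', hv⟩ := hv
      refine ⟨⁅u', v'⁆, lie_mem_baseChange (W := 𝔤)
        (fun x hx y hy => (nPlus b).lie_mem hx hy) hu' hv', fun i => ?_⟩
      have h1 : (1 : RatFunc ℂ) ⊗ₜ[ℂ] ⁅u, v⁆ =
          ⁅(1 : RatFunc ℂ) ⊗ₜ[ℂ] u, (1 : RatFunc ℂ) ⊗ₜ[ℂ] v⁆ := by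
        rw [LieAlgebra.ExtendScalars.bracket_tmul, one_mul]
      rw [h1, act_lie, act_lie, Pi.sub_apply, Pi.sub_apply, Pi.mul_apply, Pi.mul_apply,
        Pi.mul_apply, Pi.mul_apply, mul_sub, sub_mul, ← mul_assoc, hu, mul_assoc, hv, ← mul_assoc,
        ← mul_assoc (t i).val, hv, mul_assoc _ (t i).val, hu, ← mul_assoc]
  · exact ⟨0, zero_mem _, fun i => by simp⟩
  · rintro u v ⟨u', hu', hu⟩ ⟨v', hv', hv⟩
    refine ⟨u' + v', add_mem hu' hv', fun i => ?_⟩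
    rw [map_add, map_add, Pi.add_apply, Pi.add_apply, mul_add, add_mul, hu, hv]
  · rintro c u ⟨u', hu', hu⟩
    refine ⟨c • u', Submodule.smul_mem _ _ hu', fun i => ?_⟩
    rw [map_smul, map_smul, Pi.smul_apply, Pi.smul_apply, mul_smul_comm, smul_mul_assoc, hu]

theorem isNilpotent_act_apply (B : ∀ i, WeightBasis b (V i)) {x : RatFunc ℂ ⊗[ℂ] 𝔤}
    (hx : x ∈ ofRat (nPlus b)) (i : ι) : IsNilpotent (act V x i) :=
  (isNilpotent_act B hx).map (Pi.evalRingHom _ i)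

/-- The torus normalizes `N_+(z)`. -/
theorem torus_conj_mem_NPlus (B : ∀ i, WeightBasis b (V i)) {t n : Ambient V}
    (ht : t ∈ torus b V) (hn : n ∈ NPlus b V) : t * n * t⁻¹ ∈ NPlus b V := by
  obtain ⟨y, hy, h⟩ := ht
  have h1 : NPlus b V ≤ (NPlus b V).comap (MulAut.conj t).toMonoidHom := by
    conv_lhs => rw [NPlus]
    rw [Subgroup.closure_le]
    rintro _ ⟨x, hx, rfl⟩
    obtain ⟨x', hx', hxx'⟩ := h.exists_conj B hy hx
    rw [SetLike.mem_coe, Subgroup.mem_comap]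
    refine Subgroup.subset_closure ⟨x', hx', ?_⟩
    funext i
    change _ = t i * expo V x i * (t i)⁻¹
    rw [expo_eq_nexp, expo_eq_nexp, conj_nexp (isNilpotent_act_apply B hx i), hxx' i,
      mul_assoc, Units.mul_inv, mul_one]
  exact h1 hn

theorem exists_torus_mul_of_mem_BPlus (B : ∀ i, WeightBasis b (V i)) {t : Ambient V}
    (ht : t ∈ BPlus b V) : ∃ h ∈ torus b V, ∃ n ∈ NPlus b V, t = h * n := by
  let P : Subgroup (Ambient V) :=
    { carrier := {t | ∃ h ∈ torus b V, ∃ n ∈ NPlus b V, t = h * n}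
      one_mem' := ⟨1, one_mem _, 1, one_mem _, (one_mul _).symm⟩
      mul_mem' := by
        rintro _ _ ⟨h, hh, n, hn, rfl⟩ ⟨h', hh', n', hn', rfl⟩
        refine ⟨h * h', mul_mem hh hh', h'⁻¹ * n * h' * n', mul_mem ?_ hn', by group⟩
        have h1 := torus_conj_mem_NPlus B (inv_mem hh') hn
        rwa [inv_inv] at h1
      inv_mem' := by
        rintro _ ⟨h, hh, n, hn, rfl⟩
        exact ⟨h⁻¹, inv_mem hh, h * n⁻¹ * h⁻¹, torus_conj_mem_NPlus B hh (inv_mem hn), by group⟩ }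
  have h1 : BPlus b V ≤ P := sup_le (fun h hh => ⟨h, hh, 1, one_mem _, (mul_one _).symm⟩)
    fun n hn => ⟨1, one_mem _, n, hn, (one_mul _).symm⟩
  exact h1 ht

end Torus

/-! ### The action on the planes spanned by `ν_i` and `f_i ν_i` -/

section Plane

variable {ι : Type*} [Fintype ι] [DecidableEq ι]
  {𝔤 : Type*} [LieRing 𝔤] [LieAlgebra ℂ 𝔤] {𝔥 : LieSubalgebra ℂ 𝔤}
  {b : LieAlgebra.Basis ι 𝔥}
  {V : ι → Type*} [∀ i, AddCommGroup (V i)] [∀ i, Module ℂ (V i)]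
  [∀ i, LieRingModule 𝔤 (V i)] [∀ i, LieModule ℂ 𝔤 (V i)]

namespace FundamentalVectors

variable (ν : FundamentalVectors b V)

/-- The highest weight vector `ν_i` in `ℂ(z) ⊗ V_i`. -/
def hi (i : ι) : RatFunc ℂ ⊗[ℂ] V i := 1 ⊗ₜ[ℂ] ν.ν i

/-- The vector `f_i ν_i` in `ℂ(z) ⊗ V_i`. -/
def lo (i : ι) : RatFunc ℂ ⊗[ℂ] V i := 1 ⊗ₜ[ℂ] ⁅b.f i, ν.ν i⁆

theorem isWeightVector_hi (i : ι) :
    IsWeightVector b (fun k => if k = i then 1 else 0) (ν.ν i) := by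
  intro j
  rw [ν.h_lie]
  by_cases h : j = i <;> simp [h]

variable (b) in
/-- The weight `ω_i - α_i` of `f_i ν_i`. -/
def _root_.TwistedOper.lowWeight (i k : ι) : ℤ := (if k = i then 1 else 0) - cartan b k i

theorem isWeightVector_lo (i : ι) : IsWeightVector b (lowWeight b i) ⁅b.f i, ν.ν i⁆ :=
  (ν.isWeightVector_hi i).lie_f i

theorem lowWeight_ne (i : ι) : lowWeight b i ≠ fun k => if k = i then 1 else 0 := by
  intro h
  have h1 := congrFun h i
  simp [lowWeight, cartan_self] at h1

theorem e_lie_f_lie (j i : ι) :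
    ⁅b.e j, ⁅b.f i, ν.ν i⁆⁆ = if j = i then ν.ν i else 0 := by
  rw [leibniz_lie, ν.e_lie, lie_zero, add_zero]
  split_ifs with h
  · subst h
    rw [(b.sl2 j).lie_e_f, ν.h_lie, if_pos rfl, one_smul]
  · rw [b.lie_e_f_ne j i h, zero_lie]

theorem lie_e_lo (c : RatFunc ℂ) (j i : ι) :
    ⁅c ⊗ₜ[ℂ] b.e j, ν.lo i⁆ = if j = i then c • ν.hi i else 0 := by
  rw [lo, LieAlgebra.ExtendScalars.bracket_tmul, ν.e_lie_f_lie, mul_one]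
  split_ifs
  · rw [hi, TensorProduct.smul_tmul', smul_eq_mul, mul_one]
  · rw [TensorProduct.tmul_zero]

theorem lie_e_hi (c : RatFunc ℂ) (j i : ι) : ⁅c ⊗ₜ[ℂ] b.e j, ν.hi i⁆ = 0 := by
  rw [hi, LieAlgebra.ExtendScalars.bracket_tmul, ν.e_lie, TensorProduct.tmul_zero]

/-- A functional on `ℂ(z) ⊗ V_i` that is `1` on the highest weight vector and `0` on all other
weight spaces. -/
theorem exists_functional (B : ∀ i, WeightBasis b (V i)) (i : ι) :
    ∃ l : RatFunc ℂ ⊗[ℂ] V i →ₗ[RatFunc ℂ] RatFunc ℂ, l (ν.hi i) = 1 ∧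
      ∀ (m : ι → ℤ) (v : V i), IsWeightVector b m v → m ≠ (fun k => if k = i then 1 else 0) →
        l (1 ⊗ₜ v) = 0 := by
  obtain ⟨k, hk⟩ : ∃ k, (B i).basis.repr (ν.ν i) k ≠ 0 := by
    by_contra! h
    exact ν.ne_zero i ((B i).basis.ext_elem fun k => by rw [h k, map_zero, Finsupp.zero_apply])
  have hwt : (B i).wt k = fun k => if k = i then 1 else 0 := by
    by_contra hne
    exact hk ((B i).repr_eq_zero (ν.isWeightVector_hi i) hne)
  have hcoord : ∀ v : V i, ((B i).basis.baseChange (RatFunc ℂ)).coord k (1 ⊗ₜ v) =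
      RatFunc.C ((B i).basis.repr v k) := by
    intro v
    rw [Module.Basis.coord_apply, Module.Basis.baseChange_repr_tmul, RatFunc.smul_eq_C_mul, mul_one]
  refine ⟨RatFunc.C ((B i).basis.repr (ν.ν i) k)⁻¹ •
    ((B i).basis.baseChange (RatFunc ℂ)).coord k, ?_, fun m v hv hm => ?_⟩
  · rw [LinearMap.smul_apply, hi, hcoord, smul_eq_mul, ← map_mul, inv_mul_cancel₀ hk, map_one]
  · rw [LinearMap.smul_apply, hcoord, (B i).repr_eq_zero hv fun h => hm (h.symm.trans hwt),
      map_zero, smul_zero]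

theorem coeff_unique (B : ∀ i, WeightBasis b (V i)) {i : ι} {p q p' q' : RatFunc ℂ}
    (h : p • ν.lo i + q • ν.hi i = p' • ν.lo i + q' • ν.hi i) : p = p' ∧ q = q' := by
  obtain ⟨l, hl1, hl0⟩ := ν.exists_functional B i
  have hl0' : l (ν.lo i) = 0 := hl0 _ _ (ν.isWeightVector_lo i) (lowWeight_ne i)
  have h1 := congrArg l h
  have h2 := congrArg (fun w => l ⁅(1 : RatFunc ℂ) ⊗ₜ[ℂ] b.e i, w⁆) h
  simp only [map_add, map_smul, lie_add, lie_smul, lie_e_lo, lie_e_hi, hl1, hl0', smul_zero,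
    if_true, one_smul, zero_add, add_zero, smul_eq_mul, mul_one, mul_zero] at h1 h2
  exact ⟨h2, h1⟩

theorem nPlus_lie_highest {x : 𝔤} (hx : x ∈ nPlus b) (i : ι) : ⁅x, ν.ν i⁆ = 0 := by
  replace hx : x ∈ LieSubalgebra.lieSpan ℂ 𝔤 (Set.range b.e) := hx
  induction hx using LieSubalgebra.lieSpan_induction with
  | mem x hx =>
    obtain ⟨j, rfl⟩ := hx
    exact ν.e_lie i j
  | zero => exact zero_lie _
  | add u v _ _ hu hv => rw [add_lie, hu, hv, add_zero]
  | smul c u _ hu => rw [smul_lie, hu, smul_zero]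
  | lie u v _ _ hu hv => rw [lie_lie, hu, hv, lie_zero, lie_zero, sub_zero]

theorem nPlus_lie_hi {x : RatFunc ℂ ⊗[ℂ] 𝔤} (hx : x ∈ ofRat (nPlus b)) (i : ι) :
    ⁅x, ν.hi i⁆ = 0 := by
  have h1 : ∀ x ∈ (nPlus b).toSubmodule, ∀ v ∈ Submodule.span ℂ {ν.ν i},
      ⁅x, v⁆ ∈ (⊥ : Submodule ℂ (V i)) := by
    intro x hx v hv
    obtain ⟨c, rfl⟩ := Submodule.mem_span_singleton.1 hv
    rw [lie_smul, Submodule.mem_bot, ν.nPlus_lie_highest hx, smul_zero]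
  have h2 := lie_mem_baseChange h1 hx
    (one_tmul_mem_baseChange (Submodule.mem_span_singleton_self (ν.ν i)))
  rwa [Submodule.baseChange_bot, Submodule.mem_bot] at h2

theorem nPlus_lie_lo {x : RatFunc ℂ ⊗[ℂ] 𝔤} (hx : x ∈ ofRat (nPlus b)) (i : ι) :
    ∃ c : RatFunc ℂ, ⁅x, ν.lo i⁆ = c • ν.hi i := by
  refine baseChange_induction (p := fun x => ∃ c : RatFunc ℂ, ⁅x, ν.lo i⁆ = c • ν.hi i)
    ?_ ?_ ?_ ?_ hx
  · intro x hx
    replace hx : x ∈ LieSubalgebra.lieSpan ℂ 𝔤 (Set.range b.e) := hx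
    suffices ∃ c : ℂ, ⁅x, ⁅b.f i, ν.ν i⁆⁆ = c • ν.ν i by
      obtain ⟨c, hc⟩ := this
      refine ⟨RatFunc.C c, ?_⟩
      rw [lo, LieAlgebra.ExtendScalars.bracket_tmul, hc, hi, one_mul, TensorProduct.tmul_smul,
        TensorProduct.smul_tmul', TensorProduct.smul_tmul', RatFunc.smul_eq_C_mul, smul_eq_mul]
    induction hx using LieSubalgebra.lieSpan_induction with
    | mem x hx =>
      obtain ⟨j, rfl⟩ := hx
      refine ⟨if j = i then 1 else 0, ?_⟩
      rw [ν.e_lie_f_lie]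
      split_ifs <;> simp
    | zero => exact ⟨0, by rw [zero_lie, zero_smul]⟩
    | add u v _ _ hu hv =>
      obtain ⟨c, hc⟩ := hu
      obtain ⟨d, hd⟩ := hv
      exact ⟨c + d, by rw [add_lie, hc, hd, add_smul]⟩
    | smul a u _ hu =>
      obtain ⟨c, hc⟩ := hu
      exact ⟨a * c, by rw [smul_lie, hc, mul_smul]⟩
    | lie u v hu' hv' hu hv =>
      obtain ⟨c, hc⟩ := hu
      obtain ⟨d, hd⟩ := hv
      exact ⟨0, by rw [lie_lie, hc, hd, lie_smul, lie_smul, ν.nPlus_lie_highest hu',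
        ν.nPlus_lie_highest hv', smul_zero,
        smul_zero, sub_zero, zero_smul]⟩
  · exact ⟨0, by rw [zero_lie, zero_smul]⟩
  · rintro u v ⟨c, hc⟩ ⟨d, hd⟩
    exact ⟨c + d, by rw [add_lie, hc, hd, add_smul]⟩
  · rintro a u ⟨c, hc⟩
    exact ⟨a * c, by rw [smul_lie, hc, mul_smul]⟩

end FundamentalVectors

end Plane

/-! ### Coordinates of the Borel subgroups on the planes -/

section ExpApply

variable {K M : Type*} [Field K] [CharZero K] [AddCommGroup M] [Module K M]
  [Module ℚ (Module.End K M)]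

theorem exp_apply_eq_sum {X : Module.End K M} (hX : IsNilpotent X) :
    ∃ N : ℕ, ∀ n, N ≤ n → ∀ w, IsNilpotent.exp X w =
      ∑ k ∈ Finset.range n, ((k.factorial : ℚ)⁻¹ : K) • (X ^ k) w := by
  obtain ⟨N, hN⟩ := hX
  refine ⟨N, fun n hn w => ?_⟩
  rw [IsNilpotent.exp_eq_sum (pow_eq_zero_of_le hn hN), LinearMap.sum_apply]
  refine Finset.sum_congr rfl fun k _ => ?_
  rw [← Rat.cast_smul_eq_qsmul K, LinearMap.smul_apply]
  norm_num

theorem exp_apply_eq_add {X : Module.End K M} (hX : IsNilpotent X) {w u : M} (hw : X w = u)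
    (hu : X u = 0) : IsNilpotent.exp X w = w + u := by
  obtain ⟨N, hN⟩ := exp_apply_eq_sum hX
  have h0 : ∀ k, (X ^ (k + 1 + 1)) w = 0 := fun k => by
    rw [pow_succ, pow_succ, Module.End.mul_apply, Module.End.mul_apply, hw, hu, map_zero]
  rw [hN (N + 2) (by omega), Finset.sum_range_succ', Finset.sum_range_succ']
  simp only [h0, smul_zero, Finset.sum_const_zero]
  simp [hw, add_comm]

theorem exp_apply_mem {X : Module.End K M} (hX : IsNilpotent X) {P : Submodule K M}
    (hP : ∀ w ∈ P, X w ∈ P) {w : M} (hw : w ∈ P) : IsNilpotent.exp X w ∈ P := by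
  obtain ⟨N, hN⟩ := exp_apply_eq_sum hX
  rw [hN N le_rfl]
  have hpow : ∀ k : ℕ, (X ^ k) w ∈ P := by
    intro k
    induction k with
    | zero => simpa using hw
    | succ k ih =>
      rw [pow_succ', Module.End.mul_apply]
      exact hP _ ih
  exact Submodule.sum_mem _ fun k _ => Submodule.smul_mem _ _ (hpow k)

end ExpApply

section Coordinates

variable {ι : Type*} [Fintype ι] [DecidableEq ι]
  {𝔤 : Type*} [LieRing 𝔤] [LieAlgebra ℂ 𝔤] {𝔥 : LieSubalgebra ℂ 𝔤}
  {b : LieAlgebra.Basis ι 𝔥}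
  {V : ι → Type*} [∀ i, AddCommGroup (V i)] [∀ i, Module ℂ (V i)]
  [∀ i, LieRingModule 𝔤 (V i)] [∀ i, LieModule ℂ 𝔤 (V i)]

variable (b) in
/-- The value of the weight `ω_i - α_i` on the torus element `∏ y_j ^ α̌_j`. -/
def lowChar (y : ι → RatFunc ℂ) (i : ι) : RatFunc ℂ := ∏ k, y k ^ lowWeight b i k

theorem lowChar_ne_zero {y : ι → RatFunc ℂ} (hy : ∀ j, y j ≠ 0) (i : ι) : lowChar b y i ≠ 0 :=
  Finset.prod_ne_zero_iff.2 fun j _ => zpow_ne_zero _ (hy j)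

theorem lowChar_mul (y y' : ι → RatFunc ℂ) (i : ι) :
    lowChar b (fun j => y j * y' j) i = lowChar b y i * lowChar b y' i := by
  simp only [lowChar, mul_zpow, Finset.prod_mul_distrib]

theorem lowChar_inv (y : ι → RatFunc ℂ) (i : ι) :
    lowChar b (fun j => (y j)⁻¹) i = (lowChar b y i)⁻¹ := by
  simp only [lowChar, inv_zpow, Finset.prod_inv_distrib]

@[simp] theorem lowChar_one (i : ι) : lowChar b (fun _ => 1) i = 1 := by simp [lowChar]

theorem prod_zpow_ite (y : ι → RatFunc ℂ) (i : ι) :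
    ∏ k, y k ^ (if k = i then (1 : ℤ) else 0) = y i := by
  rw [Finset.prod_eq_single i] <;> simp +contextual

theorem lowChar_eq_mul_prod {y : ι → RatFunc ℂ} (hy : ∀ j, y j ≠ 0) (i : ι) :
    lowChar b y i = y i * ∏ k, y k ^ (-cartan b k i) := by
  conv_rhs => rw [← prod_zpow_ite y i]
  rw [← Finset.prod_mul_distrib, lowChar]
  refine Finset.prod_congr rfl fun k _ => ?_
  rw [← zpow_add₀ (hy k), lowWeight, sub_eq_add_neg]

/-- `t` acts on `ν_i` by `y_i` and sends `f_i ν_i` to a multiple of itself plus `y_i c_i ν_i`, the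
multiple being the one by which `∏ y_j ^ α̌_j` acts. On `B_+(z)`, the `y_i` are the coordinates of
the torus part and the `c_i` those of the abelianization of the unipotent part. -/
structure ActsBy (ν : FundamentalVectors b V) (t : Ambient V) (y c : ι → RatFunc ℂ) : Prop where
  hi : ∀ i, (t i).val (ν.hi i) = y i • ν.hi i
  lo : ∀ i, (t i).val (ν.lo i) = lowChar b y i • ν.lo i + (y i * c i) • ν.hi i

variable {ν : FundamentalVectors b V}

theorem ActsBy.mul {t t' : Ambient V} {y c y' c' : ι → RatFunc ℂ} (hy' : ∀ j, y' j ≠ 0)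
    (h : ActsBy ν t y c) (h' : ActsBy ν t' y' c') :
    ActsBy ν (t * t') (fun i => y i * y' i) fun i => lowChar b y' i / y' i * c i + c' i := by
  refine ⟨fun i => ?_, fun i => ?_⟩
  · rw [Pi.mul_apply, Units.val_mul, Module.End.mul_apply, h'.hi, map_smul, h.hi, smul_smul,
      mul_comm]
  · rw [Pi.mul_apply, Units.val_mul, Module.End.mul_apply, h'.lo, map_add, map_smul, map_smul,
      h.hi, h.lo, lowChar_mul, smul_add, smul_smul, smul_smul, smul_smul, add_assoc, ← add_smul,
      mul_comm (lowChar b y i)]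
    congr 2
    have := hy' i
    field_simp

theorem ActsBy.inv {t : Ambient V} {y c : ι → RatFunc ℂ} (hy : ∀ j, y j ≠ 0)
    (h : ActsBy ν t y c) :
    ActsBy ν t⁻¹ (fun i => (y i)⁻¹) fun i => -(y i / lowChar b y i * c i) := by
  have hinv : ∀ i w, ((t⁻¹ i : (Module.End (RatFunc ℂ) (RatFunc ℂ ⊗[ℂ] V i))ˣ)).val
      ((t i).val w) = w := by
    intro i w
    rw [Pi.inv_apply, ← Module.End.mul_apply, Units.inv_mul, Module.End.one_apply]
  have h1 : ∀ i, ((t⁻¹ i : (Module.End (RatFunc ℂ) (RatFunc ℂ ⊗[ℂ] V i))ˣ)).val (ν.hi i) =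
      (y i)⁻¹ • ν.hi i := by
    intro i
    have h2 := hinv i (ν.hi i)
    rw [h.hi, map_smul] at h2
    conv_rhs => rw [← h2, smul_smul, inv_mul_cancel₀ (hy i), one_smul]
  refine ⟨h1, fun i => ?_⟩
  have hl := lowChar_ne_zero (b := b) hy i
  have h2 := hinv i (ν.lo i)
  rw [h.lo, map_add, map_smul, map_smul, h1] at h2
  have h3 : (lowChar b y i)⁻¹ • (ν.lo i - (y i * c i) • (y i)⁻¹ • ν.hi i) =
      ((t⁻¹ i : (Module.End (RatFunc ℂ) (RatFunc ℂ ⊗[ℂ] V i))ˣ)).val (ν.lo i) := by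
    conv_lhs => rw [← h2, add_sub_cancel_right, smul_smul, inv_mul_cancel₀ hl, one_smul]
  rw [← h3, lowChar_inv, smul_sub, smul_smul, smul_smul, sub_eq_add_neg, ← neg_smul]
  congr 2
  have := hy i
  field_simp

theorem ActsBy.unique (B : ∀ i, WeightBasis b (V i)) {t : Ambient V} {y c y' c' : ι → RatFunc ℂ}
    (hy : ∀ j, y j ≠ 0) (h : ActsBy ν t y c) (h' : ActsBy ν t y' c') : y = y' ∧ c = c' := by
  have h1 : y = y' := funext fun i => by
    have h2 := (h.hi i).symm.trans (h'.hi i)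
    refine (ν.coeff_unique B (i := i) (p := 0) (p' := 0) ?_).2
    rw [h2]
  subst h1
  refine ⟨rfl, funext fun i => ?_⟩
  have h2 := (ν.coeff_unique B ((h.lo i).symm.trans (h'.lo i))).2
  exact mul_left_cancel₀ (hy i) h2

theorem IsTorusElement.actsBy {t : Ambient V} {y : ι → RatFunc ℂ} (h : IsTorusElement b V y t) :
    ActsBy ν t y fun _ => 0 := by
  refine ⟨fun i => ?_, fun i => ?_⟩
  · have h1 := h i _ _ (ν.isWeightVector_hi i)
    rw [prod_zpow_ite] at h1
    exact h1
  · rw [mul_zero, zero_smul, add_zero]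
    exact h i _ _ (ν.isWeightVector_lo i)

theorem actsBy_expo (B : ∀ i, WeightBasis b (V i)) {x : RatFunc ℂ ⊗[ℂ] 𝔤}
    (hx : x ∈ ofRat (nPlus b)) {s : ι → RatFunc ℂ} (hs : ∀ i, ⁅x, ν.lo i⁆ = s i • ν.hi i) :
    ActsBy ν (expo V x) (fun _ => 1) s := by
  refine ⟨fun i => ?_, fun i => ?_⟩
  · rw [expo_eq_nexp, val_nexp (isNilpotent_act_apply B hx i), exp_apply_eq_add
      (isNilpotent_act_apply B hx i) (ν.nPlus_lie_hi hx i) (map_zero _), add_zero, one_smul]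
  · have h1 : act V x i (s i • ν.hi i) = 0 := by
      rw [map_smul, act_apply, ν.nPlus_lie_hi hx, smul_zero]
    rw [expo_eq_nexp, val_nexp (isNilpotent_act_apply B hx i), exp_apply_eq_add
      (isNilpotent_act_apply B hx i) (hs i) h1, lowChar_one, one_smul, one_mul]

theorem exists_actsBy_of_mem_NPlus (B : ∀ i, WeightBasis b (V i)) {n : Ambient V}
    (hn : n ∈ NPlus b V) : ∃ c, ActsBy ν n (fun _ => 1) c := by
  rw [NPlus] at hn
  induction hn using Subgroup.closure_induction with
  | mem n hn =>
    obtain ⟨x, hx, rfl⟩ := hn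
    choose s hs using fun i => ν.nPlus_lie_lo hx i
    exact ⟨s, actsBy_expo B hx hs⟩
  | one => exact ⟨_, IsTorusElement.one.actsBy⟩
  | mul n m _ _ hn hm =>
    obtain ⟨c, hc⟩ := hn
    obtain ⟨d, hd⟩ := hm
    have h1 := hc.mul (fun _ => one_ne_zero) hd
    simp only [one_mul] at h1
    exact ⟨_, h1⟩
  | inv n _ hn =>
    obtain ⟨c, hc⟩ := hn
    have h1 := hc.inv fun _ => one_ne_zero
    simp only [inv_one] at h1
    exact ⟨_, h1⟩

theorem exists_actsBy_of_mem_BPlus (B : ∀ i, WeightBasis b (V i)) {t : Ambient V}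
    (ht : t ∈ BPlus b V) : ∃ y c, (∀ j, y j ≠ 0) ∧ ActsBy ν t y c := by
  obtain ⟨h, ⟨y, hy, hh⟩, n, hn, rfl⟩ := exists_torus_mul_of_mem_BPlus B ht
  obtain ⟨c, hc⟩ := exists_actsBy_of_mem_NPlus (ν := ν) B hn
  have h1 := hh.actsBy.mul (fun _ => one_ne_zero) hc
  simp only [mul_one] at h1
  exact ⟨y, _, hy, h1⟩

variable (ν) in
/-- The elements that act on all the planes diagonally and by constants. -/
def constSubgroup : Subgroup (Ambient V) where
  carrier := {t | ∃ k : ι → ℂ, (∀ i, k i ≠ 0) ∧ ActsBy ν t (fun i => RatFunc.C (k i)) fun _ => 0}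
  one_mem' := ⟨fun _ => 1, fun _ => one_ne_zero, by simpa using IsTorusElement.one.actsBy⟩
  mul_mem' := by
    rintro t t' ⟨k, hk, h⟩ ⟨k', hk', h'⟩
    refine ⟨fun i => k i * k' i, fun i => mul_ne_zero (hk i) (hk' i), ?_⟩
    have h1 := h.mul (fun j => by simpa using hk' j) h'
    simpa using h1
  inv_mem' := by
    rintro t ⟨k, hk, h⟩
    refine ⟨fun i => (k i)⁻¹, fun i => inv_ne_zero (hk i), ?_⟩
    have h1 := h.inv fun j => by simpa using hk j
    simpa using h1

theorem framingGroup_le_constSubgroup (B : ∀ i, WeightBasis b (V i)) :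
    framingGroup b V ≤ constSubgroup ν := by
  refine sup_le ?_ (Subgroup.commutator_le.2 ?_)
  · rintro t ⟨k, hk, h⟩
    exact ⟨k, hk, h.actsBy⟩
  · intro n hn m hm
    obtain ⟨c, hc⟩ := exists_actsBy_of_mem_NPlus (ν := ν) B hn
    obtain ⟨d, hd⟩ := exists_actsBy_of_mem_NPlus (ν := ν) B hm
    have h1 : ∀ _ : ι, (1 : RatFunc ℂ) ≠ 0 := fun _ => one_ne_zero
    have h2 : ∀ _ : ι, (1 : RatFunc ℂ)⁻¹ ≠ 0 := fun _ => inv_ne_zero one_ne_zero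
    have h3 := ((hc.mul h1 hd).mul h2 (hc.inv h1)).mul h2 (hd.inv h1)
    refine ⟨fun _ => 1, fun _ => one_ne_zero, ?_⟩
    rw [commutatorElement_def]
    convert h3 using 2 <;> simp

/-- An element of `𝔫_+(z)` is a combination of the `e_i` modulo the derived algebra. -/
theorem exists_act_sub_mem_lowerCentral {x : RatFunc ℂ ⊗[ℂ] 𝔤} (hx : x ∈ ofRat (nPlus b)) :
    ∃ s : ι → RatFunc ℂ,
      act V (x - ∑ i, s i ⊗ₜ[ℂ] b.e i) ∈ lowerCentral (nImage b V) 1 := by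
  have hadd : ∀ x y : RatFunc ℂ ⊗[ℂ] 𝔤,
      (∃ s : ι → RatFunc ℂ, act V (x - ∑ i, s i ⊗ₜ[ℂ] b.e i) ∈ lowerCentral (nImage b V) 1) →
      (∃ s : ι → RatFunc ℂ, act V (y - ∑ i, s i ⊗ₜ[ℂ] b.e i) ∈ lowerCentral (nImage b V) 1) →
      ∃ s : ι → RatFunc ℂ,
        act V (x + y - ∑ i, s i ⊗ₜ[ℂ] b.e i) ∈ lowerCentral (nImage b V) 1 := by
    rintro x y ⟨s, hs⟩ ⟨r, hr⟩
    refine ⟨fun i => s i + r i, ?_⟩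
    have h1 := add_mem hs hr
    rw [← map_add] at h1
    simpa only [TensorProduct.add_tmul, Finset.sum_add_distrib, add_sub_add_comm] using h1
  have hsmul : ∀ (c : RatFunc ℂ) (x : RatFunc ℂ ⊗[ℂ] 𝔤),
      (∃ s : ι → RatFunc ℂ, act V (x - ∑ i, s i ⊗ₜ[ℂ] b.e i) ∈ lowerCentral (nImage b V) 1) →
      ∃ s : ι → RatFunc ℂ, act V (c • x - ∑ i, s i ⊗ₜ[ℂ] b.e i) ∈ lowerCentral (nImage b V) 1 := by
    rintro c x ⟨s, hs⟩
    refine ⟨fun i => c * s i, ?_⟩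
    have h1 := Submodule.smul_mem _ c hs
    rw [← map_smul, smul_sub, Finset.smul_sum] at h1
    simpa only [TensorProduct.smul_tmul', smul_eq_mul] using h1
  have hzero : ∃ s : ι → RatFunc ℂ,
      act V (0 - ∑ i, s i ⊗ₜ[ℂ] b.e i) ∈ lowerCentral (nImage b V) 1 := by
    refine ⟨fun _ => 0, ?_⟩
    simp
  refine baseChange_induction (p := fun x => ∃ s : ι → RatFunc ℂ,
    act V (x - ∑ i, s i ⊗ₜ[ℂ] b.e i) ∈ lowerCentral (nImage b V) 1) ?_ hzero hadd hsmul hx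
  intro x hx
  replace hx : x ∈ LieSubalgebra.lieSpan ℂ 𝔤 (Set.range b.e) := hx
  induction hx using LieSubalgebra.lieSpan_induction with
  | mem x hx =>
    obtain ⟨j, rfl⟩ := hx
    refine ⟨fun i => if i = j then 1 else 0, ?_⟩
    have h1 : ∑ i, (if i = j then (1 : RatFunc ℂ) else 0) ⊗ₜ[ℂ] b.e i = 1 ⊗ₜ[ℂ] b.e j := by
      rw [Finset.sum_eq_single j] <;> simp +contextual
    rw [h1, sub_self, map_zero]
    exact zero_mem _
  | zero => simpa using hzero
  | add u v _ _ hu hv =>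
    rw [TensorProduct.tmul_add]
    exact hadd _ _ hu hv
  | smul c u _ hu =>
    have h1 : (1 : RatFunc ℂ) ⊗ₜ[ℂ] (c • u) = RatFunc.C c • (1 ⊗ₜ[ℂ] u) := by
      rw [TensorProduct.smul_tmul', TensorProduct.tmul_smul, TensorProduct.smul_tmul',
        RatFunc.smul_eq_C_mul, smul_eq_mul]
    rw [h1]
    exact hsmul _ _ hu
  | lie u v hu hv _ _ =>
    refine ⟨fun _ => 0, ?_⟩
    have h1 : (1 : RatFunc ℂ) ⊗ₜ[ℂ] ⁅u, v⁆ =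
        ⁅(1 : RatFunc ℂ) ⊗ₜ[ℂ] u, (1 : RatFunc ℂ) ⊗ₜ[ℂ] v⁆ := by
      rw [LieAlgebra.ExtendScalars.bracket_tmul, one_mul]
    simp only [TensorProduct.zero_tmul, Finset.sum_const_zero, sub_zero]
    rw [h1, act_lie]
    exact lie_mem_lowerCentral ⟨_, one_tmul_mem_baseChange hu, rfl⟩
      ⟨_, one_tmul_mem_baseChange hv, rfl⟩

theorem sum_tmul_e_lie_lo (s : ι → RatFunc ℂ) (i : ι) :
    ⁅∑ j, s j ⊗ₜ[ℂ] b.e j, ν.lo i⁆ = s i • ν.hi i := by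
  rw [sum_lie, Finset.sum_eq_single i]
  · rw [ν.lie_e_lo, if_pos rfl]
  · intro j _ hj
    rw [ν.lie_e_lo, if_neg hj]
  · simp

theorem apply_lo_eq_zero_of_mem_lowerCentral {X : EndProd V}
    (hX : X ∈ lowerCentral (nImage b V) 1) (i : ι) : X i (ν.lo i) = 0 := by
  have hprod : ∀ Y ∈ nImage b V, ∀ Z ∈ nImage b V, Y i (Z i (ν.lo i)) = 0 := by
    rintro _ ⟨y, hy, rfl⟩ _ ⟨z, hz, rfl⟩
    obtain ⟨c, hc⟩ := ν.nPlus_lie_lo hz i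
    rw [act_apply, act_apply, hc, lie_smul, ν.nPlus_lie_hi hy, smul_zero]
  induction hX using Submodule.span_induction with
  | mem X hX =>
    obtain ⟨Y, hY, Z, hZ, rfl⟩ := hX
    change Y i (Z i (ν.lo i)) - Z i (Y i (ν.lo i)) = 0
    rw [hprod Y hY Z hZ, hprod Z hZ Y hY, sub_zero]
  | zero => rfl
  | add X Y _ _ hX hY => rw [Pi.add_apply, LinearMap.add_apply, hX, hY, add_zero]
  | smul c X _ hX => rw [Pi.smul_apply, LinearMap.smul_apply, hX, smul_zero]

/-- The elements of `N_+(z)` that act trivially on the planes form the derived group. -/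
theorem mem_commutator_of_actsBy (B : ∀ i, WeightBasis b (V i)) {n : Ambient V}
    (hn : n ∈ NPlus b V) (h : ActsBy ν n (fun _ => 1) fun _ => 0) :
    n ∈ ⁅NPlus b V, NPlus b V⁆ := by
  have hU := isUnipotentLie_nImage b B
  rw [NPlus_eq_map B] at hn
  obtain ⟨m, hm, rfl⟩ := hn
  obtain ⟨_, ⟨x, hx, rfl⟩, hmx⟩ := hU.exists_nexp_mul_mem_commutator hm
  have h1 : (expo V x)⁻¹ * MulEquiv.piUnits m ∈ ⁅NPlus b V, NPlus b V⁆ := by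
    rw [commutator_NPlus_eq_map B, expo_eq_piUnits B hx, ← map_inv, ← map_mul]
    exact ⟨_, hmx, rfl⟩
  refine (Subgroup.mul_mem_cancel_left _ (inv_mem ?_)).1 h1
  obtain ⟨s, hs⟩ := exists_act_sub_mem_lowerCentral (V := V) hx
  have hlo : ∀ i, ⁅x, ν.lo i⁆ = s i • ν.hi i := by
    intro i
    have h2 : ⁅x - ∑ j, s j ⊗ₜ[ℂ] b.e j, ν.lo i⁆ = 0 :=
      apply_lo_eq_zero_of_mem_lowerCentral hs i
    rwa [sub_lie, sum_tmul_e_lie_lo, sub_eq_zero] at h2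
  -- both `n` and `(exp x)⁻¹ n` act trivially on the planes, hence so does `exp x`
  have hs0 : s = fun _ => 0 := by
    obtain ⟨k, hk, hk'⟩ := framingGroup_le_constSubgroup (ν := ν) B
      (Subgroup.mem_sup_right h1)
    have hx' := (actsBy_expo B hx hlo).mul (fun j => by simpa using hk j) hk'
    rw [mul_inv_cancel_left] at hx'
    have h3 := (hx'.unique B (fun j => by simpa using hk j) h).2
    funext i
    have h4 := congrFun h3 i
    have hl : lowChar b (fun i => RatFunc.C (k i)) i ≠ 0 :=
      lowChar_ne_zero (fun j => by simpa using hk j) i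
    have hki : RatFunc.C (k i) ≠ 0 := by simpa using hk i
    rw [add_zero, mul_eq_zero, div_eq_zero_iff] at h4
    tauto
  rw [commutator_NPlus_eq_map B, expo_eq_piUnits B hx]
  refine ⟨_, hU.nexp_mem_commutator ?_, rfl⟩
  simpa [hs0] using hs

/-- Elements of `B_+(z)` that act in the same way on the planes are congruent modulo
`[N_+(z), N_+(z)]`. -/
theorem inv_mul_mem_commutator_of_actsBy (B : ∀ i, WeightBasis b (V i)) {t t' : Ambient V}
    (ht : t ∈ BPlus b V) (ht' : t' ∈ BPlus b V) {y c : ι → RatFunc ℂ} (hy : ∀ j, y j ≠ 0)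
    (h : ActsBy ν t y c) (h' : ActsBy ν t' y c) : t⁻¹ * t' ∈ ⁅NPlus b V, NPlus b V⁆ := by
  have hdec : ∀ t ∈ BPlus b V, ActsBy ν t y c →
      ∃ g n, IsTorusElement b V y g ∧ n ∈ NPlus b V ∧ t = g * n := by
    intro t ht h
    obtain ⟨g, ⟨z, hz, hg⟩, n, hn, rfl⟩ := exists_torus_mul_of_mem_BPlus B ht
    obtain ⟨d, hd⟩ := exists_actsBy_of_mem_NPlus (ν := ν) B hn
    have h1 := hg.actsBy.mul (fun _ => one_ne_zero) hd
    simp only [mul_one] at h1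
    obtain ⟨rfl, -⟩ := h1.unique B hz h
    exact ⟨g, n, hg, hn, rfl⟩
  obtain ⟨g, n, hg, hn, rfl⟩ := hdec t ht h
  obtain ⟨g', n', hg', hn', rfl⟩ := hdec t' ht' h'
  obtain rfl := hg.unique B hg'
  have h1 : (g * n)⁻¹ * (g * n') = n⁻¹ * n' := by group
  rw [h1]
  refine mem_commutator_of_actsBy (ν := ν) B (mul_mem (inv_mem hn) hn') ?_
  rw [← h1]
  have h2 := (h.inv hy).mul hy h'
  convert h2 using 2 with i i
  · exact (inv_mul_cancel₀ (hy i)).symm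
  · have h3 := hy i
    have h4 := lowChar_ne_zero (b := b) hy i
    field_simp
    ring

/-- Elements of `B_-(z)` send `f_i ν_i` to a vector without component along `ν_i`. -/
theorem exists_functional_BMinus (B : ∀ i, WeightBasis b (V i)) (i : ι) :
    ∃ l : RatFunc ℂ ⊗[ℂ] V i →ₗ[RatFunc ℂ] RatFunc ℂ, l (ν.hi i) = 1 ∧ l (ν.lo i) = 0 ∧
      ∀ t ∈ BMinus b V, l ((t i).val (ν.lo i)) = 0 := by
  obtain ⟨n, d, hd, hn⟩ := exists_coweight b
  obtain ⟨l, hl1, hl0⟩ := ν.exists_functional B i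
  set s := height n fun k => if k = i then 1 else 0 with hs
  set P := (levelSpan b (V i) n (Set.Iio s)).baseChange (RatFunc ℂ) with hP
  have hPl : ∀ w ∈ P, l w = 0 := by
    intro w hw
    refine baseChange_induction (p := fun w => l w = 0) ?_ (map_zero l) ?_ ?_ hw
    · intro v hv
      induction hv using Submodule.span_induction with
      | mem v hv =>
        obtain ⟨m, hm, hT⟩ := hv
        refine hl0 m v hm ?_
        rintro rfl
        exact lt_irrefl s hT
      | zero => rw [TensorProduct.tmul_zero, map_zero]
      | add v w _ _ hv hw => rw [TensorProduct.tmul_add, map_add, hv, hw, add_zero]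
      | smul c v _ hv => rw [TensorProduct.tmul_smul, LinearMap.map_smul_of_tower, hv, smul_zero]
    · intro x y hx hy
      rw [map_add, hx, hy, add_zero]
    · intro c x hx
      rw [map_smul, hx, smul_zero]
  have hlo : ν.lo i ∈ P := by
    refine one_tmul_mem_baseChange (mem_levelSpan b (ν.isWeightVector_lo i) ?_)
    have h1 := height_sub_cartan b hn (fun k => if k = i then 1 else 0) i
    change height n (lowWeight b i) < s
    change height n (lowWeight b i) = _ at h1
    omega
  let Q : Subgroup (Ambient V) :=
    { carrier := {t | (∀ w ∈ P, (t i).val w ∈ P) ∧ ∀ w ∈ P, (t i)⁻¹.val w ∈ P}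
      one_mem' := ⟨fun w hw => hw, fun w hw => by simpa using hw⟩
      mul_mem' := by
        rintro t t' ⟨h1, h2⟩ ⟨h1', h2'⟩
        refine ⟨fun w hw => h1 _ (h1' w hw), fun w hw => ?_⟩
        rw [Pi.mul_apply, mul_inv_rev]
        exact h2' _ (h2 w hw)
      inv_mem' := by
        rintro t ⟨h1, h2⟩
        refine ⟨h2, fun w hw => ?_⟩
        rw [Pi.inv_apply, inv_inv]
        exact h1 w hw }
  have htor : ∀ {t : Ambient V} {y : ι → RatFunc ℂ}, IsTorusElement b V y t →
      ∀ w ∈ P, (t i).val w ∈ P := by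
    intro t y ht w hw
    refine baseChange_induction (p := fun w => (t i).val w ∈ P) ?_ ?_ ?_ ?_ hw
    · intro v hv
      induction hv using Submodule.span_induction with
      | mem v hv =>
        obtain ⟨m, hm, hT⟩ := hv
        rw [ht i m v hm]
        exact Submodule.smul_mem _ _ (one_tmul_mem_baseChange (mem_levelSpan b hm hT))
      | zero => rw [TensorProduct.tmul_zero, map_zero]; exact zero_mem _
      | add v w _ _ hv hw => rw [TensorProduct.tmul_add, map_add]; exact add_mem hv hw
      | smul c v _ hv =>
        rw [TensorProduct.tmul_smul, LinearMap.map_smul_of_tower]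
        exact Submodule.smul_of_tower_mem _ _ hv
    · rw [map_zero]; exact zero_mem _
    · intro x y hx hy
      rw [map_add]; exact add_mem hx hy
    · intro c x hx
      rw [map_smul]; exact Submodule.smul_mem _ _ hx
  have hle : BMinus b V ≤ Q := by
    refine sup_le ?_ ?_
    · rintro t ⟨y, hy, h⟩
      exact ⟨htor h, htor (h.inv hy)⟩
    · rw [NMinus, Subgroup.closure_le]
      rintro _ ⟨x, hx, rfl⟩
      have hX : ∀ x ∈ ofRat (nMinus b), ∀ w ∈ P, act V x i w ∈ P := fun x hx w hw =>
        lie_mem_baseChange (fun x hx v hv => nMinus_lie_mem b hd hn hx s hv) hx hw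
      by_cases hnil : IsNilpotent (act V x i)
      · refine ⟨fun w hw => ?_, fun w hw => ?_⟩
        · rw [expo_eq_nexp, val_nexp hnil]
          exact exp_apply_mem hnil (hX x hx) hw
        · rw [expo_eq_nexp, val_inv_nexp hnil, ← Pi.neg_apply, ← map_neg]
          refine exp_apply_mem ?_ (hX (-x) (neg_mem hx)) hw
          rw [map_neg]
          exact hnil.neg
      · have h1 : expo V x i = 1 := by rw [expo_eq_nexp, nexp, dif_neg hnil]
        refine ⟨fun w hw => ?_, fun w hw => ?_⟩
        · rw [h1]
          exact hw
        · rw [h1, inv_one]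
          exact hw
  exact ⟨l, hl1, hPl _ hlo, fun t ht => hPl _ ((hle ht).1 _ hlo)⟩

end Coordinates

/-! ### Connections on the planes -/

section Connections

/-- The logarithmic derivative as a homomorphism from the multiplicative to the additive group. -/
def logDerivHom : (RatFunc ℂ)ˣ →* Multiplicative (RatFunc ℂ) where
  toFun u := Multiplicative.ofAdd ((u : RatFunc ℂ)⁻¹ * ddz u)
  map_one' := by simp
  map_mul' u v := by
    rw [← ofAdd_add, Units.val_mul, ddz_mul]
    congr 1
    have hu := u.ne_zero
    have hv := v.ne_zero
    field_simp

theorem ddz_prod_zpow {ι : Type*} [Fintype ι] {y : ι → RatFunc ℂ} (hy : ∀ j, y j ≠ 0)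
    (n : ι → ℤ) : ddz (∏ k, y k ^ n k) =
      (∏ k, y k ^ n k) * ∑ k, (n k : RatFunc ℂ) * ((y k)⁻¹ * ddz (y k)) := by
  have h1 : Multiplicative.toAdd (logDerivHom (∏ k, Units.mk0 (y k) (hy k) ^ n k)) =
      ∑ k, (n k : RatFunc ℂ) * ((y k)⁻¹ * ddz (y k)) := by
    rw [map_prod, toAdd_prod]
    refine Finset.sum_congr rfl fun k _ => ?_
    rw [map_zpow, toAdd_zpow, zsmul_eq_mul]
    rfl
  rw [← h1]
  have h2 : ((∏ k, Units.mk0 (y k) (hy k) ^ n k : (RatFunc ℂ)ˣ) : RatFunc ℂ) =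
      ∏ k, y k ^ n k := by
    simp
  change _ = _ * ((((∏ k, Units.mk0 (y k) (hy k) ^ n k : (RatFunc ℂ)ˣ) : RatFunc ℂ))⁻¹ *
    ddz ((∏ k, Units.mk0 (y k) (hy k) ^ n k : (RatFunc ℂ)ˣ) : RatFunc ℂ))
  rw [h2, mul_inv_cancel_left₀ (Finset.prod_ne_zero_iff.2 fun k _ => zpow_ne_zero _ (hy k))]

variable {ι : Type*} [Fintype ι] [DecidableEq ι]
  {𝔤 : Type*} [LieRing 𝔤] [LieAlgebra ℂ 𝔤] {𝔥 : LieSubalgebra ℂ 𝔤}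
  {b : LieAlgebra.Basis ι 𝔥}
  {V : ι → Type*} [∀ i, AddCommGroup (V i)] [∀ i, Module ℂ (V i)]
  [∀ i, LieRingModule 𝔤 (V i)] [∀ i, LieModule ℂ 𝔤 (V i)]
  {ν : FundamentalVectors b V}

theorem conn_add (A : RatFunc ℂ ⊗[ℂ] 𝔤) (i : ι) (x y : RatFunc ℂ ⊗[ℂ] V i) :
    conn A i (x + y) = conn A i x + conn A i y := by
  rw [conn, conn, conn, map_add, lie_add]
  abel

theorem conn_smul (A : RatFunc ℂ ⊗[ℂ] 𝔤) (i : ι) (k : RatFunc ℂ) (x : RatFunc ℂ ⊗[ℂ] V i) :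
    conn A i (k • x) = ddz k • x + k • conn A i x := by
  have h1 : ddz.rTensor (V i) (k • x) = ddz k • x + k • ddz.rTensor (V i) x := by
    induction x using TensorProduct.induction_on with
    | zero => simp
    | tmul a v =>
      rw [TensorProduct.smul_tmul', LinearMap.rTensor_tmul, LinearMap.rTensor_tmul, smul_eq_mul,
        ddz_mul, TensorProduct.add_tmul, TensorProduct.smul_tmul', TensorProduct.smul_tmul',
        smul_eq_mul, smul_eq_mul]
    | add x y hx hy =>
      rw [smul_add, map_add, hx, hy, map_add, smul_add, smul_add]
      abel
  rw [conn, conn, h1, lie_smul, smul_add, add_assoc]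

theorem conn_one_tmul (A : RatFunc ℂ ⊗[ℂ] 𝔤) (i : ι) (v : V i) :
    conn A i (1 ⊗ₜ v) = ⁅A, (1 : RatFunc ℂ) ⊗ₜ[ℂ] v⁆ := by
  rw [conn, LinearMap.rTensor_tmul, ddz_one, TensorProduct.zero_tmul, zero_add]

theorem tmul_h_lie {m : ι → ℤ} {i : ι} {v : V i} (hv : IsWeightVector b m v) (a : RatFunc ℂ)
    (j : ι) : ⁅a ⊗ₜ[ℂ] b.h j, (1 : RatFunc ℂ) ⊗ₜ[ℂ] v⁆ =
      (a * (m j : RatFunc ℂ)) • ((1 : RatFunc ℂ) ⊗ₜ[ℂ] v) := by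
  rw [LieAlgebra.ExtendScalars.bracket_tmul, hv j, TensorProduct.tmul_smul,
    TensorProduct.smul_tmul', TensorProduct.smul_tmul', RatFunc.smul_eq_C_mul, smul_eq_mul,
    mul_one, mul_one, mul_comm, map_intCast]

theorem conn_miura_hi (g L : ι → RatFunc ℂ) (i : ι) :
    conn (miuraMatrix b g L) i (ν.hi i) = g i • ν.hi i := by
  have he : ∀ j, ⁅L j ⊗ₜ[ℂ] b.e j, (1 : RatFunc ℂ) ⊗ₜ[ℂ] ν.ν i⁆ = 0 := fun j =>
    ν.lie_e_hi (L j) j i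
  rw [FundamentalVectors.hi, conn_one_tmul, miuraMatrix, add_lie, sum_lie, sum_lie,
    Finset.sum_congr rfl fun j _ => tmul_h_lie (ν.isWeightVector_hi i) (g j) j,
    Finset.sum_congr rfl fun j _ => he j, Finset.sum_const_zero, add_zero, ← Finset.sum_smul]
  simp

theorem conn_miura_lo (g L : ι → RatFunc ℂ) (i : ι) :
    conn (miuraMatrix b g L) i (ν.lo i) =
      (∑ j, g j * (lowWeight b i j : RatFunc ℂ)) • ν.lo i + L i • ν.hi i := by
  rw [FundamentalVectors.lo, conn_one_tmul, miuraMatrix, add_lie, sum_lie,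
    Finset.sum_congr rfl fun j _ => tmul_h_lie (ν.isWeightVector_lo i) (g j) j,
    ← Finset.sum_smul]
  congr 1
  exact sum_tmul_e_lie_lo L i

theorem twist_eq_miuraMatrix (ζ : ι → ℂ) :
    twist b ζ = miuraMatrix b (fun i => RatFunc.C (ζ i)) fun _ => 0 := by
  rw [twist, miuraMatrix, TensorProduct.tmul_sum]
  simp only [TensorProduct.zero_tmul, Finset.sum_const_zero, add_zero]
  refine Finset.sum_congr rfl fun i _ => ?_
  rw [TensorProduct.tmul_smul, TensorProduct.smul_tmul', RatFunc.smul_eq_C_mul, mul_one]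

theorem sum_C_mul_lowWeight (ζ : ι → ℂ) (i : ι) :
    ∑ j, RatFunc.C (ζ j) * (lowWeight b i j : RatFunc ℂ) =
      RatFunc.C (ζ i) - RatFunc.C (rootValue b ζ i) := by
  simp only [lowWeight, rootValue, map_sum, map_mul, map_intCast, Int.cast_sub, mul_sub,
    Finset.sum_sub_distrib, Int.cast_ite, Int.cast_one, Int.cast_zero, mul_ite, mul_one, mul_zero,
    Finset.sum_ite_eq', Finset.mem_univ, if_true]
  congr 1
  exact Finset.sum_congr rfl fun j _ => mul_comm _ _

theorem mem_plane_iff {i : ι} {w : RatFunc ℂ ⊗[ℂ] V i} :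
    w ∈ ν.plane i ↔ ∃ p q : RatFunc ℂ, p • ν.hi i + q • ν.lo i = w := by
  rw [FundamentalVectors.plane, Submodule.baseChange_span, Set.image_pair, Submodule.mem_span_pair]
  rfl

variable (b) in
/-- The equations for the coordinates `y`, `c` of a trivialization expressing that it transforms
`∂_z + Z` into `∂_z + ∑ g_i α̌_i + ∑ Λ_i e_i` on the planes. -/
def PluckerEq (Λ : ι → ℂ[X]) (ζ : ι → ℂ) (g y c : ι → RatFunc ℂ) : Prop :=
  (∀ i, g i = RatFunc.C (ζ i) - (y i)⁻¹ * ddz (y i)) ∧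
    ∀ i, lowChar b y i * ratOf (Λ i) + y i * ddz (c i) +
      RatFunc.C (rootValue b ζ i) * (y i * c i) = 0

/-- The Plücker condition for a connection in standard form, in the coordinates of the
trivialization. The coefficient of `f_i ν_i` contributes nothing new: it is a consequence of the
equations for the `g_i`. -/
theorem plucker_iff (B : ∀ i, WeightBasis b (V i)) {Λ : ι → ℂ[X]} {ζ : ι → ℂ}
    {g y c : ι → RatFunc ℂ} {t : Ambient V} (hy : ∀ j, y j ≠ 0) (h : ActsBy ν t y c) :
    (∀ i, ∀ w ∈ ν.plane i, conn (miuraMatrix b g fun i => ratOf (Λ i)) i ((t i).val w) =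
      (t i).val (conn (twist b ζ) i w)) ↔ PluckerEq b Λ ζ g y c := by
  -- the two sides of the equation on `ν_i` and on `f_i ν_i`
  have hhi : ∀ i, conn (miuraMatrix b g fun i => ratOf (Λ i)) i ((t i).val (ν.hi i)) =
      (ddz (y i) + y i * g i) • ν.hi i := by
    intro i
    rw [h.hi, conn_smul, conn_miura_hi, smul_smul, ← add_smul]
  have hhi' : ∀ i, (t i).val (conn (twist b ζ) i (ν.hi i)) =
      (RatFunc.C (ζ i) * y i) • ν.hi i := by
    intro i
    rw [twist_eq_miuraMatrix, conn_miura_hi, map_smul, h.hi, smul_smul]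
  have hlo : ∀ i, conn (miuraMatrix b g fun i => ratOf (Λ i)) i ((t i).val (ν.lo i)) =
      (ddz (lowChar b y i) + lowChar b y i * ∑ j, g j * (lowWeight b i j : RatFunc ℂ)) • ν.lo i +
        (lowChar b y i * ratOf (Λ i) + ddz (y i * c i) + y i * c i * g i) • ν.hi i := by
    intro i
    rw [h.lo, conn_add, conn_smul, conn_smul, conn_miura_hi, conn_miura_lo, smul_add, smul_smul,
      smul_smul, smul_smul, add_smul, add_smul, add_smul]
    abel
  have hlo' : ∀ i, (t i).val (conn (twist b ζ) i (ν.lo i)) =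
      ((RatFunc.C (ζ i) - RatFunc.C (rootValue b ζ i)) * lowChar b y i) • ν.lo i +
        ((RatFunc.C (ζ i) - RatFunc.C (rootValue b ζ i)) * (y i * c i)) • ν.hi i := by
    intro i
    rw [twist_eq_miuraMatrix, conn_miura_lo, sum_C_mul_lowWeight, zero_smul, add_zero, map_smul,
      h.lo, smul_add, smul_smul, smul_smul]
  constructor
  · intro hw
    have h1 : ∀ i, g i = RatFunc.C (ζ i) - (y i)⁻¹ * ddz (y i) := by
      intro i
      have h2 := hw i (ν.hi i) (mem_plane_iff.2 ⟨1, 0, by simp⟩)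
      rw [hhi, hhi'] at h2
      have h3 := (ν.coeff_unique B (i := i) (p := 0) (p' := 0)
        (q := ddz (y i) + y i * g i) (q' := RatFunc.C (ζ i) * y i) (by rw [h2])).2
      have := hy i
      field_simp
      linear_combination h3
    refine ⟨h1, fun i => ?_⟩
    have h2 := hw i (ν.lo i) (mem_plane_iff.2 ⟨0, 1, by simp⟩)
    rw [hlo, hlo'] at h2
    have h3 := (ν.coeff_unique B h2).2
    rw [h1 i, ddz_mul] at h3
    have := hy i
    field_simp at h3 ⊢
    linear_combination h3
  · rintro ⟨h1, h2⟩ i w hw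
    obtain ⟨p, q, rfl⟩ := mem_plane_iff.1 hw
    have h3 : (ddz (y i) + y i * g i) = RatFunc.C (ζ i) * y i := by
      rw [h1 i]
      have := hy i
      field_simp
      ring
    have h4 : ddz (lowChar b y i) + lowChar b y i * ∑ j, g j * (lowWeight b i j : RatFunc ℂ) =
        (RatFunc.C (ζ i) - RatFunc.C (rootValue b ζ i)) * lowChar b y i := by
      rw [← sum_C_mul_lowWeight, lowChar, ddz_prod_zpow hy, ← mul_add, ← Finset.sum_add_distrib,
        mul_comm]
      congr 1
      refine Finset.sum_congr rfl fun j _ => ?_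
      rw [h1 j]
      ring
    have h5 : lowChar b y i * ratOf (Λ i) + ddz (y i * c i) + y i * c i * g i =
        (RatFunc.C (ζ i) - RatFunc.C (rootValue b ζ i)) * (y i * c i) := by
      rw [ddz_mul]
      linear_combination h2 i + c i * h3
    have h6 : conn (miuraMatrix b g fun i => ratOf (Λ i)) i ((t i).val (ν.hi i)) =
        (t i).val (conn (twist b ζ) i (ν.hi i)) := by rw [hhi, hhi', h3]
    have h7 : conn (miuraMatrix b g fun i => ratOf (Λ i)) i ((t i).val (ν.lo i)) =
        (t i).val (conn (twist b ζ) i (ν.lo i)) := by rw [hlo, hlo', h4, h5]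
    rw [map_add, map_smul, map_smul, conn_add, conn_smul, conn_smul, h6, h7, conn_add, conn_smul,
      conn_smul, map_add, map_add, map_add, map_smul, map_smul, map_smul, map_smul]

theorem lowChar_ratOf [FiniteDimensional ℂ 𝔤] {qp : ι → ℂ[X]} (hqp : ∀ i, qp i ≠ 0) (i : ι) :
    lowChar b (fun i => ratOf (qp i)) i =
      (ratOf (qp i))⁻¹ * ratOf (∏ j ∈ Finset.univ.erase i, qp j ^ (-cartan b j i).toNat) := by
  have hy : ∀ j, ratOf (qp j) ≠ 0 := fun j => RatFunc.algebraMap_ne_zero (hqp j)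
  rw [lowChar_eq_mul_prod hy, ← Finset.mul_prod_erase _ _ (Finset.mem_univ i), cartan_self,
    show ratOf (∏ j ∈ Finset.univ.erase i, qp j ^ (-cartan b j i).toNat) =
      ∏ j ∈ Finset.univ.erase i, ratOf (qp j) ^ (-cartan b j i).toNat by
        simp only [ratOf, map_prod, map_pow], ← mul_assoc]
  congr 1
  · rw [zpow_neg, zpow_two]
    have := hy i
    field_simp
  · refine Finset.prod_congr rfl fun j hj => ?_
    have h1 := cartan_nonpos b (Finset.ne_of_mem_erase hj)
    rw [← zpow_natCast, Int.toNat_of_nonneg (by omega)]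

/-- For polynomials `q_+` the equations of a Plücker trivialization with `y = q_+` and
`c = -q_- / q_+` are the `qq`-system; see also `qq_iff`. -/
theorem pluckerEq_snd_iff [FiniteDimensional ℂ 𝔤] {Λ qp : ι → ℂ[X]} {r : ℂ}
    (hqp : ∀ i, qp i ≠ 0) (c : RatFunc ℂ) (i : ι) :
    lowChar b (fun i => ratOf (qp i)) i * ratOf (Λ i) + ratOf (qp i) * ddz c +
        RatFunc.C r * (ratOf (qp i) * c) = 0 ↔
      ddz (-c) + RatFunc.C r * -c =
        ratOf (Λ i * ∏ j ∈ Finset.univ.erase i, qp j ^ (-cartan b j i).toNat) /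
          ratOf (qp i) ^ 2 := by
  have hy : ratOf (qp i) ≠ 0 := RatFunc.algebraMap_ne_zero (hqp i)
  rw [lowChar_ratOf hqp, ratOf_mul, map_neg]
  constructor
  · intro h
    field_simp at h ⊢
    linear_combination -h
  · intro h
    field_simp at h ⊢
    linear_combination -h

theorem qq_iff {p m R : ℂ[X]} {r : ℂ} (hp : p ≠ 0) :
    ddz (ratOf m / ratOf p) + RatFunc.C r * (ratOf m / ratOf p) = ratOf R / ratOf p ^ 2 ↔
      (p * Polynomial.derivative m - m * Polynomial.derivative p) +
        Polynomial.C r * (p * m) = R := by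
  have hy : ratOf p ≠ 0 := RatFunc.algebraMap_ne_zero hp
  rw [← (RatFunc.algebraMap_injective ℂ).eq_iff, ddz_eq_quotRule hp rfl, quotRule]
  simp only [map_mul, map_add, map_sub, map_pow, ← RatFunc.algebraMap_C]
  constructor
  · intro h
    field_simp at h
    linear_combination h
  · intro h
    field_simp
    linear_combination h

end Connections

/-! ### Standard forms and framings -/

section Coset

variable {G : Type*} [Group G] {K : Subgroup G} {S : Set G} {p t t' : G}

theorem inv_mul_mem_of_mem_coset (hS : S = p • (K : Set G)) (ht : t ∈ S) (ht' : t' ∈ S) :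
    t⁻¹ * t' ∈ K := by
  rw [hS, mem_leftCoset_iff, SetLike.mem_coe] at ht ht'
  have h1 := mul_mem (inv_mem ht) ht'
  rwa [mul_inv_rev, inv_inv, mul_assoc, mul_inv_cancel_left] at h1

theorem mem_coset_of_inv_mul_mem (hS : S = p • (K : Set G)) (ht : t ∈ S) (h : t⁻¹ * t' ∈ K) :
    t' ∈ S := by
  rw [hS, mem_leftCoset_iff, SetLike.mem_coe] at ht ⊢
  have h1 := mul_mem ht h
  rwa [mul_assoc, mul_inv_cancel_left] at h1

theorem eq_of_smul_subgroup_eq {S : Set G} {a a' : G} (h : a • S = (K : Set G))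
    (h' : a' • S = (K : Set G)) : a' * a⁻¹ ∈ K := by
  have h1 : (a' * a⁻¹) • (K : Set G) = (K : Set G) := by
    rw [← h, smul_smul, inv_mul_cancel_right, h', h]
  have h2 : (a' * a⁻¹) • (1 : G) ∈ (a' * a⁻¹) • (K : Set G) :=
    Set.smul_mem_smul_set (one_mem K)
  rwa [h1, smul_eq_mul, mul_one] at h2

end Coset

theorem zpow_sum_eq_prod {K ι : Type*} [Field K] {x : K} (hx : x ≠ 0) (n : ι → ℤ) (s : Finset ι) :
    x ^ ∑ i ∈ s, n i = ∏ i ∈ s, x ^ n i := by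
  classical
  induction s using Finset.induction_on with
  | empty => simp
  | insert i s hi ih => rw [Finset.sum_insert hi, Finset.prod_insert hi, zpow_add₀ hx, ih]

section Framing

variable {ι : Type*} [Fintype ι] [DecidableEq ι]
  {𝔤 : Type*} [LieRing 𝔤] [LieAlgebra ℂ 𝔤] {𝔥 : LieSubalgebra ℂ 𝔤}
  {b : LieAlgebra.Basis ι 𝔥}
  {V : ι → Type*} [∀ i, AddCommGroup (V i)] [∀ i, Module ℂ (V i)]
  [∀ i, LieRingModule 𝔤 (V i)] [∀ i, LieModule ℂ 𝔤 (V i)]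
  {ν : FundamentalVectors b V} {Λ : ι → ℂ[X]} {ζ : ι → ℂ}

theorem constTorus_le_torus : constTorus b V ≤ torus b V := by
  rintro t ⟨k, hk, h⟩
  exact ⟨_, fun j => by simpa using hk j, h⟩

theorem framingGroup_le_BPlus : framingGroup b V ≤ BPlus b V :=
  sup_le (constTorus_le_torus.trans le_sup_left)
    ((Subgroup.commutator_le_self _).trans le_sup_right)

theorem lowChar_C (k : ι → ℂ) (i : ι) :
    ∃ c : ℂ, lowChar b (fun j => RatFunc.C (k j)) i = RatFunc.C c :=
  ⟨∏ j, k j ^ lowWeight b i j, by simp [lowChar, map_prod, map_zpow₀]⟩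

theorem PluckerEq.mul_C {g y c : ι → RatFunc ℂ} {k : ι → ℂ} (hy : ∀ i, y i ≠ 0)
    (hk : ∀ i, k i ≠ 0) (h : PluckerEq b Λ ζ g y c) :
    PluckerEq b Λ ζ g (fun i => y i * RatFunc.C (k i))
      fun i => lowChar b (fun j => RatFunc.C (k j)) i / RatFunc.C (k i) * c i + 0 := by
  have hk' : ∀ i, RatFunc.C (k i) ≠ 0 := fun i => by simpa using hk i
  refine ⟨fun i => ?_, fun i => ?_⟩
  · rw [h.1 i, ddz_mul, ddz_C]
    have h1 := hy i
    have h2 := hk' i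
    field_simp
    ring
  · obtain ⟨e, he⟩ := lowChar_C (b := b) k i
    have h1 : lowChar b (fun j => RatFunc.C (k j)) i / RatFunc.C (k i) = RatFunc.C (e / k i) := by
      rw [he, map_div₀]
    have h2 : RatFunc.C (k i) * RatFunc.C (e / k i) = RatFunc.C e := by
      rw [← map_mul, mul_div_cancel₀ _ (hk i)]
    beta_reduce
    rw [h1, add_zero, lowChar_mul, he, ddz_mul, ddz_C]
    linear_combination RatFunc.C e * h.2 i +
      (y i * ddz (c i) + RatFunc.C (rootValue b ζ i) * y i * c i) * h2

namespace MPDatum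

variable (D : MPDatum ν Λ ζ) {a t t' : Ambient V} {g y c : ι → RatFunc ℂ}

theorem exists_smul_framing_eq (a : Ambient V) :
    ∃ p : Ambient V, a • D.framing = p • (framingGroup b V : Set (Ambient V)) := by
  obtain ⟨t, -, h⟩ := D.framing_coset
  exact ⟨a * t, by rw [h, smul_smul]⟩

variable {D}

theorem inv_mul_mem_framingGroup (ht : t ∈ a • D.framing) (ht' : t' ∈ a • D.framing) :
    t⁻¹ * t' ∈ framingGroup b V := by
  obtain ⟨p, hp⟩ := D.exists_smul_framing_eq a
  exact inv_mul_mem_of_mem_coset hp ht ht'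

theorem mem_smul_framing (ht : t ∈ a • D.framing) (h : t⁻¹ * t' ∈ framingGroup b V) :
    t' ∈ a • D.framing := by
  obtain ⟨p, hp⟩ := D.exists_smul_framing_eq a
  exact mem_coset_of_inv_mul_mem hp ht h

theorem mul_mem_smul_framing (ht : t ∈ a • D.framing) {k : Ambient V}
    (hk : k ∈ framingGroup b V) : t * k ∈ a • D.framing :=
  mem_smul_framing ht (by rwa [inv_mul_cancel_left])

/-- In the standard form an element of the framing is a product of an element of `B_+(z)` that is
a trivialization of the kind demanded in `MPDatum.framing_coset`, and one of `H[N_+, N_+]`. -/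
theorem exists_mul_eq (h : D.IsStandardForm Λ a g) (ht : t ∈ a • D.framing) :
    ∃ t₁ ∈ BPlus b V, ∃ k ∈ framingGroup b V, t = t₁ * k ∧
      ∀ i, ∀ w ∈ ν.plane i, conn (miuraMatrix b g fun i => ratOf (Λ i)) i ((t₁ i).val w) =
        (t₁ i).val (conn (twist b ζ) i w) := by
  obtain ⟨t₀, ⟨hF, ht₀⟩, hfr⟩ := D.framing_coset
  refine ⟨a * t₀, ?_, (a * t₀)⁻¹ * t, ?_, by rw [mul_inv_cancel_left], fun i w hw => ?_⟩
  · rw [← SetLike.mem_coe, ← h.fplus]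
    exact Set.smul_mem_smul_set hF
  · rw [hfr, smul_smul, mem_leftCoset_iff] at ht
    exact ht
  · rw [Pi.mul_apply, Units.val_mul, Module.End.mul_apply, Module.End.mul_apply, ← h.gauge,
      ht₀ i w hw]

theorem mem_BPlus (h : D.IsStandardForm Λ a g) (ht : t ∈ a • D.framing) : t ∈ BPlus b V := by
  obtain ⟨t₁, h₁, k, hk, rfl, -⟩ := exists_mul_eq h ht
  exact mul_mem h₁ (framingGroup_le_BPlus hk)

theorem pluckerEq (B : ∀ i, WeightBasis b (V i)) (h : D.IsStandardForm Λ a g)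
    (ht : t ∈ a • D.framing) (hy : ∀ i, y i ≠ 0) (hact : ActsBy ν t y c) :
    PluckerEq b Λ ζ g y c := by
  obtain ⟨t₁, h₁, k, hk, rfl, hconn⟩ := exists_mul_eq h ht
  obtain ⟨y₁, c₁, hy₁, hact₁⟩ := exists_actsBy_of_mem_BPlus (ν := ν) B h₁
  obtain ⟨κ, hκ, hactκ⟩ := framingGroup_le_constSubgroup (ν := ν) B hk
  obtain ⟨rfl, rfl⟩ := hact.unique B hy (hact₁.mul (fun j => by simpa using hκ j) hactκ)
  exact ((plucker_iff B hy₁ hact₁).1 hconn).mul_C hy₁ hκ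

/-- The framing determines the coordinates `y_i` up to constants, so it determines them if they are
monic polynomials. -/
theorem eq_of_monic (B : ∀ i, WeightBasis b (V i)) (ht : t ∈ a • D.framing)
    (ht' : t' ∈ a • D.framing) {p p' : ι → ℂ[X]} {c c' : ι → RatFunc ℂ} (hp : ∀ i, (p i).Monic)
    (hp' : ∀ i, (p' i).Monic) (h : ActsBy ν t (fun i => ratOf (p i)) c)
    (h' : ActsBy ν t' (fun i => ratOf (p' i)) c') : p = p' ∧ c = c' := by
  obtain ⟨κ, hκ, hk⟩ := framingGroup_le_constSubgroup (ν := ν) B (inv_mul_mem_framingGroup ht ht')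
  have h1 := h.mul (fun j => by simpa using hκ j) hk
  rw [mul_inv_cancel_left] at h1
  obtain ⟨h2, h3⟩ := h'.unique B (fun j => RatFunc.algebraMap_ne_zero (hp' j).ne_zero) h1
  have h4 : ∀ i, p' i = p i * Polynomial.C (κ i) := by
    intro i
    apply RatFunc.algebraMap_injective ℂ
    rw [map_mul, RatFunc.algebraMap_C]
    exact congrFun h2 i
  have h5 : ∀ i, κ i = 1 := by
    intro i
    have h6 := congrArg Polynomial.leadingCoeff (h4 i)
    rw [Polynomial.leadingCoeff_mul, Polynomial.leadingCoeff_C, (hp i).leadingCoeff,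
      (hp' i).leadingCoeff, one_mul] at h6
    exact h6.symm
  obtain rfl : κ = fun _ => 1 := funext h5
  refine ⟨funext fun i => ?_, ?_⟩
  · rw [h4 i, map_one, mul_one]
  · rw [h3]
    simp

end MPDatum

/-- A change of trivialization between two standard forms is a constant element of the torus, by
which the simple roots take the value `1`. -/
theorem MiuraOper.IsStandardForm.actsBy_mul_inv [FiniteDimensional ℂ 𝔤]
    (B : ∀ i, WeightBasis b (V i)) (hΛ : ∀ i, Λ i ≠ 0) {O : MiuraOper b V} {a a' : Ambient V}
    {g g' : ι → RatFunc ℂ} (h : O.IsStandardForm Λ a g) (h' : O.IsStandardForm Λ a' g') :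
    ∃ s : ι → ℂ, (∀ i, s i ≠ 0) ∧ ActsBy ν (a' * a⁻¹) (fun i => RatFunc.C (s i)) (fun _ => 0) ∧
      ∀ i, lowChar b (fun i => RatFunc.C (s i)) i = RatFunc.C (s i) := by
  have hplus := eq_of_smul_subgroup_eq h.fplus h'.fplus
  have hminus := eq_of_smul_subgroup_eq h.fminus h'.fminus
  have hgauge := h.gauge.symm.trans h'.gauge
  obtain ⟨s, c, hs, hact⟩ := exists_actsBy_of_mem_BPlus (ν := ν) B hplus
  have hc : c = fun _ => 0 := by
    funext i
    obtain ⟨l, hl1, hl0, hl⟩ := exists_functional_BMinus (ν := ν) B i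
    have h1 := hl _ hminus
    rw [hact.lo, map_add, map_smul, map_smul, hl0, hl1, smul_zero, zero_add, smul_eq_mul,
      mul_one] at h1
    exact (mul_eq_zero.1 h1).resolve_left (hs i)
  subst hc
  -- compare the coefficients of `ν_i` in the gauge transformation applied to `f_i ν_i`
  have hlow : ∀ i, lowChar b s i = s i := by
    intro i
    have h1 := hgauge i (ν.lo i)
    rw [conn_miura_lo, map_add, map_smul, map_smul, hact.lo, hact.hi, mul_zero, zero_smul, add_zero,
      conn_smul, conn_miura_lo, smul_add, smul_smul, smul_smul, smul_smul, smul_smul, ← add_assoc,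
      ← add_smul] at h1
    have h2 := (ν.coeff_unique B h1).2
    rw [mul_comm] at h2
    exact (mul_right_cancel₀ (RatFunc.algebraMap_ne_zero (hΛ i)) h2).symm
  have hroot : ∀ i, ∏ k, s k ^ cartan b k i = 1 := by
    intro i
    have h1 := hlow i
    rw [lowChar_eq_mul_prod hs] at h1
    have h2 := mul_left_cancel₀ (hs i) (h1.trans (mul_one _).symm)
    simp only [zpow_neg, Finset.prod_inv_distrib, inv_eq_one] at h2
    exact h2
  -- the Cartan matrix is invertible over `ℚ`
  have hconst : ∀ j, ∃ e : ℂ, e ≠ 0 ∧ s j = RatFunc.C e := by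
    intro j
    set d := (cartan b).det with hd
    have h1 : s j ^ d = 1 := by
      have h2 : ∏ k, s k ^ ((cartan b * (cartan b).adjugate) k j) = 1 := by
        simp only [Matrix.mul_apply]
        calc ∏ k, s k ^ ∑ i, cartan b k i * (cartan b).adjugate i j
            = ∏ k, ∏ i, (s k ^ cartan b k i) ^ (cartan b).adjugate i j := by
              refine Finset.prod_congr rfl fun k _ => ?_
              rw [zpow_sum_eq_prod (hs k)]
              exact Finset.prod_congr rfl fun i _ => zpow_mul _ _ _
          _ = ∏ i, (∏ k, s k ^ cartan b k i) ^ (cartan b).adjugate i j := by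
              rw [Finset.prod_comm]
              exact Finset.prod_congr rfl fun i _ => Finset.prod_zpow _ _ _
          _ = 1 := by simp [hroot]
      rw [Matrix.mul_adjugate, ← hd, Finset.prod_eq_single j] at h2
      · simpa using h2
      · intro k _ hk
        simp [Matrix.one_apply_ne hk]
      · simp
    refine eq_C_of_pow_eq_one (n := d.natAbs) (Int.natAbs_ne_zero.2 (det_cartan_ne_zero b)) ?_
    rcases Int.natAbs_eq d with h2 | h2
    · rw [h2, zpow_natCast] at h1
      exact h1
    · rw [h2, zpow_neg, zpow_natCast, inv_eq_one] at h1
      exact h1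
  choose e he hse using hconst
  obtain rfl : s = fun i => RatFunc.C (e i) := funext hse
  exact ⟨e, he, hact, hlow⟩

/-- The datum `D` corresponds to the solution `q`: in some standard form, the framing has the
coordinates `q_+` and `-q_- / q_+`. -/
def Corresponds (D : MPDatum ν Λ ζ) (q : NondegSolution b Λ ζ) : Prop :=
  ∃ a g, D.IsStandardForm Λ a g ∧ ∃ t ∈ a • D.framing,
    ActsBy ν t (fun i => ratOf (q.qp i)) fun i => -(ratOf (q.qm i) / ratOf (q.qp i))

theorem NondegSolution.ratOf_qp_ne_zero (q : NondegSolution b Λ ζ) (i : ι) :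
    ratOf (q.qp i) ≠ 0 := RatFunc.algebraMap_ne_zero (q.monic i).ne_zero

/-- The property demanded in `Corresponds` holds in every standard form: the constants by which the
coordinates change between standard forms are absorbed by the framing group. -/
theorem Corresponds.exists_mem [FiniteDimensional ℂ 𝔤] (B : ∀ i, WeightBasis b (V i))
    (hΛ : ∀ i, Λ i ≠ 0) {D : MPDatum ν Λ ζ} {q : NondegSolution b Λ ζ} (h : Corresponds D q)
    {a : Ambient V} {g : ι → RatFunc ℂ} (ha : D.IsStandardForm Λ a g) :
    ∃ t ∈ a • D.framing,
      ActsBy ν t (fun i => ratOf (q.qp i)) fun i => -(ratOf (q.qm i) / ratOf (q.qp i)) := by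
  obtain ⟨a₀, g₀, h₀, t, ht, hact⟩ := h
  obtain ⟨s, hs, hact', hlow⟩ := h₀.actsBy_mul_inv (ν := ν) B hΛ ha
  have hs' : ∀ i, RatFunc.C (s i) ≠ 0 := fun i => by simpa using hs i
  have hs'' : ∀ i, RatFunc.C (s i)⁻¹ ≠ 0 := fun i => by simpa using hs i
  obtain ⟨k, hk⟩ := exists_isTorusElement B hs''
  have hk' : k ∈ framingGroup b V :=
    Subgroup.mem_sup_left ⟨fun i => (s i)⁻¹, fun i => inv_ne_zero (hs i), hk⟩
  refine ⟨a * a₀⁻¹ * t * k, MPDatum.mul_mem_smul_framing ?_ hk', ?_⟩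
  · obtain ⟨u, hu, rfl⟩ := ht
    refine ⟨u, hu, ?_⟩
    simp only [smul_eq_mul]
    group
  · have h1 := (hact'.mul q.ratOf_qp_ne_zero hact).mul hs'' hk.actsBy
    have h2 : ∀ i, lowChar b (fun i => RatFunc.C (s i)⁻¹) i = RatFunc.C (s i)⁻¹ := by
      intro i
      simp only [map_inv₀]
      rw [lowChar_inv, hlow]
    convert h1 using 2 with i i
    · rw [mul_right_comm, ← map_mul, mul_inv_cancel₀ (hs i), map_one, one_mul]
    · rw [h2, div_self (hs'' i)]
      ring

theorem Corresponds.unique [FiniteDimensional ℂ 𝔤] (B : ∀ i, WeightBasis b (V i))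
    (hΛ : ∀ i, Λ i ≠ 0) {D : MPDatum ν Λ ζ} {q q' : NondegSolution b Λ ζ} (h : Corresponds D q)
    (h' : Corresponds D q') : q = q' := by
  obtain ⟨a, g, ha, t', ht', hact'⟩ := h'
  obtain ⟨t, ht, hact⟩ := h.exists_mem B hΛ ha
  obtain ⟨h1, h2⟩ := MPDatum.eq_of_monic B ht ht' q.monic q'.monic hact hact'
  refine NondegSolution.ext h1 (funext fun i => RatFunc.algebraMap_injective ℂ ?_)
  have h3 := congrFun h2 i
  rw [← h1, neg_inj] at h3
  exact (div_left_inj' (q.ratOf_qp_ne_zero i)).1 h3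

theorem Corresponds.of_equiv {D D' : MPDatum ν Λ ζ} {q : NondegSolution b Λ ζ} (h : Corresponds D q)
    (hD : (mpSetoid ν Λ ζ).r D D') : Corresponds D' q := by
  obtain ⟨a, g, ha, t, ht, hact⟩ := h
  obtain ⟨u, hu, h1, h2, h3, h4⟩ := hD
  refine ⟨a * u⁻¹, g, ⟨mul_mem ha.mem (inv_mem hu), h1.symm.trans ha.gauge, ?_, ?_⟩, t, ?_, hact⟩
  · rw [h2, smul_smul, inv_mul_cancel_right, ha.fminus]
  · rw [h3, smul_smul, inv_mul_cancel_right, ha.fplus]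
  · rwa [h4, smul_smul, inv_mul_cancel_right]

theorem Corresponds.equiv (B : ∀ i, WeightBasis b (V i))
    {D D' : MPDatum ν Λ ζ} {q : NondegSolution b Λ ζ} (h : Corresponds D q)
    (h' : Corresponds D' q) : (mpSetoid ν Λ ζ).r D D' := by
  obtain ⟨a, g, ha, t, ht, hact⟩ := h
  obtain ⟨a', g', ha', t', ht', hact'⟩ := h'
  have hg : g = g' := funext fun i => by
    rw [(MPDatum.pluckerEq B ha ht q.ratOf_qp_ne_zero hact).1,
      (MPDatum.pluckerEq B ha' ht' q.ratOf_qp_ne_zero hact').1]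
  subst hg
  refine ⟨a'⁻¹ * a, mul_mem (inv_mem ha'.mem) ha.mem, ha.gauge.trans ha'.gauge.symm, ?_, ?_, ?_⟩
  · rw [mul_smul, ha.fminus, ← ha'.fminus, inv_smul_smul]
  · rw [mul_smul, ha.fplus, ← ha'.fplus, inv_smul_smul]
  · have h1 := inv_mul_mem_commutator_of_actsBy B (MPDatum.mem_BPlus ha ht)
      (MPDatum.mem_BPlus ha' ht') q.ratOf_qp_ne_zero hact hact'
    obtain ⟨p, hp⟩ := D.exists_smul_framing_eq a
    obtain ⟨p', hp'⟩ := D'.exists_smul_framing_eq a'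
    have h2 : t' ∈ a • D.framing := MPDatum.mem_smul_framing ht (Subgroup.mem_sup_right h1)
    rw [mul_smul, eq_inv_smul_iff]
    ext x
    exact ⟨fun hx => mem_coset_of_inv_mul_mem hp h2 (inv_mul_mem_of_mem_coset hp' ht' hx),
      fun hx => mem_coset_of_inv_mul_mem hp' ht' (inv_mul_mem_of_mem_coset hp h2 hx)⟩

/-! ### From nondegenerate data to solutions of the `qq`-system -/

theorem HNondegenerate.of_C_mul {A : Matrix ι ι ℤ} {L : ι → RatFunc ℂ} {p : ι → ℂ[X]} {k : ι → ℂ}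
    (hk : ∀ i, k i ≠ 0) (h : HNondegenerate A L fun i => ratOf (Polynomial.C (k i) * p i)) :
    HNondegenerate A L fun i => ratOf (p i) := by
  have hz : ∀ i c, IsZeroAt (ratOf (Polynomial.C (k i) * p i)) c ↔ IsZeroAt (ratOf (p i)) c := by
    intro i c
    rw [isZeroAt_ratOf, isZeroAt_ratOf, Polynomial.IsRoot, Polynomial.IsRoot, Polynomial.eval_mul,
      Polynomial.eval_C, mul_eq_zero, or_iff_right (hk i)]
  refine ⟨fun i h0 => h.ne_zero i ?_, fun i c => ?_, fun i c => ?_, fun i c hc => ?_,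
    fun i j hij ha c hc => ?_⟩
  · rw [ratOf_mul, h0, mul_zero]
  · have h1 := h.simple_zero i c
    rw [num_ratOf, ← Polynomial.count_roots, Polynomial.roots_C_mul _ (hk i),
      Polynomial.count_roots] at h1
    rwa [num_ratOf]
  · rw [denom_ratOf, ← map_one Polynomial.C, Polynomial.rootMultiplicity_C]
    exact zero_le_one
  · exact ⟨fun h1 => (h.disjoint_sing i c hc).1 ((hz i c).2 h1), not_isPoleAt_ratOf _ _⟩
  · have h1 : ∀ i, IsZeroAt (ratOf (p i)) c ∨ IsPoleAt (ratOf (p i)) c →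
        IsZeroAt (ratOf (Polynomial.C (k i) * p i)) c ∨
          IsPoleAt (ratOf (Polynomial.C (k i) * p i)) c := fun i h2 =>
      Or.inl ((hz i c).2 (h2.resolve_right (not_isPoleAt_ratOf _ _)))
    exact h.disjoint_adj i j hij ha c ⟨h1 i hc.1, h1 j hc.2⟩

/-- All rational functions with the logarithmic derivative of a given polynomial are multiples of
one monic polynomial. -/
theorem exists_monic_of_logDeriv_eq {p : ℂ[X]} (hp : p ≠ 0) : ∃ P : ℂ[X], P.Monic ∧
    ∀ y : RatFunc ℂ, y ≠ 0 → y⁻¹ * ddz y = (ratOf p)⁻¹ * ddz (ratOf p) →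
      ∃ k : ℂ, k ≠ 0 ∧ y = ratOf (Polynomial.C k * P) := by
  have hl : p.leadingCoeff ≠ 0 := Polynomial.leadingCoeff_ne_zero.2 hp
  refine ⟨p * Polynomial.C p.leadingCoeff⁻¹, Polynomial.monic_mul_leadingCoeff_inv hp,
    fun y hy h => ?_⟩
  obtain ⟨c, hc, rfl⟩ := exists_C_mul_of_logDeriv_eq hy (RatFunc.algebraMap_ne_zero hp) h
  refine ⟨c * p.leadingCoeff, mul_ne_zero hc hl, ?_⟩
  have h1 : Polynomial.C (c * p.leadingCoeff) * (p * Polynomial.C p.leadingCoeff⁻¹) =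
      Polynomial.C c * p := by
    rw [mul_left_comm, ← map_mul, mul_inv_cancel_right₀ hl, mul_comm]
  rw [h1, ratOf_mul, ratOf, ratOf, RatFunc.algebraMap_C]

/-- A nondegenerate datum corresponds to a solution: the Cartan connection forces the coordinates
`y_i` of the framing to be multiples of monic polynomials `q^i_+`, and the equations for the `c_i`
force `-c_i q^i_+` to be a polynomial. -/
theorem exists_corresponds [FiniteDimensional ℂ 𝔤] (B : ∀ i, WeightBasis b (V i))
    {D : MPDatum ν Λ ζ} (hD : D.Nondegenerate Λ ζ) :
    ∃ q : NondegSolution b Λ ζ, Corresponds D q := by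
  obtain ⟨a, g, y, ha, hg, hN, hSL⟩ := hD
  obtain ⟨t, ht⟩ : (a • D.framing).Nonempty := by
    obtain ⟨p, hp⟩ := D.exists_smul_framing_eq a
    exact ⟨p, hp ▸ mem_own_leftCoset _ p⟩
  obtain ⟨z, c, hz, hact⟩ := exists_actsBy_of_mem_BPlus (ν := ν) B (MPDatum.mem_BPlus ha ht)
  have hgz := (MPDatum.pluckerEq B ha ht hz hact).1
  -- by `SL(2)`-nondegeneracy, the `y_i` and `z_i` are polynomials
  have hP : ∀ i, ∃ (P : ℂ[X]) (k m : ℂ), P.Monic ∧ k ≠ 0 ∧ m ≠ 0 ∧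
      z i = ratOf (Polynomial.C k * P) ∧ y i = ratOf (Polynomial.C m * P) := by
    intro i
    obtain ⟨Y, hgY, hY, p, rfl⟩ := hSL i
    have hp : p ≠ 0 := fun h => hY.ne_zero () (by rw [h, ratOf, map_zero])
    obtain ⟨P, hPm, hPeq⟩ := exists_monic_of_logDeriv_eq hp
    obtain ⟨k, hk, hzk⟩ := hPeq (z i) (hz i) (by
      linear_combination hgz i - hgY)
    obtain ⟨m, hm, hym⟩ := hPeq (y i) (hN.ne_zero i) (by
      linear_combination hg i - hgY)
    exact ⟨P, k, m, hPm, hk, hm, hzk, hym⟩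
  choose P k m hPm hk hm hzk hym using hP
  obtain rfl : z = _ := funext hzk
  obtain rfl : y = _ := funext hym
  have hPN := hN.of_C_mul hm
  -- move within the framing to make the first coordinates monic
  have hk' : ∀ i, RatFunc.C (k i)⁻¹ ≠ 0 := fun i => by simpa using hk i
  obtain ⟨h, hh⟩ := exists_isTorusElement B hk'
  have ht' := MPDatum.mul_mem_smul_framing ht (k := h)
    (Subgroup.mem_sup_left ⟨fun i => (k i)⁻¹, fun i => inv_ne_zero (hk i), hh⟩)
  have hact' := hact.mul hk' (hh.actsBy (ν := ν))
  have hy' : (fun i => ratOf (Polynomial.C (k i) * P i) * RatFunc.C (k i)⁻¹) =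
      fun i => ratOf (P i) := by
    funext i
    rw [ratOf_mul, ratOf, RatFunc.algebraMap_C, mul_right_comm, ← map_mul, mul_inv_cancel₀ (hk i),
      map_one, one_mul]
  rw [hy'] at hact'
  generalize (fun i => lowChar b (fun i => RatFunc.C (k i)⁻¹) i / RatFunc.C (k i)⁻¹ * c i + 0) = d
    at hact'
  have hP0 : ∀ i, P i ≠ 0 := fun i => (hPm i).ne_zero
  have hPr : ∀ i, ratOf (P i) ≠ 0 := fun i => RatFunc.algebraMap_ne_zero (hP0 i)
  have hpl := (MPDatum.pluckerEq B ha ht' hPr hact').2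
  have heq := fun i => (pluckerEq_snd_iff hP0 (d i) i).1 (hpl i)
  have hsimple : ∀ i c, (P i).rootMultiplicity c ≤ 1 := fun i c => by
    have h1 := hPN.simple_zero i c
    rwa [num_ratOf] at h1
  choose M hM using fun i => exists_polynomial_of_ddz_add_eq (hP0 i) (hsimple i) (heq i)
  have hd : ∀ i, -d i = ratOf (M i) / ratOf (P i) := fun i => by
    rw [← hM i, mul_div_cancel_right₀ _ (hPr i)]
  refine ⟨⟨P, M, fun i => ?_, hPm, hPN⟩, a, g, ha, _, ht', ?_⟩
  · rw [← qq_iff (hP0 i), ← hd i]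
    exact heq i
  · have h1 : (fun i => -(ratOf (M i) / ratOf (P i))) = d := funext fun i => by
      rw [← hd i, neg_neg]
    change ActsBy ν _ (fun i => ratOf (P i)) fun i => -(ratOf (M i) / ratOf (P i))
    rw [h1]
    exact hact'

/-! ### From solutions of the `qq`-system to nondegenerate data -/

theorem tmul_e_mem_nPlus (s : RatFunc ℂ) (i : ι) : s ⊗ₜ[ℂ] b.e i ∈ ofRat (nPlus b) :=
  Submodule.tmul_mem_baseChange_of_mem _ (LieSubalgebra.subset_lieSpan ⟨i, rfl⟩)

theorem prod_expo_mem_NPlus (s : ι → RatFunc ℂ) (l : List ι) :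
    (l.map fun i => expo V (s i ⊗ₜ[ℂ] b.e i)).prod ∈ NPlus b V := by
  refine Subgroup.list_prod_mem _ fun x hx => ?_
  obtain ⟨i, -, rfl⟩ := List.mem_map.1 hx
  exact Subgroup.subset_closure ⟨_, tmul_e_mem_nPlus (s i) i, rfl⟩

theorem actsBy_prod_expo (B : ∀ i, WeightBasis b (V i)) (s : ι → RatFunc ℂ) (l : List ι) :
    ActsBy ν (l.map fun i => expo V (s i ⊗ₜ[ℂ] b.e i)).prod (fun _ => 1)
      fun i => l.count i * s i := by
  induction l with
  | nil => simpa using IsTorusElement.one.actsBy (ν := ν)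
  | cons j l ih =>
    rw [List.map_cons, List.prod_cons]
    have h1 : ∀ i, ⁅s j ⊗ₜ[ℂ] b.e j, ν.lo i⁆ = (if j = i then s j else 0) • ν.hi i := by
      intro i
      rw [ν.lie_e_lo]
      split_ifs <;> simp
    have h2 := (actsBy_expo B (tmul_e_mem_nPlus (s j) j) h1).mul (fun _ => one_ne_zero) ih
    convert h2 using 2 with i i
    · rw [one_mul]
    · rw [lowChar_one, div_one, one_mul, List.count_cons]
      by_cases hji : j = i
      · subst hji
        simp
        ring
      · simp [hji]

theorem torus_mul_prod_expo_mem_BPlus {y : ι → RatFunc ℂ} (hy : ∀ i, y i ≠ 0) {h : Ambient V}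
    (hh : IsTorusElement b V y h) (s : ι → RatFunc ℂ) (l : List ι) :
    h * (l.map fun i => expo V (s i ⊗ₜ[ℂ] b.e i)).prod ∈ BPlus b V :=
  mul_mem (Subgroup.mem_sup_left ⟨y, hy, hh⟩) (Subgroup.mem_sup_right (prod_expo_mem_NPlus s l))

theorem actsBy_torus_mul_prod_expo (B : ∀ i, WeightBasis b (V i)) {y : ι → RatFunc ℂ}
    {h : Ambient V} (hh : IsTorusElement b V y h) (s : ι → RatFunc ℂ) {l : List ι}
    (hl : l.Nodup) (hl' : ∀ i, i ∈ l) :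
    ActsBy ν (h * (l.map fun i => expo V (s i ⊗ₜ[ℂ] b.e i)).prod) y s := by
  have h1 := hh.actsBy.mul (fun _ => one_ne_zero) (actsBy_prod_expo (ν := ν) B s l)
  convert h1 using 2 with i i
  · rw [mul_one]
  · rw [List.count_eq_one_of_mem hl (hl' i)]
    simp

theorem miuraMatrix_mem_bPlus (g L : ι → RatFunc ℂ) : miuraMatrix b g L ∈ ofRat (bPlus b) :=
  add_mem
    (Submodule.sum_mem _ fun i _ => Submodule.tmul_mem_baseChange_of_mem _
      (LieSubalgebra.subset_lieSpan (Set.mem_union_right _ (Set.mem_range_self i))))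
    (Submodule.sum_mem _ fun i _ => Submodule.tmul_mem_baseChange_of_mem _
      (LieSubalgebra.subset_lieSpan (Set.mem_union_left _ (Set.mem_range_self i))))

theorem hasOperForm_miuraMatrix (g L : ι → RatFunc ℂ) :
    HasOperForm b L (miuraMatrix b g L) (BMinus b V : Set (Ambient V)) := by
  refine ⟨1, one_mem _, ∑ i, g i ⊗ₜ[ℂ] b.h i, Submodule.sum_mem _ fun i _ =>
    Submodule.tmul_mem_baseChange_of_mem _
      (LieSubalgebra.subset_lieSpan (Set.mem_union_right _ (Set.mem_range_self i))), ?_⟩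
  rw [add_comm]
  exact IsGauge.refl _

namespace NondegSolution

variable [FiniteDimensional ℂ 𝔤] (q : NondegSolution b Λ ζ)

/-- The coefficients `ζ_i - (q^i_+)⁻¹ ∂_z q^i_+` of the Cartan connection. -/
def cartanCoeff (i : ι) : RatFunc ℂ :=
  RatFunc.C (ζ i) - (ratOf (q.qp i))⁻¹ * ddz (ratOf (q.qp i))

theorem pluckerEq : PluckerEq b Λ ζ q.cartanCoeff (fun i => ratOf (q.qp i))
    fun i => -(ratOf (q.qm i) / ratOf (q.qp i)) := by
  refine ⟨fun i => rfl, fun i => ?_⟩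
  have hqp : ∀ i, q.qp i ≠ 0 := fun i => (q.monic i).ne_zero
  rw [pluckerEq_snd_iff hqp, neg_neg, qq_iff (hqp i)]
  exact q.qq i

theorem sl2Nondegenerate (i : ι) :
    SL2Nondegenerate (ζ i) (rho b (fun i => ratOf (Λ i)) (fun i => ratOf (q.qp i)) i)
      (q.cartanCoeff i) := by
  have hrho : rho b (fun i => ratOf (Λ i)) (fun i => ratOf (q.qp i)) i =
      ratOf (Λ i * ∏ k ∈ Finset.univ.erase i, q.qp k ^ (-cartan b k i).toNat) := by
    simp only [rho, ratOf, map_mul, map_prod, map_pow]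
    congr 1
    refine Finset.prod_congr rfl fun k hk => ?_
    have h1 := cartan_nonpos b (Finset.ne_of_mem_erase hk)
    rw [← zpow_natCast, Int.toNat_of_nonneg (by omega)]
  refine ⟨ratOf (q.qp i), rfl, ⟨fun _ => q.nondeg.ne_zero i, fun _ => q.nondeg.simple_zero i,
    fun _ => q.nondeg.simple_pole i, fun _ c hc => ⟨?_, not_isPoleAt_ratOf _ _⟩,
    fun _ _ h => absurd rfl h⟩, q.qp i, rfl⟩
  rw [hrho, isZeroAt_ratOf, Polynomial.IsRoot, Polynomial.eval_mul, mul_eq_zero,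
    Polynomial.eval_prod, Finset.prod_eq_zero_iff] at hc
  rcases hc with hc | ⟨k, hk, hc⟩
  · exact (q.nondeg.disjoint_sing i c (isZeroAt_ratOf.2 hc)).1
  · rw [Polynomial.eval_pow] at hc
    have hroot : (q.qp k).IsRoot c := eq_zero_of_pow_eq_zero hc
    have hne : cartan b k i ≠ 0 := by
      intro h0
      rw [h0, neg_zero, Int.toNat_zero, pow_zero] at hc
      exact one_ne_zero hc
    exact fun h => q.nondeg.disjoint_adj k i (Finset.ne_of_mem_erase hk) hne c
      ⟨Or.inl (isZeroAt_ratOf.2 hroot), Or.inl h⟩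

/-- The Miura oper `∂_z + ∑ (ζ_i - (q^i_+)⁻¹ ∂_z q^i_+) α̌_i + ∑ Λ_i e_i` with the standard
reductions. -/
def miuraOper (hΛ : ∀ i, Λ i ≠ 0) : MiuraOper b V where
  A := miuraMatrix b q.cartanCoeff fun i => ratOf (Λ i)
  Fminus := BMinus b V
  Fplus := BPlus b V
  fminus_coset := ⟨1, one_mem _, (one_smul _ _).symm⟩
  fplus_coset := ⟨1, one_mem _, (one_smul _ _).symm⟩
  oper := ⟨fun i => ratOf (Λ i), fun i => RatFunc.algebraMap_ne_zero (hΛ i),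
    hasOperForm_miuraMatrix _ _⟩
  preserved := ⟨1, one_mem _, _, miuraMatrix_mem_bPlus _ _, IsGauge.refl _⟩

theorem isStandardForm_miuraOper (hΛ : ∀ i, Λ i ≠ 0) :
    (q.miuraOper (V := V) hΛ).IsStandardForm Λ 1 q.cartanCoeff :=
  ⟨one_mem _, IsGauge.refl _, one_smul _ _, one_smul _ _⟩

/-- Every solution arises from a nondegenerate datum. -/
theorem exists_corresponds (B : ∀ i, WeightBasis b (V i)) (hΛ : ∀ i, Λ i ≠ 0) :
    ∃ D : MPDatum ν Λ ζ, D.Nondegenerate Λ ζ ∧ Corresponds D q := by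
  obtain ⟨h, hh⟩ := exists_isTorusElement B q.ratOf_qp_ne_zero
  set t := h * ((Finset.univ : Finset ι).toList.map fun i => expo V
    ((-(ratOf (q.qm i) / ratOf (q.qp i))) ⊗ₜ[ℂ] b.e i)).prod
  have hact : ActsBy ν t _ _ := actsBy_torus_mul_prod_expo (ν := ν) B hh
    (fun i => -(ratOf (q.qm i) / ratOf (q.qp i))) (Finset.nodup_toList _) (by simp)
  have ht : t ∈ BPlus b V := torus_mul_prod_expo_mem_BPlus q.ratOf_qp_ne_zero hh _ _
  have hreg : (q.miuraOper (V := V) hΛ).HasRegularSingularities Λ := hasOperForm_miuraMatrix _ _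
  refine ⟨⟨q.miuraOper hΛ, hreg, t • (framingGroup b V : Set (Ambient V)), t,
    ⟨ht, (plucker_iff B q.ratOf_qp_ne_zero hact).2 q.pluckerEq⟩, rfl⟩,
    ⟨1, q.cartanCoeff, _, q.isStandardForm_miuraOper hΛ, fun i => rfl, q.nondeg,
      q.sl2Nondegenerate⟩,
    1, q.cartanCoeff, q.isStandardForm_miuraOper hΛ, t, ?_, hact⟩
  rw [one_smul]
  exact mem_own_leftCoset _ t

end NondegSolution

end Framing

end TwistedOper

end

theorem theorem5p4 {ι : Type*} [Fintype ι] [DecidableEq ι]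
    {𝔤 : Type*} [LieRing 𝔤] [LieAlgebra ℂ 𝔤] [FiniteDimensional ℂ 𝔤] [LieAlgebra.IsSimple ℂ 𝔤]
    {𝔥 : LieSubalgebra ℂ 𝔤} (b : LieAlgebra.Basis ι 𝔥)
    (V : ι → Type*) [∀ i, AddCommGroup (V i)] [∀ i, Module ℂ (V i)]
    [∀ i, FiniteDimensional ℂ (V i)] [∀ i, LieRingModule 𝔤 (V i)] [∀ i, LieModule ℂ 𝔤 (V i)]
    [∀ i, LieModule.IsIrreducible ℂ 𝔤 (V i)] (ν : TwistedOper.FundamentalVectors b V)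
    (Λ : ι → Polynomial ℂ) (hΛ : ∀ i, (Λ i).Monic) (ζ : ι → ℂ) :
    ∃ Φ : TwistedOper.NondegDatumClass ν Λ ζ ≃ TwistedOper.NondegSolution b Λ ζ,
      ∀ (D : TwistedOper.NondegDatum ν Λ ζ) (q : TwistedOper.NondegSolution b Λ ζ),
        Φ D.cls = q →
          -- the oper can be brought to the standard form
          (∃ a g, D.1.IsStandardForm Λ a g) ∧
          -- whenever it is in the standard form, it is given by the `q^i_+`
          ∀ a g, D.1.IsStandardForm Λ a g →
            (∀ i, g i = RatFunc.C (ζ i) -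
              (TwistedOper.ratOf (q.qp i))⁻¹ * TwistedOper.ddz (TwistedOper.ratOf (q.qp i))) ∧
            -- the framing is the class of `∏ (q^i_+) ^ α̌_i ∏ exp (-(q^i_- / q^i_+) e_i)`
            (∃ h : TwistedOper.Ambient V,
              TwistedOper.IsTorusElement b V (fun i => TwistedOper.ratOf (q.qp i)) h ∧
              ∀ l : List ι, l.Nodup → (∀ i, i ∈ l) →
                h * (l.map fun i => TwistedOper.expo V
                  ((-(TwistedOper.ratOf (q.qm i) / TwistedOper.ratOf (q.qp i))) ⊗ₜ[ℂ]
                    b.e i)).prod ∈ a • D.1.framing) ∧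
            -- if the framing is the class of `(∏ y_i ^ α̌_i) n` with `y_i` monic, then `y_i = q^i_+`
            (∀ (y : ι → Polynomial ℂ) (h n : TwistedOper.Ambient V), (∀ i, (y i).Monic) →
              TwistedOper.IsTorusElement b V (fun i => TwistedOper.ratOf (y i)) h →
              n ∈ TwistedOper.NPlus b V → h * n ∈ a • D.1.framing → ∀ i, y i = q.qp i) := by
  have hΛ0 : ∀ i, Λ i ≠ 0 := fun i => (hΛ i).ne_zero
  have B : ∀ i, TwistedOper.WeightBasis b (V i) := fun i =>
    Classical.choice (TwistedOper.exists_weightBasis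
      (TwistedOper.span_isWeightVector_eq_top (ν.isWeightVector_hi i) (ν.ne_zero i)))
  choose F hF using fun D : TwistedOper.NondegDatum ν Λ ζ => TwistedOper.exists_corresponds B D.2
  let Ψ : TwistedOper.NondegDatumClass ν Λ ζ → TwistedOper.NondegSolution b Λ ζ :=
    Quotient.lift F fun D D' h => ((hF D).of_equiv h).unique B hΛ0 (hF D')
  have hΨ : Function.Bijective Ψ := by
    refine ⟨?_, fun q => ?_⟩
    · rintro ⟨D⟩ ⟨D'⟩ h
      have h1 : F D = F D' := h
      have h2 := hF D'
      rw [← h1] at h2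
      exact Quotient.sound ((hF D).equiv B h2)
    · obtain ⟨D, hD, hDq⟩ := q.exists_corresponds (ν := ν) B hΛ0
      exact ⟨TwistedOper.NondegDatum.cls ⟨D, hD⟩, (hF ⟨D, hD⟩).unique B hΛ0 hDq⟩
  refine ⟨Equiv.ofBijective Ψ hΨ, ?_⟩
  intro D q hDq
  have hq : TwistedOper.Corresponds D.1 q := by
    rw [← show F D = q from hDq]
    exact hF D
  have hne := q.ratOf_qp_ne_zero
  refine ⟨?_, fun a g ha => ?_⟩
  · obtain ⟨a, g, ha, -⟩ := hq
    exact ⟨a, g, ha⟩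
  obtain ⟨t, ht, hact⟩ := hq.exists_mem B hΛ0 ha
  obtain ⟨h, hh⟩ := TwistedOper.exists_isTorusElement B hne
  refine ⟨(TwistedOper.MPDatum.pluckerEq B ha ht hne hact).1, ⟨h, hh, fun l hl hl' => ?_⟩, ?_⟩
  · refine TwistedOper.MPDatum.mem_smul_framing ht (Subgroup.mem_sup_right ?_)
    exact TwistedOper.inv_mul_mem_commutator_of_actsBy B (TwistedOper.MPDatum.mem_BPlus ha ht)
      (TwistedOper.torus_mul_prod_expo_mem_BPlus hne hh _ l) hne hact
      (TwistedOper.actsBy_torus_mul_prod_expo B hh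
        (fun i => -(TwistedOper.ratOf (q.qm i) / TwistedOper.ratOf (q.qp i))) hl hl')
  · intro y h' n hy hh' hn hmem i
    obtain ⟨c, hc⟩ := TwistedOper.exists_actsBy_of_mem_NPlus (ν := ν) B hn
    have h1 := hh'.actsBy.mul (fun _ => one_ne_zero) hc
    simp only [mul_one] at h1
    exact congrFun (TwistedOper.MPDatum.eq_of_monic B hmem ht hy q.monic h1 hact).1 i
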